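/- **Setting.** Let $V=\mathbb C^N$. For $X\in\mathrm{End}(V\otimes V)$ let $X_i$ denote $X$ acting in the tensor factors $i,i+1$ of $V^{\otimes n}$. A Yang–Baxter matrix is $R\in\mathrm{Aut}(V\otimes V)$ with $R_1R_2R_1=R_2R_1R_2$. It is skew invertible if there is $\Psi_R\in\mathrm{End}(V\otimes V)$ with $\mathrm{Tr}_{(2)}R_1(\Psi_R)_2=\mathrm{Tr}_{(2)}(\Psi_R)_1R_2=P$ (the permutation), and strict skew invertible if $R$ and $R^{-1}$ are skew invertible; put $D_R:=\mathrm{Tr}_{(2)}\Psi_R\in\mathrm{End}(V)$, and let $\mathrm{Tr}_{R(1,\dots,n)}X:=\mathrm{Tr}\,(D_R^{\otimes n}X)$. A pair $\{R,F\}$ of Yang–Baxter matrices is compatible if $R_1F_2F_1=F_2F_1R_2$ and $R_2F_1F_2=F_1F_2R_1$. The BMW algebra $\mathcal W_n(q,\mu)$ is the quotient of $\mathbb C[\mathcal B_n]$ (braid generators $\sigma_1,\dots,\sigma_{n-1}$) by the relations, with $\kappa_i:=\frac{(q-\sigma_i)(q^{-1}+\sigma_i)}{\mu(q-q^{-1})}$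 and $\eta:=\frac{(q-\mu)(q^{-1}+\mu)}{\mu(q-q^{-1})}$, $$\sigma_i\kappa_i=\kappa_i\sigma_i=\mu\kappa_i,\quad \kappa_i\sigma_{i\pm1}^{\epsilon}=\kappa_i\kappa_{i\pm1}\sigma_i^{-\epsilon},\quad \sigma_{i\pm1}^{\epsilon}\kappa_i=\sigma_i^{-\epsilon}\kappa_{i\pm1}\kappa_i\ (\epsilon=\pm1),\quad \kappa_i\kappa_{i\pm1}\kappa_i=\kappa_i,\quad \kappa_i^2=\eta\kappa_i .$$ $R$ is of BMW type if for all $n$ the map $\sigma_i\mapsto R_i$ extends to a representation $\rho_R$ of $\mathcal W_n(q,\mu)$ on $V^{\otimes n}$. With $\sigma_i^-(x):=1+\frac{x-1}{q-q^{-1}}\sigma_i+\frac{\mu(x-1)}{\mu+qx}\kappa_i$ and $i_q:=\frac{q^i-q^{-i}}{q-q^{-1}}$, the $q$-antisymmetrizers are $a^{(1)}:=1$, $a^{(i+1)}:=\frac{q^i}{(i+1)_q}a^{(i)}\sigma_i^-(q^{-2i})a^{(i)}$; let $x\mapsto x^{\uparrow1}$ be the shift $\sigma_i\mapsto\sigma_{i+1}$.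 For $k\ge2$, $R$ is *orthogonal of type $O(k)$* if it is skew invertible of BMW type with $q\ne0$, $\mu\notin\{0,q\}$, $q^{2i}\neq1$ and $\mu\ne-q^{1-2i}$ for $i=1,\dots,k$; $\mathrm{rk}\,\rho_R(a^{(i)})\neq0$ for $2\le i\le k$ and $\rho_R(a^{(k)\uparrow1}\sigma_1^-(q^{-2k})a^{(k)\uparrow1})=0$; $\mu=q^{1-k}$; and $\mathrm{rk}\,\rho_R(a^{(k)})=1$. Let $\{R,F\}$ be a compatible pair of strict skew invertible Yang–Baxter matrices with $R$ of type $O(k)$. The quantum matrix algebra $\mathcal M(R,F)$ is the unital associative $\mathbb C$-algebra generated by the entries of $M=\|M^a_b\|_{a,b=1}^N$ with relations $R_1M_{\bar1}M_{\bar2}=M_{\bar1}M_{\bar2}R_1$, where $M_{\bar1}:=M_1$ and $M_{\overline{i+1}}:=F_iM_{\bar i}F_i^{-1}$. Set $$g:=\mu^2\eta^{-1}\,\mathrm{Tr}_{(1,2)}\big(M_{\bar1}M_{\bar2}\,\rho_R(\kappa_1)\big),\qquad e_0:=1,\quad e_i:=\mathrm{Tr}_{R(1,\dots,i)}\big(M_{\bar1}\cdots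 M_{\bar i}\,\rho_R(a^{(i)})\big)\ (i\geq1).$$ Let $O_k(R,F)$ be the algebra obtained from $\mathcal M(R,F)$ by adjoining an inverse $g^{-1}$ of $g$. **Theorem (resolution of the reciprocal relations).** 1. Let $k=2\ell$ and assume that $g^{-\ell}e_{2\ell}$ is central in $O_{2\ell}(R,F)$. Let $O^{\pm}_{2\ell}(R,F)$ be the quotient of $O_{2\ell}(R,F)$ by the relation $g^{-\ell}e_{2\ell}=\pm1$. Then in $O^{\pm}_{2\ell}(R,F)$ the reciprocal relations $g^{k-i}e_i=e_ke_{k-i}$ $(0\le i\le k-1)$ hold and are resolved by $$e_{\ell+i}=\pm g^i e_{\ell-i},\qquad i=0,1,\dots,\ell,$$ respectively. In particular $e_\ell=0$ in $O^-_{2\ell}(R,F)$. 2. Let $k=2\ell-1$ and put $g^{1/2}:=g^{1-\ell}e_{2\ell-1}\in O_{2\ell-1}(R,F)$. Then in $O_{2\ell-1}(R,F)$ the reciprocal relations $g^{k-i}e_i=e_ke_{k-i}$ $(0\le i\le k-1)$ hold, $(g^{1/2})^2=g$, $e_{2\ell-1}=(g^{1/2})^{2\ell-1}$, and $$e_{\ell+i}=g^{i+1/2}e_{\ell-1-i},\qquad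 i=0,1,\dots,\ell-1,$$ where $g^{i+1/2}:=(g^{1/2})^{2i+1}$. -/

import Mathlib

open scoped BigOperators

noncomputable section

namespace QMA

/-! ## Birman-Murakami-Wenzl algebras

The elements `κ`, `σ⁻(x)` and `a^{(i)}` are noncommutative expressions in the braid generators. They
are written over an arbitrary `ℂ`-algebra `A`, so that the same formula gives the element of the BMW
algebra and, evaluated on the operators `R_i`, its image in the Yang-Baxter representation. -/

section Elements

variable {A B : Type*} [Ring A] [Algebra ℂ A] [Ring B] [Algebra ℂ B]

/-- `κ = (q - σ)(q⁻¹ + σ) / (μ (q - q⁻¹))`. -/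
def kappa (q μ : ℂ) (s : A) : A :=
  (μ * (q - q⁻¹))⁻¹ • ((algebraMap ℂ A q - s) * (algebraMap ℂ A q⁻¹ + s))

/-- `η = (q - μ)(q⁻¹ + μ) / (μ (q - q⁻¹))`. -/
def eta (q μ : ℂ) : ℂ := (q - μ) * (q⁻¹ + μ) / (μ * (q - q⁻¹))

/-- The `q`-number `i_q`. -/
def qNum (q : ℂ) (i : ℕ) : ℂ := (q ^ i - (q⁻¹) ^ i) / (q - q⁻¹)

/-- The baxterized element `σ⁻(x) = 1 + (x-1)/(q-q⁻¹) σ + μ(x-1)/(μ + q x) κ`. -/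
def baxMinus (q μ : ℂ) (s : A) (x : ℂ) : A :=
  1 + ((x - 1) / (q - q⁻¹)) • s + (μ * (x - 1) / (μ + q * x)) • kappa q μ s

/-- The `q`-antisymmetrizers: `a^{(1)} = 1` and
`a^{(i+1)} = q^i / (i+1)_q · a^{(i)} σ_i⁻(q^{-2i}) a^{(i)}`.
The braid generators are numbered from `0`: `σ 0, σ 1, …` are `σ_1, σ_2, …`. -/
def antisymmetrizer (q μ : ℂ) (σ : ℕ → A) : ℕ → A
  | 0 => 1
  | 1 => 1
  | m + 2 =>
      (q ^ (m + 1) / qNum q (m + 2)) •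
        (antisymmetrizer q μ σ (m + 1) * baxMinus q μ (σ m) ((q⁻¹) ^ (2 * (m + 1))) *
          antisymmetrizer q μ σ (m + 1))

theorem map_kappa (f : A →ₐ[ℂ] B) (q μ : ℂ) (s : A) : f (kappa q μ s) = kappa q μ (f s) := by
  simp [kappa]

theorem map_baxMinus (f : A →ₐ[ℂ] B) (q μ : ℂ) (s : A) (x : ℂ) :
    f (baxMinus q μ s x) = baxMinus q μ (f s) x := by
  simp [baxMinus, map_kappa]

theorem map_antisymmetrizer (f : A →ₐ[ℂ] B) (q μ : ℂ) (σ : ℕ → A) (i : ℕ) :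
    f (antisymmetrizer q μ σ i) = antisymmetrizer q μ (fun j => f (σ j)) i := by
  induction i using Nat.strong_induction_on with
  | _ i ih =>
    match i, ih with
    | 0, _ => simp [antisymmetrizer]
    | 1, _ => simp [antisymmetrizer]
    | m + 2, ih => simp [antisymmetrizer, map_baxMinus, ih (m + 1) (by omega)]

end Elements

/-- The generators `σ_i` and `σ_i⁻¹`, `1 ≤ i ≤ n - 1` (numbered from `0`). -/
inductive BMWGen (n : ℕ) : Type
  | sigma (i : Fin (n - 1)) : BMWGen n
  | sigmaInv (i : Fin (n - 1)) : BMWGen n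

section BMW

variable (q μ : ℂ) (n : ℕ)

/-- `σ_i` in the free algebra. -/
abbrev freeS (i : Fin (n - 1)) : FreeAlgebra ℂ (BMWGen n) := FreeAlgebra.ι ℂ (BMWGen.sigma i)

/-- `σ_i⁻¹` in the free algebra. -/
abbrev freeSInv (i : Fin (n - 1)) : FreeAlgebra ℂ (BMWGen n) := FreeAlgebra.ι ℂ (BMWGen.sigmaInv i)

/-- `κ_i` in the free algebra. -/
abbrev freeK (i : Fin (n - 1)) : FreeAlgebra ℂ (BMWGen n) := kappa q μ (freeS n i)

/-- `|i - j| = 1`. -/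
def Adjacent {m : ℕ} (i j : Fin m) : Prop := i.val + 1 = j.val ∨ j.val + 1 = i.val

/-- The defining relations of the BMW algebra `W_n(q, μ)`. -/
inductive BMWRel : FreeAlgebra ℂ (BMWGen n) → FreeAlgebra ℂ (BMWGen n) → Prop
  | mul_inv (i) : BMWRel (freeS n i * freeSInv n i) 1
  | inv_mul (i) : BMWRel (freeSInv n i * freeS n i) 1
  | braid (i j) (h : Adjacent i j) :
      BMWRel (freeS n i * freeS n j * freeS n i) (freeS n j * freeS n i * freeS n j)
  | comm (i j) (h : i.val + 1 < j.val ∨ j.val + 1 < i.val) :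
      BMWRel (freeS n i * freeS n j) (freeS n j * freeS n i)
  | sigma_kappa (i) : BMWRel (freeS n i * freeK q μ n i) (μ • freeK q μ n i)
  | kappa_sigma (i) : BMWRel (freeK q μ n i * freeS n i) (μ • freeK q μ n i)
  | kappa_sigma_adj (i j) (h : Adjacent i j) :
      BMWRel (freeK q μ n i * freeS n j) (freeK q μ n i * freeK q μ n j * freeSInv n i)
  | kappa_sigmaInv_adj (i j) (h : Adjacent i j) :
      BMWRel (freeK q μ n i * freeSInv n j) (freeK q μ n i * freeK q μ n j * freeS n i)
  | sigma_kappa_adj (i j) (h : Adjacent i j) :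
      BMWRel (freeS n j * freeK q μ n i) (freeSInv n i * freeK q μ n j * freeK q μ n i)
  | sigmaInv_kappa_adj (i j) (h : Adjacent i j) :
      BMWRel (freeSInv n j * freeK q μ n i) (freeS n i * freeK q μ n j * freeK q μ n i)
  | kappa_kappa_kappa (i j) (h : Adjacent i j) :
      BMWRel (freeK q μ n i * freeK q μ n j * freeK q μ n i) (freeK q μ n i)
  | kappa_sq (i) : BMWRel (freeK q μ n i * freeK q μ n i) (eta q μ • freeK q μ n i)

/-- The BMW algebra `W_n(q, μ)`. -/
abbrev BMWAlgebra : Type := RingQuot (BMWRel q μ n)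

/-- The generator `σ_i` of `W_n(q, μ)`. -/
def bmwSigma (i : Fin (n - 1)) : BMWAlgebra q μ n :=
  RingQuot.mkAlgHom ℂ (BMWRel q μ n) (freeS n i)

end BMW

/-! ## Yang-Baxter matrices

`V = ℂ^N`. Operators on `V ⊗ V` are matrices indexed by `Fin N × Fin N`, and operators on `V^{⊗n}`
are matrices indexed by `Fin n → Fin N`. -/

/-- Operators on `V ⊗ V`. -/
abbrev TwoOp (N : ℕ) : Type := Matrix (Fin N × Fin N) (Fin N × Fin N) ℂ

/-- Matrices in `End(V^{⊗n}) ⊗ A`. -/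
abbrev TensorMat (N n : ℕ) (A : Type*) : Type _ := Matrix (Fin n → Fin N) (Fin n → Fin N) A

variable {N : ℕ}

/-- The operator `X_{i+1} = I^{⊗ i} ⊗ X ⊗ I^{⊗ (n-i-2)}` on `V^{⊗n}` (tensor factors are numbered
from `0`, so `siteOp n X 0` is `X_1`); the value `1` for `i + 1 ≥ n` is never used. -/
def siteOp (n : ℕ) (X : TwoOp N) (i : ℕ) : TensorMat N n ℂ :=
  if h : i + 1 < n then
    Matrix.of fun a b =>
      if ∀ j : Fin n, j.val ≠ i → j.val ≠ i + 1 → a j = b j then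
        X (a ⟨i, by omega⟩, a ⟨i + 1, h⟩) (b ⟨i, by omega⟩, b ⟨i + 1, h⟩)
      else 0
  else 1

/-- A Yang-Baxter matrix: an invertible operator with `R_1 R_2 R_1 = R_2 R_1 R_2`. -/
def IsYangBaxter (R : TwoOp N) : Prop :=
  IsUnit R ∧
    siteOp 3 R 0 * siteOp 3 R 1 * siteOp 3 R 0 = siteOp 3 R 1 * siteOp 3 R 0 * siteOp 3 R 1

/-- A Yang-Baxter matrix of BMW type: for every `n` the assignment `σ_i ↦ R_i` extends to a
representation of `W_n(q, μ)` on `V^{⊗n}`. -/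
def IsBMWType (R : TwoOp N) (q μ : ℂ) : Prop :=
  ∀ n : ℕ, ∃ ρ : BMWAlgebra q μ n →ₐ[ℂ] TensorMat N n ℂ,
    ∀ i : Fin (n - 1), ρ (bmwSigma q μ n i) = siteOp n R i.val

/-- `Ψ` is a skew inverse of `R`: `Tr_(2) R_1 Ψ_2 = Tr_(2) Ψ_1 R_2 = P`, written in components. -/
def IsSkewInverse (R Ψ : TwoOp N) : Prop :=
  (∀ a b c d : Fin N,
    ∑ s, ∑ t, R (a, s) (c, t) * Ψ (t, b) (s, d) = if a = d ∧ b = c then 1 else 0) ∧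
  (∀ a b c d : Fin N,
    ∑ s, ∑ t, Ψ (a, s) (c, t) * R (t, b) (s, d) = if a = d ∧ b = c then 1 else 0)

/-- Skew invertibility. -/
def IsSkewInvertible (R : TwoOp N) : Prop := ∃ Ψ, IsSkewInverse R Ψ

/-- Strict skew invertibility: `R` and `R⁻¹` are skew invertible. -/
def IsStrictSkewInvertible (R : TwoOp N) : Prop := IsSkewInvertible R ∧ IsSkewInvertible R⁻¹

open Classical in
/-- The skew inverse `Ψ_R` (it is unique when it exists). -/
def skewInverse (R : TwoOp N) : TwoOp N :=
  if h : IsSkewInvertible R then h.choose else 0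

/-- `D_R = Tr_(2) Ψ_R`. -/
def dMatrix (R : TwoOp N) : Matrix (Fin N) (Fin N) ℂ :=
  Matrix.of fun a b => ∑ s, skewInverse R (a, s) (b, s)

/-- A compatible pair of strict skew invertible Yang-Baxter matrices. -/
structure IsCompatiblePair (R F : TwoOp N) : Prop where
  yangBaxter_R : IsYangBaxter R
  yangBaxter_F : IsYangBaxter F
  strict_R : IsStrictSkewInvertible R
  strict_F : IsStrictSkewInvertible F
  twist_left : siteOp 3 R 0 * siteOp 3 F 1 * siteOp 3 F 0 =
    siteOp 3 F 1 * siteOp 3 F 0 * siteOp 3 R 1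
  twist_right : siteOp 3 R 1 * siteOp 3 F 0 * siteOp 3 F 1 =
    siteOp 3 F 0 * siteOp 3 F 1 * siteOp 3 R 0

/-- `ρ_R(a^{(i)})` as an operator on `V^{⊗n}`, `i ≤ n`. -/
def antisymOp (R : TwoOp N) (q μ : ℂ) (n i : ℕ) : TensorMat N n ℂ :=
  antisymmetrizer q μ (siteOp n R) i

/-- `antisymOp` is the image of `a^{(i)} ∈ W_n` under every representation with `σ_j ↦ R_j`. -/
theorem antisymOp_eq_map (R : TwoOp N) (q μ : ℂ) (n i : ℕ)
    (ρ : BMWAlgebra q μ n →ₐ[ℂ] TensorMat N n ℂ)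
    (hρ : ∀ i : Fin (n - 1), ρ (bmwSigma q μ n i) = siteOp n R i.val) :
    ρ (antisymmetrizer q μ (fun j => if h : j < n - 1 then bmwSigma q μ n ⟨j, h⟩ else 1) i) =
      antisymOp R q μ n i := by
  rw [map_antisymmetrizer, antisymOp]
  congr 1
  funext j
  split_ifs with h
  · rw [hρ]
  · rw [map_one, siteOp, dif_neg (by omega)]

/-- `R` is a Yang-Baxter matrix of height `k`: a skew invertible matrix of BMW type, with the
restrictions on `q` and `μ` that make `a^{(2)}, …, a^{(k)}` and `σ⁻(q^{-2k})` well defined, such that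
`rk ρ_R(a^{(i)}) ≠ 0` for `2 ≤ i ≤ k` and `ρ_R(a^{(k)↑1} σ_1⁻(q^{-2k}) a^{(k)↑1}) = 0`. -/
structure HasHeight (R : TwoOp N) (q μ : ℂ) (k : ℕ) : Prop where
  two_le : 2 ≤ k
  q_ne_zero : q ≠ 0
  q_pow_ne_one : ∀ i ∈ Finset.Icc 1 k, q ^ (2 * i) ≠ 1
  μ_ne_zero : μ ≠ 0
  μ_ne_q : μ ≠ q
  μ_ne_neg : ∀ i ∈ Finset.Icc 1 k, μ ≠ -q ^ (-2 * (i : ℤ) + 1)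
  bmw : IsBMWType R q μ
  skew : IsSkewInvertible R
  rank_ne_zero : ∀ i ∈ Finset.Icc 2 k, (antisymOp R q μ i i).rank ≠ 0
  vanish :
    antisymmetrizer q μ (fun j => siteOp (k + 1) R (j + 1)) k *
        baxMinus q μ (siteOp (k + 1) R 0) ((q⁻¹) ^ (2 * k)) *
        antisymmetrizer q μ (fun j => siteOp (k + 1) R (j + 1)) k = 0

/-- `R` is an orthogonal Yang-Baxter matrix of type `O(k)`. -/
structure IsOrthogonalType (R : TwoOp N) (q μ : ℂ) (k : ℕ) : Prop where
  height : HasHeight R q μ k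
  μ_eq : μ = q ^ (1 - (k : ℤ))
  rank_one : (antisymOp R q μ k k).rank = 1

/-! ## Quantum matrices and elementary sums

`M` is an `N × N` matrix over a `ℂ`-algebra `A`. -/

section Copies

variable {A : Type*} [Ring A] [Algebra ℂ A]

/-- A numerical operator as a matrix over `A`. -/
def numMat (A : Type*) [Ring A] [Algebra ℂ A] {n : ℕ} (X : TensorMat N n ℂ) : TensorMat N n A :=
  X.map (algebraMap ℂ A)

/-- `M_1 = M ⊗ I^{⊗(n-1)}`. -/
def firstCopy (n : ℕ) (M : Matrix (Fin N) (Fin N) A) : TensorMat N n A :=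
  if h : 0 < n then
    Matrix.of fun a b =>
      if ∀ j : Fin n, j.val ≠ 0 → a j = b j then M (a ⟨0, h⟩) (b ⟨0, h⟩) else 0
  else 1

/-- The copies `M_{\bar 1} = M_1`, `M_{\overline{i+1}} = F_i M_{\bar i} F_i⁻¹` on `V^{⊗n}`
(numbered from `0`). -/
def matCopy (F : TwoOp N) (n : ℕ) (M : Matrix (Fin N) (Fin N) A) : ℕ → TensorMat N n A
  | 0 => firstCopy n M
  | i + 1 => numMat A (siteOp n F i) * matCopy F n M i * numMat A (siteOp n F⁻¹ i)

/-- The ordered product `M_{\bar 1} M_{\bar 2} ⋯ M_{\bar n}` on `V^{⊗n}`. -/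
def matString (F : TwoOp N) (n : ℕ) (M : Matrix (Fin N) (Fin N) A) : TensorMat N n A :=
  ((List.range n).map (matCopy F n M)).prod

/-- The R-trace over all tensor factors, `X ↦ Tr (D_R ⊗ ⋯ ⊗ D_R) X`. -/
def rTrace (R : TwoOp N) (n : ℕ) (X : TensorMat N n A) : A :=
  (numMat A (Matrix.of fun a b => ∏ j, dMatrix R (a j) (b j)) * X).trace

/-- The elementary sums `e_0 = 1`,
`e_i = ch(a^{(i)}) = Tr_R_{(1,…,i)} M_{\bar 1} ⋯ M_{\bar i} ρ_R(a^{(i)})`. -/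
def elemSum (R F : TwoOp N) (q μ : ℂ) (M : Matrix (Fin N) (Fin N) A) : ℕ → A
  | 0 => 1
  | i + 1 => rTrace R (i + 1) (matString F (i + 1) M * numMat A (antisymOp R q μ (i + 1) (i + 1)))

/-- The contraction `g = μ² Tr_{(1,2)} (M_{\bar 1} M_{\bar 2} ρ_R(c^{(2)}))`, where
`c^{(2)} = η⁻¹ κ_1`. -/
def contraction (R F : TwoOp N) (q μ : ℂ) (M : Matrix (Fin N) (Fin N) A) : A :=
  (μ ^ 2) • (matString F 2 M *
    numMat A ((eta q μ)⁻¹ • kappa q μ (siteOp 2 R 0))).trace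

end Copies

/-! ## The extended quantum matrix algebra and its components -/

section Algebras

variable (R F : TwoOp N) (q μ : ℂ)

/-- The free algebra on the symbols `M^a_b` (`some (a, b)`) and `g⁻¹` (`none`). -/
abbrev ExtFree (N : ℕ) : Type := FreeAlgebra ℂ (Option (Fin N × Fin N))

/-- The matrix of generators. -/
def freeM (N : ℕ) : Matrix (Fin N) (Fin N) (ExtFree N) :=
  Matrix.of fun a b => FreeAlgebra.ι ℂ (some (a, b))

/-- The relations `R_1 M_{\bar 1} M_{\bar 2} = M_{\bar 1} M_{\bar 2} R_1` of the quantum matrix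
algebra, together with `g⁻¹ g = g g⁻¹ = 1`. -/
inductive ExtRel : ExtFree N → ExtFree N → Prop
  | qma (a b : Fin 2 → Fin N) :
      ExtRel ((numMat (ExtFree N) (siteOp 2 R 0) * matString F 2 (freeM N)) a b)
        ((matString F 2 (freeM N) * numMat (ExtFree N) (siteOp 2 R 0)) a b)
  | inv_mul :
      ExtRel (FreeAlgebra.ι ℂ none * contraction R F q μ (freeM N)) 1
  | mul_inv :
      ExtRel (contraction R F q μ (freeM N) * FreeAlgebra.ι ℂ none) 1

/-- The quantum matrix algebra extended by the inverse of the contraction; when `R` is of type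
`O(k)` this is `O_k(R, F)`. -/
abbrev ExtAlgebra : Type := RingQuot (ExtRel R F q μ)

/-- The quantum matrix `M` over the extended algebra. -/
def quantumMatrix : Matrix (Fin N) (Fin N) (ExtAlgebra R F q μ) :=
  (freeM N).map (RingQuot.mkAlgHom ℂ (ExtRel R F q μ))

/-- The contraction `g` in the extended algebra. -/
def g : ExtAlgebra R F q μ := contraction R F q μ (quantumMatrix R F q μ)

/-- The generator `g⁻¹` of the extended algebra. -/
def gInv : ExtAlgebra R F q μ :=
  RingQuot.mkAlgHom ℂ (ExtRel R F q μ) (FreeAlgebra.ι ℂ none)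

/-- The elementary sum `e_i` in the extended algebra. -/
def e (i : ℕ) : ExtAlgebra R F q μ := elemSum R F q μ (quantumMatrix R F q μ) i

/-- The element `g^{-ℓ} e_{2ℓ}`. -/
def signElement (ℓ : ℕ) : ExtAlgebra R F q μ := gInv R F q μ ^ ℓ * e R F q μ (2 * ℓ)

/-- The relation `g^{-ℓ} e_{2ℓ} = ε`, where `ε = ±1`. -/
inductive ComponentRel (ℓ : ℕ) (ε : ℤˣ) : ExtAlgebra R F q μ → ExtAlgebra R F q μ → Prop
  | sign : ComponentRel ℓ ε (signElement R F q μ ℓ) ((ε : ℤ) : ExtAlgebra R F q μ)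

/-- The component `O^ε_{2ℓ}(R, F)`. -/
abbrev Component (ℓ : ℕ) (ε : ℤˣ) : Type := RingQuot (ComponentRel R F q μ ℓ ε)

/-- The projection of the extended algebra onto its component. -/
def toComponent (ℓ : ℕ) (ε : ℤˣ) : ExtAlgebra R F q μ →ₐ[ℂ] Component R F q μ ℓ ε :=
  RingQuot.mkAlgHom ℂ (ComponentRel R F q μ ℓ ε)

/-- The element `g^{1/2} = g^{1-ℓ} e_{2ℓ-1}`, for `ℓ ≥ 1`. -/
def gHalf (ℓ : ℕ) : ExtAlgebra R F q μ := gInv R F q μ ^ (ℓ - 1) * e R F q μ (2 * ℓ - 1)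

end Algebras

end QMA

end

/-! Everything rests on two facts in the extended algebra: g commutes with every e_i, and e_k e_m =
e_d g^m whenever d + m = k (`e_mul_e`). The reciprocal relations are the second fact with d = i.
Both resolutions follow from it by cancelling powers of the invertible g, once e_k is written
through g.

Call a family of linear maps τ on the images of the algebras W_n a character if it is cyclic and
multiplicative under juxtaposition of tensor factors (`IsCharacter`). The maps x ↦ Tr_R(M_1 ⋯ M_n
x), with the twisted copies of M, form a character; so do the plain matrix traces, whose values on
idempotents are ranks. On V^{⊗(k+m)} compare P = a^{(k)} ⊗ a^{(m)} with Q, the product of m nested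
contractions and a^{(d)}. Put p = η⁻¹ κ_1. A character sends P to τ(a^{(k)}) τ(a^{(m)}) and Q to
η^{2m} τ(a^{(d)}) τ(p)^m (`IsCharacter.apply_nest`).

In the BMW algebra P² = P, Q² = η^{2m} Q and QPQ = cQ with c ≠ 0 (`antisymmetrizer_nest_equiv`):
each contraction lowers the antisymmetrizer by one, and nested contractions identify mirror
generators, so that a^{(m)} is absorbed by a^{(k)}. Hence E = P - c⁻¹ PQP is an idempotent and its
plain trace is a natural number. Since rk a^{(k)} = 1, this says rk a^{(d)} (rk p)^m ≤ rk a^{(m)}.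
For d = 0 it forces rk p = 1; exchanging d and m then gives rk a^{(d)} = rk a^{(m)}, so E has trace
zero and vanishes. Now PQP = cP, and every character agrees on P and η^{-2m} Q. For the quantum
matrix this is e_k e_m = e_d g^m.

Three further points are needed. Multiplicativity for the quantum matrix: the weighted trace over
the factors n+1, …, n+m of the corresponding copies of M is a scalar independent of n, because a
product of operators F_i moves both the copies and the trace (`segTrace_copySeg`). The element g,
defined with a plain trace, is the R-trace character of p, because p has rank one and commutes with
D_R ⊗ D_R, which therefore acts on its image by a scalar, equal to μ² (`rTrace_kappa`). Finally g
commutes with e_i because the chain κ_1 ⋯ κ_{i+1} carries a contraction from one end of a^{(i)} to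
the other. If κ_1 acts as zero, then g = 0 is invertible and the algebra is trivial. -/

noncomputable section

namespace QMA

/-! ## Families of BMW generators -/

section Family

variable {A : Type*} [Ring A] [Algebra ℂ A]

/-- Elements `s i` with inverses `t i`, `i + 1 < n`, that satisfy the relations of `W_n(q, μ)`. -/
structure BMWFamily (q μ : ℂ) (n : ℕ) (s t : ℕ → A) : Prop where
  mul_inv : ∀ i, i + 1 < n → s i * t i = 1
  inv_mul : ∀ i, i + 1 < n → t i * s i = 1
  braid : ∀ i, i + 2 < n → s i * s (i + 1) * s i = s (i + 1) * s i * s (i + 1)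
  comm : ∀ i j, i + 1 < j → j + 1 < n → Commute (s i) (s j)
  sk : ∀ i, i + 1 < n → s i * kappa q μ (s i) = μ • kappa q μ (s i)
  ks : ∀ i, i + 1 < n → kappa q μ (s i) * s i = μ • kappa q μ (s i)
  ks_adj : ∀ i j, i + 1 < n → j + 1 < n → (i + 1 = j ∨ j + 1 = i) →
    kappa q μ (s i) * s j = kappa q μ (s i) * kappa q μ (s j) * t i
  kt_adj : ∀ i j, i + 1 < n → j + 1 < n → (i + 1 = j ∨ j + 1 = i) →
    kappa q μ (s i) * t j = kappa q μ (s i) * kappa q μ (s j) * s i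
  sk_adj : ∀ i j, i + 1 < n → j + 1 < n → (i + 1 = j ∨ j + 1 = i) →
    s j * kappa q μ (s i) = t i * kappa q μ (s j) * kappa q μ (s i)
  tk_adj : ∀ i j, i + 1 < n → j + 1 < n → (i + 1 = j ∨ j + 1 = i) →
    t j * kappa q μ (s i) = s i * kappa q μ (s j) * kappa q μ (s i)
  kkk : ∀ i j, i + 1 < n → j + 1 < n → (i + 1 = j ∨ j + 1 = i) →
    kappa q μ (s i) * kappa q μ (s j) * kappa q μ (s i) = kappa q μ (s i)
  kk : ∀ i, i + 1 < n → kappa q μ (s i) * kappa q μ (s i) = eta q μ • kappa q μ (s i)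

theorem Commute.kappa_right {q μ : ℂ} {x s : A} (h : Commute x s) : Commute x (kappa q μ s) := by
  unfold kappa
  refine Commute.smul_right (Commute.mul_right ?_ ?_) _
  · exact Commute.sub_right (Algebra.commutes _ _).symm h
  · exact Commute.add_right (Algebra.commutes _ _).symm h

theorem Commute.baxMinus_right {q μ : ℂ} {x s : A} (h : Commute x s) (y : ℂ) :
    Commute x (baxMinus q μ s y) := by
  unfold baxMinus
  exact ((Commute.one_right x).add_right (h.smul_right _)).add_right
    ((Commute.kappa_right h).smul_right _)

theorem Commute.antisymmetrizer_right {q μ : ℂ} {x : A} {s : ℕ → A} (m : ℕ)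
    (h : ∀ i, i + 1 < m → Commute x (s i)) : Commute x (antisymmetrizer q μ s m) := by
  induction m using Nat.strong_induction_on with
  | _ m ih =>
    match m, ih, h with
    | 0, _, _ => simp [antisymmetrizer]
    | 1, _, _ => simp [antisymmetrizer]
    | m + 2, ih, h =>
      have h1 := ih (m + 1) (by omega) fun i hi => h i (by omega)
      exact Commute.smul_right
        ((h1.mul_right (Commute.baxMinus_right (h m (by omega)) _)).mul_right h1) _

/-- The definition of κ read backwards: a quadratic relation for σ with a κ-correction, used to
reduce words. -/
theorem sq_eq_of_kappa {q μ : ℂ} (hq : q ≠ 0) (hμ : μ ≠ 0) (hl : q - q⁻¹ ≠ 0) (s : A) :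
    s * s = 1 + (q - q⁻¹) • s - (μ * (q - q⁻¹)) • kappa q μ s := by
  have : (μ * (q - q⁻¹)) • kappa q μ s = (algebraMap ℂ A q - s) * (algebraMap ℂ A q⁻¹ + s) := by
    rw [kappa, smul_smul, mul_inv_cancel₀ (mul_ne_zero hμ hl), one_smul]
  rw [this]
  simp only [Algebra.algebraMap_eq_smul_one, mul_add, sub_mul, smul_mul_assoc, one_mul,
    mul_smul_comm, mul_one, sub_smul]
  match_scalars <;> field_simp <;> ring

namespace BMWFamily

variable {q μ : ℂ} {n : ℕ} {s t : ℕ → A}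

theorem mono {m : ℕ} (h : BMWFamily q μ n s t) (hm : m ≤ n) : BMWFamily q μ m s t where
  mul_inv i hi := h.mul_inv i (by omega)
  inv_mul i hi := h.inv_mul i (by omega)
  braid i hi := h.braid i (by omega)
  comm i j hi hj := h.comm i j hi (by omega)
  sk i hi := h.sk i (by omega)
  ks i hi := h.ks i (by omega)
  ks_adj i j hi hj := h.ks_adj i j (by omega) (by omega)
  kt_adj i j hi hj := h.kt_adj i j (by omega) (by omega)
  sk_adj i j hi hj := h.sk_adj i j (by omega) (by omega)
  tk_adj i j hi hj := h.tk_adj i j (by omega) (by omega)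
  kkk i j hi hj := h.kkk i j (by omega) (by omega)
  kk i hi := h.kk i (by omega)

theorem shift {m : ℕ} (h : BMWFamily q μ (n + m) s t) :
    BMWFamily q μ m (fun i => s (n + i)) (fun i => t (n + i)) where
  mul_inv i hi := h.mul_inv _ (by omega)
  inv_mul i hi := h.inv_mul _ (by omega)
  braid i hi := h.braid (n + i) (by omega)
  comm i j hi hj := h.comm _ _ (by omega) (by omega)
  sk i hi := h.sk _ (by omega)
  ks i hi := h.ks _ (by omega)
  ks_adj i j hi hj _ := h.ks_adj _ _ (by omega) (by omega) (by omega)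
  kt_adj i j hi hj _ := h.kt_adj _ _ (by omega) (by omega) (by omega)
  sk_adj i j hi hj _ := h.sk_adj _ _ (by omega) (by omega) (by omega)
  tk_adj i j hi hj _ := h.tk_adj _ _ (by omega) (by omega) (by omega)
  kkk i j hi hj _ := h.kkk _ _ (by omega) (by omega) (by omega)
  kk i hi := h.kk _ (by omega)

section

variable (h : BMWFamily q μ n s t) (hq : q ≠ 0) (hμ : μ ≠ 0) (hl : q - q⁻¹ ≠ 0)
include h

theorem kt (hμ : μ ≠ 0) {i : ℕ} (hi : i + 1 < n) :
    kappa q μ (s i) * t i = μ⁻¹ • kappa q μ (s i) := by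
  have := congrArg (fun z => μ⁻¹ • (z * t i)) (h.ks i hi)
  simp only [mul_assoc, h.mul_inv i hi, mul_one, smul_mul_assoc, smul_smul, inv_mul_cancel₀ hμ,
    one_smul] at this
  exact this.symm

theorem tk (hμ : μ ≠ 0) {i : ℕ} (hi : i + 1 < n) :
    t i * kappa q μ (s i) = μ⁻¹ • kappa q μ (s i) := by
  have := congrArg (fun z => μ⁻¹ • (t i * z)) (h.sk i hi)
  simp only [← mul_assoc, h.inv_mul i hi, one_mul, mul_smul_comm, smul_smul, inv_mul_cancel₀ hμ,
    one_smul] at this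
  exact this.symm

-- The skein relation, obtained by multiplying the quadratic relation by σ⁻¹. It makes σ⁻¹ a linear
-- combination of 1, σ and κ.
include hq hμ hl in
theorem inv_eq {i : ℕ} (hi : i + 1 < n) :
    t i = s i - (q - q⁻¹) • (1 : A) + (q - q⁻¹) • kappa q μ (s i) := by
  have h1 := congrArg (· * t i) (sq_eq_of_kappa hq hμ hl (s i))
  simp only [add_mul, sub_mul, smul_mul_assoc, one_mul, h.kt hμ hi, smul_smul] at h1
  rw [mul_assoc, h.mul_inv i hi, mul_one, mul_right_comm, mul_inv_cancel₀ hμ, one_mul] at h1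
  generalize kappa q μ (s i) = e at h1 ⊢
  rw [h1]
  module

/-- `κ_i κ_j σ_i = κ_i σ_j⁻¹`, and the three similar relations. -/
theorem kks {i j : ℕ} (hi : i + 1 < n) (hj : j + 1 < n) (hij : i + 1 = j ∨ j + 1 = i) :
    kappa q μ (s i) * kappa q μ (s j) * s i = kappa q μ (s i) * t j :=
  (h.kt_adj i j hi hj hij).symm

theorem skk {i j : ℕ} (hi : i + 1 < n) (hj : j + 1 < n) (hij : i + 1 = j ∨ j + 1 = i) :
    s i * kappa q μ (s j) * kappa q μ (s i) = t j * kappa q μ (s i) :=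
  (h.tk_adj i j hi hj hij).symm

theorem kss {i j : ℕ} (hi : i + 1 < n) (hj : j + 1 < n) (hij : i + 1 = j ∨ j + 1 = i) :
    kappa q μ (s i) * s j * s i = kappa q μ (s i) * kappa q μ (s j) := by
  rw [h.ks_adj i j hi hj hij, mul_assoc, h.inv_mul i hi, mul_one]

theorem ssk {i j : ℕ} (hi : i + 1 < n) (hj : j + 1 < n) (hij : i + 1 = j ∨ j + 1 = i) :
    s i * s j * kappa q μ (s i) = kappa q μ (s j) * kappa q μ (s i) := by
  rw [mul_assoc, h.sk_adj i j hi hj hij, ← mul_assoc, ← mul_assoc, h.mul_inv i hi, one_mul]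

theorem ksk (hμ : μ ≠ 0) {i j : ℕ} (hi : i + 1 < n) (hj : j + 1 < n)
    (hij : i + 1 = j ∨ j + 1 = i) :
    kappa q μ (s i) * s j * kappa q μ (s i) = μ⁻¹ • kappa q μ (s i) := by
  rw [h.ks_adj i j hi hj hij, mul_assoc, h.tk hμ hi, mul_smul_comm, h.kkk i j hi hj hij]

end

end BMWFamily

/-- The Yang-Baxter equation for polynomials of degree one in `σ` and `κ`, with the coefficient
identities as hypotheses discharged for the baxterized elements. -/
theorem BMWFamily.yangBaxter {q μ : ℂ} {n : ℕ} {s t : ℕ → A} (h : BMWFamily q μ n s t)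
    (hq : q ≠ 0) (hμ : μ ≠ 0) (hl : q - q⁻¹ ≠ 0) {i : ℕ} (hi : i + 2 < n) (x y : ℂ)
    (hx : μ + q * x ≠ 0) (hy : μ + q * y ≠ 0) (hxy : μ + q * (x * y) ≠ 0) :
    baxMinus q μ (s i) x * baxMinus q μ (s (i + 1)) (x * y) * baxMinus q μ (s i) y =
      baxMinus q μ (s (i + 1)) y * baxMinus q μ (s i) (x * y) * baxMinus q μ (s (i + 1)) x := by
  have i1 : i + 1 < n := by omega
  have i2 : i + 1 + 1 < n := hi
  have l1 : i + 1 = i + 1 ∨ i + 1 + 1 = i := Or.inl rfl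
  have l2 : i + 1 + 1 = i ∨ i + 1 = i + 1 := Or.inr rfl
  have aa := sq_eq_of_kappa hq hμ hl (s i)
  have bb := sq_eq_of_kappa hq hμ hl (s (i + 1))
  have ae := h.sk i i1
  have ea := h.ks i i1
  have ee := h.kk i i1
  have bf := h.sk (i + 1) i2
  have fb := h.ks (i + 1) i2
  have ff := h.kk (i + 1) i2
  have ta := h.inv_eq hq hμ hl i1
  have tb := h.inv_eq hq hμ hl i2
  have aba := h.braid i hi
  have abe := h.ssk i1 i2 l1
  have eba := h.kss i1 i2 l1
  have ebe := h.ksk hμ i1 i2 l1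
  have afe := h.skk i1 i2 l1
  have efa := h.kks i1 i2 l1
  have efe := h.kkk i (i + 1) i1 i2 l1
  have baf := h.ssk i2 i1 l2
  have fab := h.kss i2 i1 l2
  have faf := h.ksk hμ i2 i1 l2
  have bef := h.skk i2 i1 l2
  have feb := h.kks i2 i1 l2
  have fef := h.kkk (i + 1) i i2 i1 l2
  have be := h.sk_adj i (i + 1) i1 i2 l1
  -- The one cubic word not listed among the defining relations: the adjacent relation is applied to
  -- the left generator, then its mirror image to the right one.
  have beb : s (i + 1) * kappa q μ (s i) * s (i + 1) = t i * kappa q μ (s (i + 1)) * t i := by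
    rw [be, mul_assoc, mul_assoc, ← mul_assoc (kappa q μ (s (i + 1))), feb]
    simp only [mul_assoc]
  clear be
  unfold baxMinus eta at *
  generalize hA : s i = a at *
  generalize hB : s (i + 1) = b at *
  generalize hE : kappa q μ a = e at *
  generalize hF : kappa q μ b = f at *
  generalize hTA : t i = ta' at *
  generalize hTB : t (i + 1) = tb' at *
  -- With the inverses eliminated, every word in the expansion reduces to a fixed spanning set of
  -- words in a, b, e, f, and the claim becomes a list of scalar identities.
  subst ta tb
  simp only [mul_add, add_mul, mul_sub, sub_mul, smul_mul_assoc, mul_smul_comm, one_mul, mul_one,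
    smul_add, smul_sub, smul_smul] at afe efa bef feb beb
  simp only [mul_add, add_mul, smul_mul_assoc, mul_smul_comm, one_mul, mul_one, smul_add,
    smul_smul, ← aba, aa, bb, ae, ea, ee, bf, fb, ff, abe, eba, ebe, afe, efa, efe, baf, fab, faf,
    bef, feb, fef, beb, smul_sub]
  have hl' : q - q⁻¹ = (q ^ 2 - 1) / q := by field_simp
  -- The denominators become atoms with known non-vanishing, so that they are cleared before being
  -- expanded.
  generalize hdx : μ + q * x = dx at *
  generalize hdy : μ + q * y = dy at *
  generalize hdxy : μ + q * (x * y) = dxy at *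
  generalize hdl : q - q⁻¹ = l at *
  match_scalars
  all_goals field_simp
  all_goals subst hdx hdy hdxy hl'
  all_goals try field_simp
  all_goals ring

end Family

/-! ### Properties of the q-antisymmetrizers in a BMW family. -/

section Antisymmetrizer

variable {A : Type*} [Ring A] [Algebra ℂ A]

/-- The restrictions on `q` and `μ` that are needed for antisymmetrizers up to `a^{(k)}`. -/
structure Generic (q μ : ℂ) (k : ℕ) : Prop where
  q_ne : q ≠ 0
  μ_ne : μ ≠ 0
  l_ne : q - q⁻¹ ≠ 0
  eta_ne : eta q μ ≠ 0
  qNum_ne : ∀ j, 1 ≤ j → j ≤ k → qNum q j ≠ 0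
  denom_ne : ∀ j, 1 ≤ j → j ≤ k → μ + q * (q⁻¹) ^ (2 * j) ≠ 0
  num_ne : ∀ j, 1 ≤ j → j < k → (q⁻¹) ^ (2 * j) + q * μ ≠ 0
  num_ne' : ∀ j, 1 ≤ j → j < k → q ^ 2 * (q⁻¹) ^ (2 * j) ≠ μ ^ 2

variable {q μ : ℂ} {k : ℕ}

theorem kappa_mul_eq_zero {s y : A} (h : s * y = (-q⁻¹) • y) : kappa q μ s * y = 0 := by
  rw [kappa, smul_mul_assoc, mul_assoc, add_mul, h, Algebra.algebraMap_eq_smul_one,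
    Algebra.algebraMap_eq_smul_one, smul_mul_assoc, one_mul, neg_smul, add_neg_cancel, mul_zero,
    smul_zero]

theorem mul_kappa_eq_zero {s y : A} (h : y * s = (-q⁻¹) • y) :
    y * kappa q μ s = 0 := by
  have : (algebraMap ℂ A q - s) * (algebraMap ℂ A q⁻¹ + s) =
      (algebraMap ℂ A q⁻¹ + s) * (algebraMap ℂ A q - s) := by
    simp only [Algebra.algebraMap_eq_smul_one, mul_add, add_mul, mul_sub, sub_mul, smul_mul_assoc,
      one_mul, mul_smul_comm, mul_one]
    module
  rw [kappa, this, mul_smul_comm, ← mul_assoc, mul_add, h, Algebra.algebraMap_eq_smul_one,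
    mul_smul_comm, mul_one, neg_smul, add_neg_cancel, zero_mul, smul_zero]

theorem baxMinus_mul {s y : A} (h : s * y = (-q⁻¹) • y) (x : ℂ) :
    baxMinus q μ s x * y = (1 - q⁻¹ * (x - 1) / (q - q⁻¹)) • y := by
  rw [baxMinus, add_mul, add_mul, smul_mul_assoc, smul_mul_assoc, h, kappa_mul_eq_zero h, one_mul, smul_zero]
  module

theorem mul_baxMinus {s y : A} (h : y * s = (-q⁻¹) • y) (x : ℂ) :
    y * baxMinus q μ s x = (1 - q⁻¹ * (x - 1) / (q - q⁻¹)) • y := by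
  rw [baxMinus, mul_add, mul_add, mul_smul_comm, mul_smul_comm, h, mul_kappa_eq_zero h, mul_one, smul_zero]
  module

/-- The normalization in the recursive definition of a^{(m+1)} is exactly the inverse of the scalar
by which σ⁻(q^{-2m}) acts where σ = -q⁻¹ (there κ acts as zero). -/
theorem antisymmetrizer_scalar (hq : q ≠ 0) (hl : q - q⁻¹ ≠ 0) (m : ℕ)
    (hm : qNum q (m + 1) ≠ 0) :
    q ^ m / qNum q (m + 1) * (1 - q⁻¹ * ((q⁻¹) ^ (2 * m) - 1) / (q - q⁻¹)) = 1 := by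
  have h1 : qNum q (m + 1) * (q - q⁻¹) = q ^ (m + 1) - q⁻¹ ^ (m + 1) := by
    rw [qNum, div_mul_cancel₀ _ hl]
  have h2 : q ^ m * (q⁻¹) ^ m = 1 := by rw [← mul_pow, mul_inv_cancel₀ hq, one_pow]
  have h3 : (1 - q⁻¹ * ((q⁻¹) ^ (2 * m) - 1) / (q - q⁻¹)) * (q - q⁻¹) =
      q - q⁻¹ * (q⁻¹) ^ (2 * m) := by
    rw [sub_mul, div_mul_cancel₀ _ hl]
    ring
  have h4 : q ^ m * (q - q⁻¹ * (q⁻¹) ^ (2 * m)) = q ^ (m + 1) - q⁻¹ ^ (m + 1) := by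
    linear_combination (-q⁻¹ * q⁻¹ ^ m) * h2
  rw [div_mul_eq_mul_div, div_eq_one_iff_eq hm]
  apply mul_right_cancel₀ hl
  rw [h1, mul_assoc, h3, h4]

/-- On a common eigenvector with all σ_i = -q⁻¹ each factor of the recursion is a scalar, and the
scalars multiply to 1. Together with `BMWFamily.antisymmetrizer_spec` this yields idempotency and
absorption of smaller antisymmetrizers. -/
theorem antisymmetrizer_mul_of (hg : Generic q μ k) (s : ℕ → A) (y : A) (m : ℕ) (hm : m ≤ k)
    (h : ∀ i, i + 1 < m → s i * y = (-q⁻¹) • y) : antisymmetrizer q μ s m * y = y := by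
  induction m using Nat.strong_induction_on with
  | _ m ih =>
    match m, ih, h, hm with
    | 0, _, _, _ => simp [antisymmetrizer]
    | 1, _, _, _ => simp [antisymmetrizer]
    | m + 2, ih, h, hm =>
      have h1 := ih (m + 1) (by omega) (by omega) fun i hi => h i (by omega)
      rw [antisymmetrizer, smul_mul_assoc, mul_assoc, mul_assoc, h1, baxMinus_mul (h m (by omega)),
        mul_smul_comm, h1, smul_smul,
        antisymmetrizer_scalar hg.q_ne hg.l_ne _ (hg.qNum_ne _ (by omega) hm), one_smul]

theorem mul_antisymmetrizer_of (hg : Generic q μ k) (s : ℕ → A) (y : A) (m : ℕ) (hm : m ≤ k)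
    (h : ∀ i, i + 1 < m → y * s i = (-q⁻¹) • y) : y * antisymmetrizer q μ s m = y := by
  induction m using Nat.strong_induction_on with
  | _ m ih =>
    match m, ih, h, hm with
    | 0, _, _, _ => simp [antisymmetrizer]
    | 1, _, _, _ => simp [antisymmetrizer]
    | m + 2, ih, h, hm =>
      have h1 := ih (m + 1) (by omega) (by omega) fun i hi => h i (by omega)
      rw [antisymmetrizer, mul_smul_comm, ← mul_assoc, ← mul_assoc, h1,
        mul_baxMinus (h m (by omega)), smul_mul_assoc, h1, smul_smul,
        antisymmetrizer_scalar hg.q_ne hg.l_ne _ (hg.qNum_ne _ (by omega) hm), one_smul]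

namespace BMWFamily

variable {n : ℕ} {s t : ℕ → A}

/-- At x = q⁻² the baxterized element is a multiple of a^{(2)}: its image lies in the eigenspace σ =
-q⁻¹. This is the seed of the induction below. -/
theorem mul_baxMinus_inv_sq (h : BMWFamily q μ n s t) (hg : Generic q μ k) (hk : 1 ≤ k) {i : ℕ}
    (hi : i + 1 < n) :
    s i * baxMinus q μ (s i) ((q⁻¹) ^ 2) = (-q⁻¹) • baxMinus q μ (s i) ((q⁻¹) ^ 2) := by
  have hd := hg.denom_ne 1 le_rfl hk
  have hq := hg.q_ne
  have hl := hg.l_ne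
  have hl' : q - q⁻¹ = (q ^ 2 - 1) / q := by field_simp
  have hq2 : q ^ 2 - 1 ≠ 0 := fun h0 => hl (by rw [hl', h0, zero_div])
  have hd2 : μ + q * (q⁻¹) ^ 2 = (q * μ + 1) / q := by field_simp
  have hd' : q * μ + 1 ≠ 0 := fun h0 => hd (by rw [mul_one, hd2, h0, zero_div])
  rw [baxMinus, mul_add, mul_add, mul_smul_comm, mul_smul_comm, mul_one, h.sk i hi,
    sq_eq_of_kappa hq hg.μ_ne hl (s i), hl', hd2]
  match_scalars <;> field_simp <;> ring

theorem baxMinus_inv_sq_mul (h : BMWFamily q μ n s t) (hg : Generic q μ k) (hk : 1 ≤ k) {i : ℕ}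
    (hi : i + 1 < n) :
    baxMinus q μ (s i) ((q⁻¹) ^ 2) * s i = (-q⁻¹) • baxMinus q μ (s i) ((q⁻¹) ^ 2) := by
  rw [← h.mul_baxMinus_inv_sq hg hk hi]
  exact (Commute.baxMinus_right (Commute.refl (s i)) _).symm

/-- All generators but the last are handled by the outer factors of the recursion. For the last one,
expand one outer factor, absorb the smaller antisymmetrizer into the other, insert σ⁻(q⁻²) there at
the cost of a scalar, and apply the Yang-Baxter equation: this brings σ⁻(q⁻²) in the last generator
to the outside, where that generator acts by -q⁻¹. -/
theorem antisymmetrizer_spec (h : BMWFamily q μ n s t) (hg : Generic q μ k) (m : ℕ) (hm : m ≤ k)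
    (hn : m ≤ n) (i : ℕ) (hi : i + 1 < m) :
    s i * antisymmetrizer q μ s m = (-q⁻¹) • antisymmetrizer q μ s m ∧
      antisymmetrizer q μ s m * s i = (-q⁻¹) • antisymmetrizer q μ s m := by
  induction m using Nat.strong_induction_on generalizing i with
  | _ m ih =>
    match m, ih, hi, hm, hn with
    | m + 2, ih, hi, hm, hn =>
      rcases Nat.lt_or_ge (i + 1) (m + 1) with him | him
      · obtain ⟨h1, h2⟩ := ih (m + 1) (by omega) (by omega) (by omega) i him
        constructor
        · rw [antisymmetrizer, mul_smul_comm, ← mul_assoc, ← mul_assoc, h1, smul_mul_assoc,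
            smul_mul_assoc, smul_comm]
        · rw [antisymmetrizer, smul_mul_assoc, mul_assoc, h2, mul_smul_comm, smul_comm]
      · obtain rfl : i = m := by omega
        match i, ih, hm, hn with
        | 0, _, hm, hn =>
          simp only [antisymmetrizer, zero_add, mul_one, one_mul, mul_smul_comm, smul_mul_assoc,
            h.mul_baxMinus_inv_sq hg (by omega : 1 ≤ k) (by omega : 0 + 1 < n),
            h.baxMinus_inv_sq_mul hg (by omega : 1 ≤ k) (by omega : 0 + 1 < n)]
          constructor <;> rw [smul_comm]
        | m + 1, ih, hm, hn =>
          have ha := fun i hi => (ih (m + 2) (by omega) (by omega) (by omega) i hi).1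
          have ha' := fun i hi => (ih (m + 2) (by omega) (by omega) (by omega) i hi).2
          set a := antisymmetrizer q μ s (m + 2) with haa
          set a' := antisymmetrizer q μ s (m + 1) with haa'
          set y : ℂ := (q⁻¹) ^ 2 with hy
          set x : ℂ := (q⁻¹) ^ (2 * (m + 1)) with hx
          have hxy : (q⁻¹) ^ (2 * (m + 1 + 1)) = x * y := by rw [hx, hy]; ring
          set c : ℂ := q ^ (m + 1) / qNum q (m + 2)
          have hac : a = c • (a' * baxMinus q μ (s m) x * a') := by
            rw [haa, antisymmetrizer]
          have e1 : a' * a = a := antisymmetrizer_mul_of hg s a (m + 1) (by omega)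
            fun i hi => ha i (by omega)
          have e2 : a * a' = a := mul_antisymmetrizer_of hg s a (m + 1) (by omega)
            fun i hi => ha' i (by omega)
          -- The scalar by which σ⁻(q⁻²) acts on the antisymmetrizer; it is a factor of a product
          -- equal to 1, hence invertible.
          set z : ℂ := 1 - q⁻¹ * (y - 1) / (q - q⁻¹)
          have hz : z ≠ 0 := by
            have := antisymmetrizer_scalar hg.q_ne hg.l_ne 1 (hg.qNum_ne _ (by omega) (by omega))
            exact right_ne_zero_of_mul (this.trans_ne one_ne_zero)
          have ez1 : a = z⁻¹ • (baxMinus q μ (s m) y * a) := by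
            rw [baxMinus_mul (ha m (by omega)), smul_smul, inv_mul_cancel₀ hz, one_smul]
          have ez2 : a = z⁻¹ • (a * baxMinus q μ (s m) y) := by
            rw [mul_baxMinus (ha' m (by omega)), smul_smul, inv_mul_cancel₀ hz, one_smul]
          have hcomm : ∀ w, Commute (baxMinus q μ (s (m + 1)) w) a' := fun w =>
            Commute.antisymmetrizer_right _ fun i hi =>
              (Commute.baxMinus_right (h.comm i (m + 1) (by omega) (by omega)) w).symm
          have dx := hg.denom_ne (m + 1) (by omega) (by omega)
          have dy := hg.denom_ne 1 (by omega) (by omega)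
          have dxy := hg.denom_ne (m + 1 + 1) (by omega) (by omega)
          rw [hxy] at dxy
          have yb1 := h.yangBaxter hg.q_ne hg.μ_ne hg.l_ne (i := m) (by omega) x y dx dy dxy
          have yb2 := h.yangBaxter hg.q_ne hg.μ_ne hg.l_ne (i := m) (by omega) y x dy dx
            (by rwa [mul_comm y])
          rw [mul_comm y x] at yb2
          -- Here σ⁻(q⁻²) is moved to the left end; `b2` is the mirror computation, moving it to the
          -- right end.
          have b1 : a * baxMinus q μ (s (m + 1)) (x * y) * a =
              (c * z⁻¹) • (baxMinus q μ (s (m + 1)) y *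
                (a' * baxMinus q μ (s m) (x * y) * baxMinus q μ (s (m + 1)) x * a)) := by
            calc a * baxMinus q μ (s (m + 1)) (x * y) * a
                = c • (a' * baxMinus q μ (s m) x *
                    (a' * baxMinus q μ (s (m + 1)) (x * y)) * a) := by
                  rw [← mul_assoc, ← smul_mul_assoc, ← smul_mul_assoc, ← hac]
              _ = c • (a' * baxMinus q μ (s m) x * baxMinus q μ (s (m + 1)) (x * y) *
                    (a' * a)) := by
                  rw [← (hcomm _).eq]; simp only [mul_assoc]
              _ = (c * z⁻¹) • (a' * (baxMinus q μ (s m) x * baxMinus q μ (s (m + 1)) (x * y) *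
                    baxMinus q μ (s m) y) * a) := by
                  rw [e1, ← mul_assoc, mul_assoc _ (baxMinus q μ (s m) y), ← smul_smul,
                    ← mul_smul_comm z⁻¹, ← ez1, mul_assoc a']
              _ = _ := by
                  rw [yb1]
                  simp only [← mul_assoc]
                  rw [(hcomm y).eq]
          have b2 : a * baxMinus q μ (s (m + 1)) (x * y) * a =
              (c * z⁻¹) • ((a * baxMinus q μ (s (m + 1)) x * baxMinus q μ (s m) (x * y) * a') *
                baxMinus q μ (s (m + 1)) y) := by
            calc a * baxMinus q μ (s (m + 1)) (x * y) * a
                = c • (a * (baxMinus q μ (s (m + 1)) (x * y) * a') *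
                    baxMinus q μ (s m) x * a') := by
                  have : c • (a * (baxMinus q μ (s (m + 1)) (x * y) * a') *
                      baxMinus q μ (s m) x * a') = a * baxMinus q μ (s (m + 1)) (x * y) *
                      (c • (a' * baxMinus q μ (s m) x * a')) := by
                    simp only [mul_smul_comm, mul_assoc]
                  rw [this, ← hac]
              _ = c • ((a * a') * baxMinus q μ (s (m + 1)) (x * y) * baxMinus q μ (s m) x *
                    a') := by
                  rw [(hcomm _).eq]; simp only [mul_assoc]
              _ = (c * z⁻¹) • (a * (baxMinus q μ (s m) y * baxMinus q μ (s (m + 1)) (x * y) *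
                    baxMinus q μ (s m) x) * a') := by
                  rw [e2, ← smul_smul]
                  simp only [← mul_assoc]
                  rw [← smul_mul_assoc z⁻¹, ← smul_mul_assoc z⁻¹, ← smul_mul_assoc z⁻¹, ← ez2]
              _ = _ := by
                  rw [yb2]
                  simp only [mul_assoc]
                  rw [(hcomm y).eq]
          rw [antisymmetrizer, ← haa, hxy]
          constructor
          · have hs : s (m + 1) * baxMinus q μ (s (m + 1)) y =
                (-q⁻¹) • baxMinus q μ (s (m + 1)) y :=
              h.mul_baxMinus_inv_sq hg (by omega) (by omega)
            rw [b1]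
            simp only [mul_smul_comm, ← mul_assoc, hs]
            simp only [smul_mul_assoc, smul_smul]
            congr 1
            ring
          · have hs : baxMinus q μ (s (m + 1)) y * s (m + 1) =
                (-q⁻¹) • baxMinus q μ (s (m + 1)) y :=
              h.baxMinus_inv_sq_mul hg (by omega) (by omega)
            rw [b2]
            simp only [smul_mul_assoc, mul_assoc, hs]
            simp only [mul_smul_comm, smul_smul]
            congr 1
            ring

theorem antisymmetrizer_mul_self (h : BMWFamily q μ n s t) (hg : Generic q μ k) {m : ℕ}
    (hm : m ≤ k) (hn : m ≤ n) :
    antisymmetrizer q μ s m * antisymmetrizer q μ s m = antisymmetrizer q μ s m :=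
  antisymmetrizer_mul_of hg s _ m hm fun i hi => (h.antisymmetrizer_spec hg m hm hn i hi).1

theorem commute_kappa_antisymmetrizer (h : BMWFamily q μ n s t) {m j : ℕ} (hj : j + 1 < n)
    (hm : m ≤ j) : Commute (kappa q μ (s j)) (antisymmetrizer q μ s m) :=
  Commute.antisymmetrizer_right _ fun i hi =>
    (Commute.kappa_right (h.comm i j (by omega) hj)).symm

/-- `κ_{m+1} a^{(m+1)} κ_{m+1}` is a non-zero multiple of `κ_{m+1} a^{(m)}`. -/
theorem kappa_antisymmetrizer_kappa (h : BMWFamily q μ n s t) (hg : Generic q μ k) {m : ℕ}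
    (hm : m + 1 ≤ k) (hn : m + 1 < n) :
    ∃ c : ℂ, c ≠ 0 ∧ kappa q μ (s m) * antisymmetrizer q μ s (m + 1) * kappa q μ (s m) =
      c • (kappa q μ (s m) * antisymmetrizer q μ s m) := by
  match m, hm, hn with
  | 0, _, hn =>
    exact ⟨eta q μ, hg.eta_ne, by simp [antisymmetrizer, h.kk 0 hn]⟩
  | m + 1, hm, hn =>
    set x : ℂ := (q⁻¹) ^ (2 * (m + 1)) with hx
    have hq := hg.q_ne
    have hμ := hg.μ_ne
    have hl := hg.l_ne
    have hd := hg.denom_ne (m + 1) (by omega) (by omega)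
    have hn1 := hg.num_ne (m + 1) (by omega) (by omega)
    have hn2 := hg.num_ne' (m + 1) (by omega) (by omega)
    rw [← hx] at hd hn1 hn2
    -- The three summands come from κκ = ηκ, κσκ = μ⁻¹κ and κκ'κ = κ, applied to the three terms of
    -- σ⁻(x) between two neighbouring κ.
    refine ⟨q ^ (m + 1) / qNum q (m + 2) *
      (eta q μ + (x - 1) / (q - q⁻¹) * μ⁻¹ + μ * (x - 1) / (μ + q * x)), mul_ne_zero
        (div_ne_zero (pow_ne_zero _ hq) (hg.qNum_ne _ (by omega) (by omega))) ?_, ?_⟩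
    -- The scalar factorizes, and the two numerator factors are those excluded by `num_ne` and
    -- `num_ne'` in `Generic`.
    · have : eta q μ + (x - 1) / (q - q⁻¹) * μ⁻¹ + μ * (x - 1) / (μ + q * x) =
          (x + q * μ) * (q ^ 2 * x - μ ^ 2) / (q * ((q - q⁻¹) * μ * (μ + q * x))) := by
        have hl' : q - q⁻¹ = (q ^ 2 - 1) / q := by field_simp
        unfold eta
        generalize hdl : q - q⁻¹ = l at *
        generalize hdx : μ + q * x = dx at *
        field_simp
        subst hdx hl'
        field_simp
        ring
      rw [this]
      exact div_ne_zero (mul_ne_zero hn1 (sub_ne_zero.mpr hn2))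
        (mul_ne_zero hq (mul_ne_zero (mul_ne_zero hl hμ) hd))
    · have hc := h.commute_kappa_antisymmetrizer (m := m + 1) hn le_rfl
      have hii := h.antisymmetrizer_mul_self hg (m := m + 1) (by omega) (by omega)
      have hmid : kappa q μ (s (m + 1)) * baxMinus q μ (s m) x * kappa q μ (s (m + 1)) =
          (eta q μ + (x - 1) / (q - q⁻¹) * μ⁻¹ + μ * (x - 1) / (μ + q * x)) •
            kappa q μ (s (m + 1)) := by
        rw [baxMinus]
        simp only [mul_add, add_mul, mul_one, mul_smul_comm, smul_mul_assoc, h.kk _ hn,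
          h.ksk hμ hn (show m + 1 < n by omega) (Or.inr rfl),
          h.kkk _ _ hn (show m + 1 < n by omega) (Or.inr rfl)]
        module
      rw [antisymmetrizer, ← hx]
      set a := antisymmetrizer q μ s (m + 1)
      set K := kappa q μ (s (m + 1))
      calc K * ((q ^ (m + 1) / qNum q (m + 2)) • (a * baxMinus q μ (s m) x * a)) * K
          = (q ^ (m + 1) / qNum q (m + 2)) • ((K * a) * baxMinus q μ (s m) x * (a * K)) := by
            simp only [mul_smul_comm, smul_mul_assoc, mul_assoc]
        _ = (q ^ (m + 1) / qNum q (m + 2)) • (a * (K * baxMinus q μ (s m) x * K) * a) := by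
            rw [hc.eq, ← hc.eq]
            simp only [← hc.eq, mul_assoc]
            simp only [← mul_assoc, hc.eq]
        _ = _ := by
            rw [hmid, mul_smul_comm, smul_mul_assoc, smul_smul, ← hc.eq, mul_assoc, hii]

end BMWFamily

end Antisymmetrizer

/-! ## Chains and nested contractions -/

section Chains

variable {A : Type*} [Ring A] [Algebra ℂ A]

/-- The product `κ_c κ_{c+1} ⋯ κ_{c+m}`. -/
def upChain (κ : ℕ → A) (c : ℕ) : ℕ → A
  | 0 => κ c
  | m + 1 => upChain κ c m * κ (c + m + 1)

/-- The product `κ_{c+m} ⋯ κ_{c+1} κ_c`. -/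
def downChain (κ : ℕ → A) (c : ℕ) : ℕ → A
  | 0 => κ c
  | m + 1 => κ (c + m + 1) * downChain κ c m

/-- A multiple of the projector onto `m` nested contractions of the strands `d, …, d + 2m - 1`. -/
def nest (κ : ℕ → A) (d : ℕ) : ℕ → A
  | 0 => 1
  | m + 1 => upChain κ (d + m) m * nest κ d m * downChain κ (d + m) m

theorem upChain_succ' (κ : ℕ → A) (c m : ℕ) :
    upChain κ c (m + 1) = κ c * upChain κ (c + 1) m := by
  induction m with
  | zero => simp [upChain]
  | succ m ih =>
    rw [upChain, ih, upChain, mul_assoc, show c + (m + 1) + 1 = c + 1 + m + 1 by ring]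

theorem downChain_succ' (κ : ℕ → A) (c m : ℕ) :
    downChain κ c (m + 1) = downChain κ (c + 1) m * κ c := by
  induction m with
  | zero => simp [downChain]
  | succ m ih =>
    rw [downChain, ih, downChain, mul_assoc, show c + (m + 1) + 1 = c + 1 + m + 1 by ring]

theorem commute_upChain {κ : ℕ → A} {x : A} {c m : ℕ}
    (h : ∀ j, c ≤ j → j ≤ c + m → Commute x (κ j)) : Commute x (upChain κ c m) := by
  induction m with
  | zero => exact h c le_rfl le_rfl
  | succ m ih =>
    exact (ih fun j h1 h2 => h j h1 (by omega)).mul_right (h _ (by omega) le_rfl)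

theorem commute_downChain {κ : ℕ → A} {x : A} {c m : ℕ}
    (h : ∀ j, c ≤ j → j ≤ c + m → Commute x (κ j)) : Commute x (downChain κ c m) := by
  induction m with
  | zero => exact h c le_rfl le_rfl
  | succ m ih =>
    exact (h _ (by omega) le_rfl).mul_right (ih fun j h1 h2 => h j h1 (by omega))

theorem commute_nest {κ : ℕ → A} {x : A} {d m : ℕ}
    (h : ∀ j, d ≤ j → j + 2 ≤ d + 2 * m → Commute x (κ j)) : Commute x (nest κ d m) := by
  induction m with
  | zero => exact Commute.one_right x
  | succ m ih =>
    exact ((commute_upChain fun j h1 h2 => h j (by omega) (by omega)).mul_right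
      (ih fun j h1 h2 => h j h1 (by omega))).mul_right
      (commute_downChain fun j h1 h2 => h j (by omega) (by omega))

namespace BMWFamily

variable {q μ : ℂ} {k n : ℕ} {s t : ℕ → A}

local notation "κ[" q ", " μ ", " s "]" => fun i => kappa q μ (s i)

section

variable (h : BMWFamily q μ n s t)
include h

theorem commute_kappa {i j : ℕ} (hij : i + 1 < j ∨ j + 1 < i) (hi : i + 1 < n) (hj : j + 1 < n) :
    Commute (kappa q μ (s i)) (kappa q μ (s j)) := by
  rcases hij with hij | hij
  · exact Commute.kappa_right (Commute.kappa_right (h.comm i j hij hj).symm).symm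
  · exact Commute.kappa_right (Commute.kappa_right (h.comm j i hij hi)).symm

theorem commute_s {i j : ℕ} (hij : i + 1 < j ∨ j + 1 < i) (hi : i + 1 < n) (hj : j + 1 < n) :
    Commute (s i) (kappa q μ (s j)) := by
  rcases hij with hij | hij
  · exact Commute.kappa_right (h.comm i j hij hj)
  · exact Commute.kappa_right (h.comm j i hij hi).symm

theorem upChain_mul_top {c m : ℕ} (hn : c + m + 1 < n) :
    upChain κ[q, μ, s] c m * kappa q μ (s (c + m)) = eta q μ • upChain κ[q, μ, s] c m := by
  cases m with
  | zero => exact h.kk c hn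
  | succ m => rw [upChain, mul_assoc, ← add_assoc, h.kk _ (by omega), mul_smul_comm]

theorem top_mul_downChain {c m : ℕ} (hn : c + m + 1 < n) :
    kappa q μ (s (c + m)) * downChain κ[q, μ, s] c m = eta q μ • downChain κ[q, μ, s] c m := by
  cases m with
  | zero => exact h.kk c hn
  | succ m => rw [downChain, ← mul_assoc, ← add_assoc, h.kk _ (by omega), smul_mul_assoc]

theorem downChain_mul_bot {c m : ℕ} (hn : c + m + 1 < n) :
    downChain κ[q, μ, s] c m * kappa q μ (s c) = eta q μ • downChain κ[q, μ, s] c m := by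
  cases m with
  | zero => exact h.kk c hn
  | succ m => rw [downChain_succ', mul_assoc, h.kk _ (by omega), mul_smul_comm]

/-- The innermost pair of κ contracts x to x'. The remaining pairs telescope by κ_{j+1} κ_j κ_{j+1}
= κ_{j+1}, since x' commutes with them, leaving only the top κ. -/
theorem downChain_mul_mul_upChain {c m : ℕ} (hn : c + m + 1 < n) {x x' : A} {ε : ℂ}
    (hx : ∀ j, c < j → j ≤ c + m → Commute x (kappa q μ (s j)))
    (hx' : ∀ j, c < j → j ≤ c + m → Commute x' (kappa q μ (s j)))
    (hε : kappa q μ (s c) * x * kappa q μ (s c) = ε • (kappa q μ (s c) * x')) :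
    downChain κ[q, μ, s] c m * x * upChain κ[q, μ, s] c m =
      ε • (kappa q μ (s (c + m)) * x') := by
  induction m with
  | zero => exact hε
  | succ m ih =>
    have := ih (by omega) (fun j h1 h2 => hx j h1 (by omega)) fun j h1 h2 => hx' j h1 (by omega)
    calc downChain κ[q, μ, s] c (m + 1) * x * upChain κ[q, μ, s] c (m + 1)
        = kappa q μ (s (c + m + 1)) * (downChain κ[q, μ, s] c m * x * upChain κ[q, μ, s] c m) *
            kappa q μ (s (c + m + 1)) := by simp only [downChain, upChain, mul_assoc]
      _ = ε • (kappa q μ (s (c + m + 1)) * kappa q μ (s (c + m)) *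
            (x' * kappa q μ (s (c + m + 1)))) := by
          rw [this]; simp only [mul_smul_comm, smul_mul_assoc, mul_assoc]
      _ = _ := by
          rw [(hx' _ (by omega) (by omega)).eq, ← mul_assoc,
            h.kkk (c + m + 1) (c + m) (by omega) (by omega) (Or.inr rfl), ← add_assoc]

theorem downChain_mul_upChain {c m : ℕ} (hn : c + m + 1 < n) :
    downChain κ[q, μ, s] c m * upChain κ[q, μ, s] c m = eta q μ • kappa q μ (s (c + m)) := by
  have := h.downChain_mul_mul_upChain (x := 1) (x' := 1) hn (fun _ _ _ => Commute.one_left _)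
    (fun _ _ _ => Commute.one_left _) (ε := eta q μ) (by simp [h.kk c (by omega)])
  simpa using this

/-- With `downChain_mul_upChain` this shows that the κ at the two ends of a chain are exchanged by
cyclic permutation, up to the same factor η. -/
theorem upChain_mul_downChain {c m : ℕ} (hn : c + m + 1 < n) :
    upChain κ[q, μ, s] c m * downChain κ[q, μ, s] c m = eta q μ • kappa q μ (s c) := by
  induction m generalizing c with
  | zero => exact h.kk c hn
  | succ m ih =>
    have := ih (c := c + 1) (by omega)
    calc upChain κ[q, μ, s] c (m + 1) * downChain κ[q, μ, s] c (m + 1)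
        = kappa q μ (s c) * (upChain κ[q, μ, s] (c + 1) m * downChain κ[q, μ, s] (c + 1) m) *
            kappa q μ (s c) := by simp only [downChain_succ', upChain_succ', mul_assoc]
      _ = _ := by
          rw [this, mul_smul_comm, smul_mul_assoc, h.kkk c (c + 1) (by omega) (by omega)
            (Or.inl rfl)]

/-- As a diagram the chain has a cap at one end, a cup at the other, and strands displaced by two in
between. A crossing of two of these strands slides along them, so its index changes by two. -/
theorem downChain_mul_s (hη : eta q μ ≠ 0) {c m i : ℕ} (hn : c + m + 1 < n) (hc : c ≤ i)
    (hi : i + 2 ≤ c + m) :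
    downChain κ[q, μ, s] c m * s (i + 2) = s i * downChain κ[q, μ, s] c m := by
  induction m with
  | zero => omega
  | succ m ih =>
    rcases Nat.lt_or_ge (c + m) (i + 2) with him | him
    · obtain ⟨m, rfl⟩ : ∃ m', m = m' + 1 := ⟨m - 1, by omega⟩
      obtain rfl : i = c + m := by omega
      have h1 : Commute (s (c + m + 2)) (downChain κ[q, μ, s] c m) :=
        commute_downChain fun j h1 h2 => h.commute_s (by omega) (by omega) (by omega)
      -- A second copy of the top κ is split off, because the relation that turns the inverse
      -- generator into the displaced one needs it alongside.
      have h2 : downChain κ[q, μ, s] c m =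
          (eta q μ)⁻¹ • (kappa q μ (s (c + m)) * downChain κ[q, μ, s] c m) := by
        rw [h.top_mul_downChain (by omega), smul_smul, inv_mul_cancel₀ hη, one_smul]
      have h3 := h.kks (i := c + m + 2) (j := c + m + 1) (by omega) (by omega) (Or.inr rfl)
      have h4 := h.tk_adj (c + m) (c + m + 1) (by omega) (by omega) (Or.inl rfl)
      have h5 := h.commute_s (i := c + m) (j := c + m + 2) (by omega) (by omega) (by omega)
      rw [downChain, downChain, mul_assoc, mul_assoc, ← h1.eq]
      change kappa q μ (s (c + m + 2)) * (kappa q μ (s (c + m + 1)) *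
        (s (c + m + 2) * downChain κ[q, μ, s] c m)) = s (c + m) * (kappa q μ (s (c + m + 2)) *
        (kappa q μ (s (c + m + 1)) * downChain κ[q, μ, s] c m))
      rw [← mul_assoc, ← mul_assoc, h3, ← mul_assoc, h5.eq, h2]
      simp only [mul_smul_comm]
      congr 1
      rw [mul_assoc, ← mul_assoc (t _), h4]
      simp only [mul_assoc]
    · rw [downChain, mul_assoc, ih (by omega) him, ← mul_assoc, ← mul_assoc]
      congr 1
      exact (h.commute_s (by omega) (by omega) (by omega)).symm

theorem s_mul_upChain (hη : eta q μ ≠ 0) {c m i : ℕ} (hn : c + m + 1 < n) (hc : c ≤ i)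
    (hi : i + 2 ≤ c + m) :
    upChain κ[q, μ, s] c m * s i = s (i + 2) * upChain κ[q, μ, s] c m := by
  induction m with
  | zero => omega
  | succ m ih =>
    rcases Nat.lt_or_ge (c + m) (i + 2) with him | him
    · obtain ⟨m, rfl⟩ : ∃ m', m = m' + 1 := ⟨m - 1, by omega⟩
      obtain rfl : i = c + m := by omega
      have h1 : Commute (s (c + m + 2)) (upChain κ[q, μ, s] c m) :=
        commute_upChain fun j h1 h2 => h.commute_s (by omega) (by omega) (by omega)
      have h2 : upChain κ[q, μ, s] c m =
          (eta q μ)⁻¹ • (upChain κ[q, μ, s] c m * kappa q μ (s (c + m))) := by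
        rw [h.upChain_mul_top (by omega), smul_smul, inv_mul_cancel₀ hη, one_smul]
      have h3 := h.skk (i := c + m + 2) (j := c + m + 1) (by omega) (by omega) (Or.inr rfl)
      have h4 := h.kt_adj (c + m) (c + m + 1) (by omega) (by omega) (Or.inl rfl)
      have h5 := h.commute_s (i := c + m) (j := c + m + 2) (by omega) (by omega) (by omega)
      rw [upChain, upChain]
      change upChain κ[q, μ, s] c m * kappa q μ (s (c + m + 1)) * kappa q μ (s (c + m + 2)) *
        s (c + m) = s (c + m + 2) * (upChain κ[q, μ, s] c m * kappa q μ (s (c + m + 1)) *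
        kappa q μ (s (c + m + 2)))
      rw [mul_assoc, ← h5.eq, ← mul_assoc, ← mul_assoc, ← mul_assoc, h1.eq,
        mul_assoc _ (s (c + m + 2)), mul_assoc _ (s (c + m + 2) * _), h3, h2]
      simp only [smul_mul_assoc]
      congr 1
      rw [← mul_assoc, mul_assoc _ _ (t _), h4]
      simp only [mul_assoc]
    · rw [upChain, mul_assoc, ← (h.commute_s (by omega) (by omega) (by omega)).eq, ← mul_assoc,
        ih (by omega) him, mul_assoc]

theorem commute_kappa_nest {d m j : ℕ} (hn : d + 2 * m ≤ n) (hj : j + 1 < n)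
    (hd : j + 1 < d ∨ d + 2 * m ≤ j) :
    Commute (kappa q μ (s j)) (nest κ[q, μ, s] d m) :=
  commute_nest fun _ _ _ => h.commute_kappa (by omega) (by omega) (by omega)

/-- Each level contributes η twice: once when the inner chains collapse to a κ, once when that κ,
after commuting with the inner nest, is absorbed by the chain on the left. -/
theorem nest_mul_self {d m : ℕ} (hn : d + 2 * m ≤ n) :
    nest κ[q, μ, s] d m * nest κ[q, μ, s] d m = eta q μ ^ (2 * m) • nest κ[q, μ, s] d m := by
  induction m with
  | zero => simp [nest]
  | succ m ih =>
    have hN := ih (by omega)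
    rw [nest]
    have hdu := h.downChain_mul_upChain (c := d + m) (m := m) (by omega)
    have htop := h.upChain_mul_top (c := d + m) (m := m) (by omega)
    have hc := h.commute_kappa_nest (d := d) (m := m) (j := d + m + m) (by omega) (by omega)
      (by omega)
    set U := upChain κ[q, μ, s] (d + m) m
    set D := downChain κ[q, μ, s] (d + m) m
    set M := nest κ[q, μ, s] d m
    calc U * M * D * (U * M * D) = U * M * (D * U) * M * D := by simp only [mul_assoc]
      _ = eta q μ • (U * (M * kappa q μ (s (d + m + m))) * M * D) := by
          rw [hdu]; simp only [mul_smul_comm, smul_mul_assoc, mul_assoc]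
      _ = eta q μ • ((U * kappa q μ (s (d + m + m))) * (M * M) * D) := by
          rw [← hc.eq]; simp only [mul_assoc]
      _ = _ := by
          rw [htop, hN]
          simp only [mul_smul_comm, smul_mul_assoc, smul_smul]
          congr 1
          ring

theorem nest_mul_center (hη : eta q μ ≠ 0) {d m : ℕ} (hn : d + 2 * (m + 1) ≤ n) :
    nest κ[q, μ, s] d (m + 1) = (eta q μ)⁻¹ • (nest κ[q, μ, s] d (m + 1) * kappa q μ (s (d + m)))
    := by
  rw [nest, mul_assoc _ (downChain _ _ _), h.downChain_mul_bot (by omega), mul_smul_comm, smul_smul,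
    inv_mul_cancel₀ hη, one_smul]

/-- Nested contractions identify the generators at mirror positions. -/
theorem nest_mul_s (hη : eta q μ ≠ 0) {d m : ℕ} (hn : d + 2 * (m + 1) ≤ n) {i i' : ℕ}
    (hi : i + i' = 2 * m) (him : i < m) :
    nest κ[q, μ, s] d (m + 1) * s (d + i') = nest κ[q, μ, s] d (m + 1) * s (d + i) := by
  induction m generalizing i i' with
  | zero => omega
  | succ m ih =>
    rcases Nat.lt_or_ge i m with him' | him'
    -- Sliding through the outer chain lowers the right-hand index by two, which reduces the claim
    -- to the inner nest.
    · obtain ⟨i', rfl⟩ : ∃ j, i' = j + 2 := ⟨i' - 2, by omega⟩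
      have h1 := ih (by omega) (i := i) (i' := i') (by omega) him'
      have h2 : downChain κ[q, μ, s] (d + (m + 1)) (m + 1) * s (d + (i' + 2)) =
          s (d + i') * downChain κ[q, μ, s] (d + (m + 1)) (m + 1) :=
        h.downChain_mul_s hη (i := d + i') (by omega) (by omega) (by omega)
      have h3 : Commute (s (d + i)) (downChain κ[q, μ, s] (d + (m + 1)) (m + 1)) :=
        commute_downChain fun j h1 h2 => h.commute_s (by omega) (by omega) (by omega)
      rw [nest, mul_assoc, h2, mul_assoc, ← mul_assoc (nest _ _ _), h1,
        mul_assoc (nest _ _ _), h3.eq]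
      simp only [mul_assoc]
    -- The two generators next to the centre of the nest: each is turned into the inverse of the
    -- central generator, one by the κ on its right-hand neighbours, the other by the central κ of
    -- the inner nest.
    · obtain rfl : i = m := by omega
      obtain rfl : i' = i + 2 := by omega
      rw [nest, mul_assoc, mul_assoc, mul_assoc, mul_assoc]
      congr 1
      have hcen := h.nest_mul_center hη (d := d) (m := i) (by omega)
      set M := nest κ[q, μ, s] d (i + 1)
      have hD' : downChain κ[q, μ, s] (d + (i + 1)) (i + 1) =
          downChain κ[q, μ, s] (d + i + 2) i * kappa q μ (s (d + i + 1)) := by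
        rw [downChain_succ']; rfl
      have hbot : downChain κ[q, μ, s] (d + i + 2) i = (eta q μ)⁻¹ •
          (downChain κ[q, μ, s] (d + i + 2) i * kappa q μ (s (d + i + 2))) := by
        rw [h.downChain_mul_bot (by omega), smul_smul, inv_mul_cancel₀ hη, one_smul]
      have hc : Commute (kappa q μ (s (d + i))) (downChain κ[q, μ, s] (d + i + 2) i) :=
        commute_downChain fun j h1 h2 => h.commute_kappa (by omega) (by omega) (by omega)
      have e1 := h.kks (i := d + i + 2) (j := d + i + 1) (by omega) (by omega) (Or.inr rfl)
      have e2 := h.ks_adj (d + i + 1) (d + i) (by omega) (by omega) (Or.inr rfl)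
      have e3 := h.kkk (d + i) (d + i + 1) (by omega) (by omega) (Or.inl rfl)
      rw [hD']
      set D := downChain κ[q, μ, s] (d + i + 2) i
      have l : D * kappa q μ (s (d + i + 1)) * s (d + (i + 2)) = D * t (d + i + 1) := by
        conv_lhs => rw [hbot]
        conv_rhs => rw [hbot]
        rw [smul_mul_assoc, smul_mul_assoc, smul_mul_assoc, mul_assoc D, mul_assoc D,
          mul_assoc D, ← add_assoc, e1]
      have r : M * (D * kappa q μ (s (d + i + 1)) * s (d + i)) = M * (D * t (d + i + 1)) := by
        have x1 : M * D = (eta q μ)⁻¹ • (M * D * kappa q μ (s (d + i))) := by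
          conv_lhs => rw [hcen]
          rw [smul_mul_assoc, mul_assoc, hc.eq, mul_assoc]
        calc M * (D * kappa q μ (s (d + i + 1)) * s (d + i))
            = M * D * (kappa q μ (s (d + i + 1)) * s (d + i)) := by simp only [mul_assoc]
          _ = (eta q μ)⁻¹ • (M * D * (kappa q μ (s (d + i)) * kappa q μ (s (d + i + 1)) *
                kappa q μ (s (d + i))) * t (d + i + 1)) := by
              conv_lhs => rw [x1]
              rw [e2]
              simp only [smul_mul_assoc, mul_assoc]
          _ = M * (D * t (d + i + 1)) := by
              rw [e3, ← smul_mul_assoc, ← x1, mul_assoc]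
      rw [l, r]

/-- One level of the nest contracts one strand of the antisymmetrizer by
`kappa_antisymmetrizer_kappa`; the constants are non-zero at every level. -/
theorem nest_mul_antisymmetrizer_mul_nest (hg : Generic q μ k) {d m : ℕ} (hn : d + 2 * m ≤ n)
    (hk : d + m ≤ k) :
    ∃ c : ℂ, c ≠ 0 ∧ nest κ[q, μ, s] d m * antisymmetrizer q μ s (d + m) * nest κ[q, μ, s] d m =
      c • (nest κ[q, μ, s] d m * antisymmetrizer q μ s d) := by
  induction m with
  | zero => exact ⟨1, one_ne_zero, by simp [nest]⟩
  | succ m ih =>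
    obtain ⟨c, hc, hN⟩ := ih (by omega) (by omega)
    obtain ⟨ε, hε, hK⟩ := h.kappa_antisymmetrizer_kappa hg (m := d + m) (by omega) (by omega)
    refine ⟨ε * eta q μ * c, mul_ne_zero (mul_ne_zero hε hg.eta_ne) hc, ?_⟩
    have hdu := h.downChain_mul_mul_upChain (c := d + m) (m := m) (by omega)
      (fun j h1 h2 => (h.commute_kappa_antisymmetrizer (by omega) (by omega)).symm)
      (fun j h1 h2 => (h.commute_kappa_antisymmetrizer (by omega) (by omega)).symm) hK
    have htop := h.upChain_mul_top (c := d + m) (m := m) (by omega)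
    have hcn := h.commute_kappa_nest (d := d) (m := m) (j := d + m + m) (by omega) (by omega)
      (by omega)
    have hca : Commute (antisymmetrizer q μ s d) (downChain κ[q, μ, s] (d + m) m) :=
      commute_downChain fun j h1 h2 => (h.commute_kappa_antisymmetrizer (by omega) (by omega)).symm
    rw [nest, ← add_assoc]
    set U := upChain κ[q, μ, s] (d + m) m
    set D := downChain κ[q, μ, s] (d + m) m
    set M := nest κ[q, μ, s] d m
    set K := kappa q μ (s (d + m + m))
    calc U * M * D * antisymmetrizer q μ s (d + m + 1) * (U * M * D)
        = U * M * (D * antisymmetrizer q μ s (d + m + 1) * U) * M * D := by simp only [mul_assoc]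
      _ = ε • (U * (M * K) * antisymmetrizer q μ s (d + m) * M * D) := by
          rw [hdu]; simp only [mul_smul_comm, smul_mul_assoc, mul_assoc]
      _ = ε • ((U * K) * (M * antisymmetrizer q μ s (d + m) * M) * D) := by
          rw [← hcn.eq]; simp only [mul_assoc]
      _ = (ε * eta q μ * c) • (U * M * (antisymmetrizer q μ s d * D)) := by
          rw [htop, hN]
          simp only [mul_smul_comm, smul_mul_assoc, smul_smul]
          simp only [mul_assoc, mul_comm c]
      _ = _ := by rw [hca.eq]; simp only [mul_assoc]

/-- The nest reflects a generator of the right-hand antisymmetrizer to one inside a^{(d+m)}, which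
then acts by -q⁻¹. So the product is a common eigenvector for the right-hand generators and absorbs
their antisymmetrizer. -/
theorem nest_mul_antisymmetrizer_mul_shift (hg : Generic q μ k) {d m : ℕ} (hn : d + 2 * m ≤ n)
    (hk : d + m ≤ k) :
    nest κ[q, μ, s] d m * antisymmetrizer q μ s (d + m) *
        antisymmetrizer q μ (fun i => s (d + m + i)) m =
      nest κ[q, μ, s] d m * antisymmetrizer q μ s (d + m) := by
  refine mul_antisymmetrizer_of hg _ _ m (by omega) fun j hj => ?_
  obtain ⟨m, rfl⟩ : ∃ m', m = m' + 1 := ⟨m - 1, by omega⟩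
  have hcomm : Commute (s (d + (m + 1) + j)) (antisymmetrizer q μ s (d + (m + 1))) :=
    Commute.antisymmetrizer_right _ fun i hi => (h.comm i _ (by omega) (by omega)).symm
  have hs := (h.antisymmetrizer_spec hg (d + (m + 1)) hk (by omega) (d + (m - 1 - j))
    (by omega)).1
  -- After the substitution m = m' + 1 (with m' again called m), the mirror of position m' + 1 + j
  -- is m' - 1 - j, as the two add up to 2m'.
  have hm := h.nest_mul_s hg.eta_ne hn (i := m - 1 - j) (i' := m + 1 + j) (by omega) (by omega)
  rw [mul_assoc, ← hcomm.eq, ← mul_assoc, add_assoc d, hm, mul_assoc, hs, mul_smul_comm]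

/-- The algebraic core: P is idempotent, Q is idempotent up to η^{2m}, and compressing P by Q gives
a non-zero multiple of Q, so Q is equivalent to a subidempotent of P. Whether the two are equivalent
is decided later by comparing ranks. -/
theorem antisymmetrizer_nest_equiv (hg : Generic q μ k) {d m : ℕ} (hn : d + 2 * m ≤ n)
    (hk : d + m ≤ k) {P Q : A}
    (hP : P = antisymmetrizer q μ s (d + m) * antisymmetrizer q μ (fun i => s (d + m + i)) m)
    (hQ : Q = nest κ[q, μ, s] d m * antisymmetrizer q μ s d) :
    P * P = P ∧ Q * Q = eta q μ ^ (2 * m) • Q ∧ ∃ c : ℂ, c ≠ 0 ∧ Q * P * Q = c • Q := by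
  have hPP : Commute (antisymmetrizer q μ (fun i => s (d + m + i)) m)
      (antisymmetrizer q μ s (d + m)) :=
    Commute.antisymmetrizer_right _ fun i hi => (Commute.antisymmetrizer_right _ fun j hj =>
      h.comm i (d + m + j) (by omega) (by omega)).symm
  have hfam : BMWFamily q μ m (fun i => s (d + m + i)) (fun i => t (d + m + i)) :=
    (h.mono (m := d + m + m) (by omega)).shift
  have i1 := h.antisymmetrizer_mul_self hg (m := d + m) hk (by omega)
  have i2 := hfam.antisymmetrizer_mul_self hg (m := m) (by omega) le_rfl
  have i3 := h.antisymmetrizer_mul_self hg (m := d) (by omega) (by omega)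
  have hQQ : Commute (antisymmetrizer q μ s d) (nest κ[q, μ, s] d m) :=
    commute_nest fun j h1 h2 => (h.commute_kappa_antisymmetrizer (by omega) (by omega)).symm
  have hN := h.nest_mul_self hn
  obtain ⟨c, hc, hNN⟩ := h.nest_mul_antisymmetrizer_mul_nest hg hn hk
  have hsh := h.nest_mul_antisymmetrizer_mul_shift hg hn hk
  subst hP hQ
  set M := nest κ[q, μ, s] d m
  set a := antisymmetrizer q μ s (d + m)
  set b := antisymmetrizer q μ (fun i => s (d + m + i)) m
  set e := antisymmetrizer q μ s d
  refine ⟨?_, ?_, ⟨c, hc, ?_⟩⟩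
  · rw [mul_assoc, ← mul_assoc b, hPP.eq, mul_assoc a b b, i2, ← mul_assoc, i1]
  · rw [mul_assoc, ← mul_assoc e, hQQ.eq, mul_assoc M e e, i3, ← mul_assoc, hN, smul_mul_assoc]
  · calc M * e * (a * b) * (M * e) = e * ((M * a * b) * M) * e := by
          rw [show M * e * (a * b) * (M * e) = M * e * (a * b * M) * e by simp only [mul_assoc],
            ← hQQ.eq]
          simp only [mul_assoc]
      _ = c • (e * M * (e * e)) := by
          rw [hsh, hNN]; simp only [mul_smul_comm, smul_mul_assoc, mul_assoc]
      _ = _ := by rw [i3, hQQ.eq, mul_assoc, i3]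

end

end BMWFamily

end Chains

/-! ## Operators placed on consecutive tensor factors -/

section Place

variable {N : ℕ} {A : Type*} [Ring A] [Algebra ℂ A] {m P : ℕ}

/-- The tensor factors `c, …, c + m - 1`. -/
def offsetEmb {c m P : ℕ} (h : c + m ≤ P) : Fin m ↪ Fin P where
  toFun i := ⟨c + i, by omega⟩
  inj' i j hij := by
    have := congrArg Fin.val hij
    simp only at this
    exact Fin.ext (by omega)

@[simp]
theorem offsetEmb_val {c m P : ℕ} (h : c + m ≤ P) (i : Fin m) : (offsetEmb h i).val = c + i := rfl

theorem mem_range_offsetEmb {c m P : ℕ} (h : c + m ≤ P) (j : Fin P) :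
    j ∈ Set.range (offsetEmb h) ↔ c ≤ j.val ∧ j.val < c + m := by
  constructor
  · rintro ⟨i, rfl⟩
    rw [offsetEmb_val]
    omega
  · rintro ⟨h1, h2⟩
    exact ⟨⟨j.val - c, by omega⟩, Fin.ext (by rw [offsetEmb_val]; simp only; omega)⟩

/-- `a` and `b` agree outside the range of `φ`. -/
def AgreeOff (φ : Fin m ↪ Fin P) (a b : Fin P → Fin N) : Prop :=
  ∀ j, j ∉ Set.range φ → a j = b j

open Classical in
/-- The operator `X` on `V^{⊗m}`, acting in the tensor factors `φ 0, …, φ (m - 1)` of `V^{⊗P}`. -/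
def place (φ : Fin m ↪ Fin P) (X : TensorMat N m A) : TensorMat N P A :=
  Matrix.of fun a b => if AgreeOff φ a b then X (a ∘ φ) (b ∘ φ) else 0

/-- The multi-index `a` with the entries in the range of `φ` replaced by those of `d`. -/
abbrev fill (φ : Fin m ↪ Fin P) (d : Fin m → Fin N) (a : Fin P → Fin N) : Fin P → Fin N :=
  Function.extend φ d a

theorem fill_comp (φ : Fin m ↪ Fin P) (d : Fin m → Fin N) (a : Fin P → Fin N) :
    fill φ d a ∘ φ = d := by
  funext i
  exact φ.injective.extend_apply d a i

theorem fill_apply_of_notMem (φ : Fin m ↪ Fin P) (d : Fin m → Fin N) (a : Fin P → Fin N)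
    {j : Fin P} (hj : j ∉ Set.range φ) : fill φ d a j = a j :=
  Function.extend_apply' d a j hj

theorem agreeOff_fill (φ : Fin m ↪ Fin P) (d : Fin m → Fin N) (a : Fin P → Fin N) :
    AgreeOff φ a (fill φ d a) := fun _ hj => (fill_apply_of_notMem φ d a hj).symm

theorem AgreeOff.symm {φ : Fin m ↪ Fin P} {a b : Fin P → Fin N} (h : AgreeOff φ a b) :
    AgreeOff φ b a := fun j hj => (h j hj).symm

theorem AgreeOff.trans {φ : Fin m ↪ Fin P} {a b c : Fin P → Fin N} (h : AgreeOff φ a b)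
    (h' : AgreeOff φ b c) : AgreeOff φ a c := fun j hj => (h j hj).trans (h' j hj)

theorem AgreeOff.eq_fill {φ : Fin m ↪ Fin P} {a b : Fin P → Fin N} (h : AgreeOff φ a b) :
    b = fill φ (b ∘ φ) a := by
  funext j
  by_cases hj : j ∈ Set.range φ
  · obtain ⟨i, rfl⟩ := hj
    exact (congrFun (fill_comp φ (b ∘ φ) a) i).symm
  · rw [fill_apply_of_notMem φ _ _ hj, h j hj]

theorem fill_self (φ : Fin m ↪ Fin P) (a : Fin P → Fin N) : fill φ (a ∘ φ) a = a :=
  (AgreeOff.eq_fill fun _ _ => rfl).symm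

theorem place_apply (φ : Fin m ↪ Fin P) (X : TensorMat N m A) {a b : Fin P → Fin N}
    (h : AgreeOff φ a b) : place φ X a b = X (a ∘ φ) (b ∘ φ) := by
  rw [place, Matrix.of_apply, if_pos h]

theorem place_apply_of_not (φ : Fin m ↪ Fin P) (X : TensorMat N m A) {a b : Fin P → Fin N}
    (h : ¬AgreeOff φ a b) : place φ X a b = 0 := by
  rw [place, Matrix.of_apply, if_neg h]

/-- An operator placed along φ changes only the indices in the range of φ, so sums over intermediate
multi-indices reduce to sums over fillings of that range. -/
theorem sum_agreeOff {B : Type*} [AddCommMonoid B] (φ : Fin m ↪ Fin P) (a : Fin P → Fin N)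
    (f : (Fin P → Fin N) → B) (hf : ∀ c, ¬AgreeOff φ a c → f c = 0) :
    ∑ c, f c = ∑ d : Fin m → Fin N, f (fill φ d a) := by
  classical
  rw [← Finset.sum_filter_of_ne (p := fun c => AgreeOff φ a c)
    (fun c _ hc => not_not.mp fun hn => hc (hf c hn))]
  refine Finset.sum_bij' (fun c _ => c ∘ φ) (fun d _ => fill φ d a) ?_ ?_ ?_ ?_ ?_
  · simp
  · intro d _
    simpa using agreeOff_fill φ d a
  · intro c hc
    exact (AgreeOff.eq_fill (by simpa using hc)).symm
  · intro d _
    exact fill_comp φ d a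
  · intro c hc
    rw [← AgreeOff.eq_fill (by simpa using hc)]

theorem place_mul_apply (φ : Fin m ↪ Fin P) (X : TensorMat N m A) (Z : TensorMat N P A)
    (a b : Fin P → Fin N) :
    (place φ X * Z) a b = ∑ d, X (a ∘ φ) d * Z (fill φ d a) b := by
  rw [Matrix.mul_apply, sum_agreeOff φ a]
  · refine Finset.sum_congr rfl fun d _ => ?_
    rw [place_apply φ X (agreeOff_fill φ d a), fill_comp]
  · intro c hc
    rw [place_apply_of_not φ X hc, zero_mul]

theorem mul_place_apply (φ : Fin m ↪ Fin P) (X : TensorMat N m A) (Z : TensorMat N P A)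
    (a b : Fin P → Fin N) :
    (Z * place φ X) a b = ∑ d, Z a (fill φ d b) * X d (b ∘ φ) := by
  rw [Matrix.mul_apply, sum_agreeOff φ b]
  · refine Finset.sum_congr rfl fun d _ => ?_
    rw [place_apply φ X (agreeOff_fill φ d b).symm, fill_comp]
  · intro c hc
    rw [place_apply_of_not φ X (fun h => hc h.symm), mul_zero]

theorem place_mul (φ : Fin m ↪ Fin P) (X Y : TensorMat N m A) :
    place φ X * place φ Y = place φ (X * Y) := by
  ext a b
  rw [place_mul_apply]
  by_cases h : AgreeOff φ a b
  · rw [place_apply φ _ h, Matrix.mul_apply]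
    refine Finset.sum_congr rfl fun d _ => ?_
    rw [place_apply φ Y ((agreeOff_fill φ d a).symm.trans h), fill_comp]
  · rw [place_apply_of_not φ _ h]
    refine Finset.sum_eq_zero fun d _ => ?_
    rw [place_apply_of_not φ Y (fun h' => h ((agreeOff_fill φ d a).trans h')), mul_zero]

theorem place_one (φ : Fin m ↪ Fin P) : place φ (1 : TensorMat N m A) = 1 := by
  ext a b
  by_cases h : AgreeOff φ a b
  · rw [place_apply φ _ h, Matrix.one_apply, Matrix.one_apply]
    refine if_congr ⟨fun hab => ?_, fun hab => by rw [hab]⟩ rfl rfl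
    rw [h.eq_fill, ← hab, fill_self]
  · rw [place_apply_of_not φ _ h, Matrix.one_apply_ne]
    rintro rfl
    exact h fun _ _ => rfl

theorem place_add (φ : Fin m ↪ Fin P) (X Y : TensorMat N m A) :
    place φ (X + Y) = place φ X + place φ Y := by
  ext a b
  by_cases h : AgreeOff φ a b
  · simp [place_apply φ _ h]
  · simp [place_apply_of_not φ _ h]

theorem place_smul (φ : Fin m ↪ Fin P) (r : ℂ) (X : TensorMat N m A) :
    place φ (r • X) = r • place φ X := by
  ext a b
  by_cases h : AgreeOff φ a b
  · simp [place_apply φ _ h]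
  · simp [place_apply_of_not φ _ h]

/-- `place` as a homomorphism of algebras. -/
def placeHom (φ : Fin m ↪ Fin P) : TensorMat N m A →ₐ[ℂ] TensorMat N P A :=
  AlgHom.ofLinearMap ⟨⟨place φ, place_add φ⟩, place_smul φ⟩ (place_one φ)
    fun X Y => (place_mul φ X Y).symm

@[simp]
theorem placeHom_apply (φ : Fin m ↪ Fin P) (X : TensorMat N m A) : placeHom φ X = place φ X := rfl

/-- `numMat` as a homomorphism of algebras. -/
def numMatHom (A : Type*) [Ring A] [Algebra ℂ A] (n : ℕ) : TensorMat N n ℂ →ₐ[ℂ] TensorMat N n A :=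
  (Algebra.ofId ℂ A).mapMatrix

@[simp]
theorem numMatHom_apply {n : ℕ} (X : TensorMat N n ℂ) : numMatHom A n X = numMat A X := rfl

theorem numMat_mul {n : ℕ} (X Y : TensorMat N n ℂ) :
    numMat A (X * Y) = numMat A X * numMat A Y := map_mul (numMatHom A n) X Y

theorem numMat_place (φ : Fin m ↪ Fin P) (X : TensorMat N m ℂ) :
    numMat A (place φ X) = place φ (numMat A X) := by
  ext a b
  by_cases h : AgreeOff φ a b
  · simp [numMat, place_apply φ _ h]
  · simp [numMat, place_apply_of_not φ _ h]

theorem place_place {l : ℕ} (φ : Fin m ↪ Fin P) (ψ : Fin l ↪ Fin m) (X : TensorMat N l A) :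
    place φ (place ψ X) = place (ψ.trans φ) X := by
  have key : ∀ a b : Fin P → Fin N, AgreeOff (ψ.trans φ) a b ↔
      AgreeOff φ a b ∧ AgreeOff ψ (a ∘ φ) (b ∘ φ) := by
    intro a b
    constructor
    · intro h
      refine ⟨fun j hj => h j ?_, fun i hi => h (φ i) ?_⟩
      · rintro ⟨i, rfl⟩
        exact hj ⟨ψ i, rfl⟩
      · rintro ⟨i', h'⟩
        exact hi ⟨i', φ.injective h'⟩
    · rintro ⟨h1, h2⟩ j hj
      by_cases hj' : j ∈ Set.range φ
      · obtain ⟨i, rfl⟩ := hj'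
        refine h2 i ?_
        rintro ⟨i', rfl⟩
        exact hj ⟨i', rfl⟩
      · exact h1 j hj'
  ext a b
  by_cases h : AgreeOff (ψ.trans φ) a b
  · rw [place_apply _ _ h, place_apply _ _ ((key a b).mp h).1, place_apply _ _ ((key a b).mp h).2]
    rfl
  · rw [place_apply_of_not _ _ h]
    by_cases h1 : AgreeOff φ a b
    · rw [place_apply _ _ h1, place_apply_of_not]
      exact fun h2 => h ((key a b).mpr ⟨h1, h2⟩)
    · rw [place_apply_of_not _ _ h1]

theorem fill_comp_of_disjoint {l : ℕ} (φ : Fin m ↪ Fin P) (ψ : Fin l ↪ Fin P)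
    (h : ∀ i j, φ i ≠ ψ j) (d : Fin m → Fin N) (a : Fin P → Fin N) :
    fill φ d a ∘ ψ = a ∘ ψ := by
  funext j
  exact fill_apply_of_notMem φ d a (by rintro ⟨i, hi⟩; exact h i j hi)

theorem place_mul_place_apply {l : ℕ} (φ : Fin m ↪ Fin P) (ψ : Fin l ↪ Fin P)
    (h : ∀ i j, φ i ≠ ψ j) (X : TensorMat N m A) (Y : TensorMat N l A) (a b : Fin P → Fin N) :
    (place φ X * place ψ Y) a b = X (a ∘ φ) (b ∘ φ) * place ψ Y (fill φ (b ∘ φ) a) b := by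
  rw [place_mul_apply, Finset.sum_eq_single (b ∘ φ)]
  · intro d _ hd
    rw [place_apply_of_not, mul_zero]
    intro hag
    refine hd ?_
    funext i
    have := hag (φ i) (by rintro ⟨j, hj⟩; exact h i j hj.symm)
    change d i = b (φ i)
    rw [← this]
    exact (congrFun (fill_comp φ d a) i).symm
  · intro hb
    exact absurd (Finset.mem_univ _) hb

/-- On disjoint factors the entries simply multiply. Over a noncommutative A this gives commutation
because one of the two operators is numerical. -/
theorem commute_place {l : ℕ} (φ : Fin m ↪ Fin P) (ψ : Fin l ↪ Fin P)
    (h : ∀ i j, φ i ≠ ψ j) (X : TensorMat N m ℂ) (Y : TensorMat N l A) :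
    Commute (numMat A (place φ X)) (place ψ Y) := by
  rw [numMat_place]
  ext a b
  rw [place_mul_place_apply φ ψ h, place_mul_place_apply ψ φ fun i j => (h j i).symm]
  have key : AgreeOff ψ (fill φ (b ∘ φ) a) b ↔ AgreeOff φ (fill ψ (b ∘ ψ) a) b := by
    have : ∀ {m l : ℕ} (φ : Fin m ↪ Fin P) (ψ : Fin l ↪ Fin P) (_ : ∀ i j, φ i ≠ ψ j),
        AgreeOff ψ (fill φ (b ∘ φ) a) b → AgreeOff φ (fill ψ (b ∘ ψ) a) b := by
      intro m l φ ψ h hab j hj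
      by_cases hj' : j ∈ Set.range ψ
      · obtain ⟨i, rfl⟩ := hj'
        exact congrFun (fill_comp ψ _ _) i
      · rw [fill_apply_of_notMem ψ _ _ hj', ← hab j hj', fill_apply_of_notMem φ _ _ hj]
    exact ⟨this φ ψ h, this ψ φ fun i j => (h j i).symm⟩
  by_cases hag : AgreeOff ψ (fill φ (b ∘ φ) a) b
  · rw [place_apply ψ _ hag, place_apply φ _ (key.mp hag), fill_comp_of_disjoint φ ψ h,
      fill_comp_of_disjoint ψ φ fun i j => (h j i).symm]
    exact Algebra.commutes _ _
  · rw [place_apply_of_not ψ _ hag, place_apply_of_not φ _ (fun h' => hag (key.mpr h')), mul_zero,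
      mul_zero]

end Place

/-! ## Operators in two neighbouring factors -/

section SiteOp

variable {N : ℕ}

theorem siteOp_apply {n i : ℕ} (h : i + 1 < n) (X : TwoOp N) (a b : Fin n → Fin N) :
    siteOp n X i a b = if ∀ j : Fin n, j.val ≠ i → j.val ≠ i + 1 → a j = b j then
        X (a ⟨i, by omega⟩, a ⟨i + 1, h⟩) (b ⟨i, by omega⟩, b ⟨i + 1, h⟩) else 0 := by
  rw [siteOp, dif_pos h, Matrix.of_apply]

theorem siteOp_two_apply (X : TwoOp N) (a b : Fin 2 → Fin N) :
    siteOp 2 X 0 a b = X (a 0, a 1) (b 0, b 1) := by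
  rw [siteOp_apply (by omega), if_pos]
  · rfl
  · intro j h1 h2
    omega

theorem place_siteOp {c m P i : ℕ} (h : c + m ≤ P) (hi : i + 1 < m) (X : TwoOp N) :
    place (offsetEmb h) (siteOp m X i) = siteOp P X (c + i) := by
  ext a b
  rw [siteOp_apply (by omega)]
  by_cases hab : AgreeOff (offsetEmb h) a b
  · rw [place_apply _ _ hab, siteOp_apply hi]
    refine if_congr ⟨fun hh j h1 h2 => ?_, fun hh j h1 h2 => ?_⟩ rfl rfl
    · by_cases hj : j ∈ Set.range (offsetEmb h)
      · obtain ⟨j, rfl⟩ := hj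
        rw [offsetEmb_val] at h1 h2
        exact hh j (by omega) (by omega)
      · exact hab j hj
    · exact hh _ (by rw [offsetEmb_val]; omega) (by rw [offsetEmb_val]; omega)
  · rw [place_apply_of_not _ _ hab, if_neg]
    intro hh
    refine hab fun j hj => hh j ?_ ?_
    · rw [mem_range_offsetEmb] at hj; omega
    · rw [mem_range_offsetEmb] at hj; omega

theorem siteOp_eq_place {n i : ℕ} (h : i + 2 ≤ n) (X : TwoOp N) :
    siteOp n X i = place (offsetEmb h) (siteOp 2 X 0) := by
  rw [place_siteOp h (by omega), add_zero]

theorem siteOp_two_mul (X Y : TwoOp N) : siteOp 2 X 0 * siteOp 2 Y 0 = siteOp 2 (X * Y) 0 := by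
  ext a b
  rw [Matrix.mul_apply, siteOp_two_apply, Matrix.mul_apply,
    ← (finTwoArrowEquiv (Fin N)).sum_comp]
  simp [siteOp_two_apply, finTwoArrowEquiv]

theorem siteOp_two_one : siteOp 2 (1 : TwoOp N) 0 = 1 := by
  ext a b
  rw [siteOp_two_apply, Matrix.one_apply, Matrix.one_apply]
  refine if_congr ⟨fun h => ?_, fun h => by rw [h]⟩ rfl rfl
  rw [Prod.mk.injEq] at h
  funext j
  fin_cases j
  · exact h.1
  · exact h.2

theorem siteOp_mul {n i : ℕ} (h : i + 1 < n) (X Y : TwoOp N) :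
    siteOp n X i * siteOp n Y i = siteOp n (X * Y) i := by
  rw [siteOp_eq_place h, siteOp_eq_place h, siteOp_eq_place h, place_mul, siteOp_two_mul]

theorem siteOp_one {n i : ℕ} (h : i + 1 < n) : siteOp n (1 : TwoOp N) i = 1 := by
  rw [siteOp_eq_place h, siteOp_two_one, place_one]

theorem siteOp_mul_inv {n i : ℕ} (h : i + 1 < n) {X : TwoOp N} (hX : IsUnit X) :
    siteOp n X i * siteOp n X⁻¹ i = 1 := by
  rw [siteOp_mul h, Matrix.mul_nonsing_inv _ ((Matrix.isUnit_iff_isUnit_det _).mp hX),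
    siteOp_one h]

theorem siteOp_inv_mul {n i : ℕ} (h : i + 1 < n) {X : TwoOp N} (hX : IsUnit X) :
    siteOp n X⁻¹ i * siteOp n X i = 1 := by
  rw [siteOp_mul h, Matrix.nonsing_inv_mul _ ((Matrix.isUnit_iff_isUnit_det _).mp hX),
    siteOp_one h]

theorem commute_siteOp {n i j : ℕ} (hij : i + 1 < j) (hj : j + 1 < n) (X Y : TwoOp N) :
    Commute (siteOp n X i) (siteOp n Y j) := by
  have := commute_place (A := ℂ) (offsetEmb (show i + 2 ≤ n by omega))
    (offsetEmb (show j + 2 ≤ n by omega))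
    (fun x y hxy => by
      have := congrArg Fin.val hxy
      simp only [offsetEmb_val] at this
      omega) (siteOp 2 X 0) (siteOp 2 Y 0)
  rw [← siteOp_eq_place, ← siteOp_eq_place] at this
  exact this

/-- A cubic relation on `V^{⊗3}` holds in every three neighbouring factors. -/
theorem siteOp_three {n i : ℕ} (h : i + 2 < n) {X Y Z X' Y' Z' : TwoOp N} {a b c a' b' c' : ℕ}
    (ha : a < 2) (hb : b < 2) (hc : c < 2) (ha' : a' < 2) (hb' : b' < 2) (hc' : c' < 2)
    (H : siteOp 3 X a * siteOp 3 Y b * siteOp 3 Z c =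
      siteOp 3 X' a' * siteOp 3 Y' b' * siteOp 3 Z' c') :
    siteOp n X (i + a) * siteOp n Y (i + b) * siteOp n Z (i + c) =
      siteOp n X' (i + a') * siteOp n Y' (i + b') * siteOp n Z' (i + c') := by
  have := congrArg (place (offsetEmb (show i + 3 ≤ n by omega))) H
  simp only [← place_mul] at this
  rwa [place_siteOp _ (by omega), place_siteOp _ (by omega), place_siteOp _ (by omega),
    place_siteOp _ (by omega), place_siteOp _ (by omega), place_siteOp _ (by omega)] at this

/-- The type condition prescribes only the images of the σ_i; the image of σ_i⁻¹ is R_i⁻¹ by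
uniqueness of inverses, and the relations are then read off from the defining ones. -/
theorem bmwFamily_siteOp {R : TwoOp N} {q μ : ℂ} (h : IsBMWType R q μ) (hR : IsUnit R) (n : ℕ) :
    BMWFamily q μ n (siteOp n R) (siteOp n R⁻¹) := by
  obtain ⟨ρ, hρ⟩ := h n
  set f : FreeAlgebra ℂ (BMWGen n) →ₐ[ℂ] TensorMat N n ℂ :=
    ρ.comp (RingQuot.mkAlgHom ℂ (BMWRel q μ n)) with hf
  have hrel : ∀ {x y}, BMWRel q μ n x y → f x = f y := fun hxy =>
    congrArg ρ (RingQuot.mkAlgHom_rel ℂ hxy)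
  have hs : ∀ i : Fin (n - 1), f (freeS n i) = siteOp n R i := fun i => hρ i
  have ht : ∀ i : Fin (n - 1), f (freeSInv n i) = siteOp n R⁻¹ i := by
    intro i
    have h1 := hrel (BMWRel.inv_mul i)
    rw [map_mul, map_one, hs] at h1
    exact left_inv_eq_right_inv h1 (siteOp_mul_inv (by omega) hR)
  have hk : ∀ i : Fin (n - 1), f (freeK q μ n i) = kappa q μ (siteOp n R i) := by
    intro i
    rw [freeK, map_kappa, hs]
  have adj : ∀ {i j : ℕ} (hi : i + 1 < n) (hj : j + 1 < n), (i + 1 = j ∨ j + 1 = i) →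
      Adjacent (⟨i, by omega⟩ : Fin (n - 1)) ⟨j, by omega⟩ := fun _ _ h => h
  refine ⟨fun i hi => siteOp_mul_inv hi hR, fun i hi => siteOp_inv_mul hi hR, fun i hi => ?_,
    fun i j hij hj => commute_siteOp hij hj R R, fun i hi => ?_, fun i hi => ?_,
    fun i j hi hj hij => ?_, fun i j hi hj hij => ?_, fun i j hi hj hij => ?_,
    fun i j hi hj hij => ?_, fun i j hi hj hij => ?_, fun i hi => ?_⟩
  · have := hrel (BMWRel.braid _ _ (adj (i := i) (j := i + 1) (by omega) hi (Or.inl rfl)))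
    simpa only [map_mul, hs] using this
  · have := hrel (BMWRel.sigma_kappa ⟨i, by omega⟩)
    simpa only [map_mul, map_smul, hs, hk] using this
  · have := hrel (BMWRel.kappa_sigma ⟨i, by omega⟩)
    simpa only [map_mul, map_smul, hs, hk] using this
  · have := hrel (BMWRel.kappa_sigma_adj _ _ (adj hi hj hij))
    simpa only [map_mul, hs, hk, ht] using this
  · have := hrel (BMWRel.kappa_sigmaInv_adj _ _ (adj hi hj hij))
    simpa only [map_mul, hs, hk, ht] using this
  · have := hrel (BMWRel.sigma_kappa_adj _ _ (adj hi hj hij))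
    simpa only [map_mul, hs, hk, ht] using this
  · have := hrel (BMWRel.sigmaInv_kappa_adj _ _ (adj hi hj hij))
    simpa only [map_mul, hs, hk, ht] using this
  · have := hrel (BMWRel.kappa_kappa_kappa _ _ (adj hi hj hij))
    simpa only [map_mul, hs, hk] using this
  · have := hrel (BMWRel.kappa_sq ⟨i, by omega⟩)
    simpa only [map_mul, map_smul, hs, hk] using this

end SiteOp

/-! ## Copies of the quantum matrix -/

section Strings

variable {N : ℕ} {A : Type*} [Ring A] [Algebra ℂ A]

theorem place_firstCopy {m P : ℕ} (h : 0 + m ≤ P) (hm : 0 < m) (M : Matrix (Fin N) (Fin N) A) :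
    place (offsetEmb h) (firstCopy m M) = firstCopy P M := by
  ext a b
  rw [firstCopy, firstCopy, dif_pos hm, dif_pos (by omega), Matrix.of_apply]
  by_cases hab : AgreeOff (offsetEmb h) a b
  · rw [place_apply _ _ hab, Matrix.of_apply]
    have h0 : offsetEmb h ⟨0, hm⟩ = ⟨0, by omega⟩ := Fin.ext (by simp)
    refine if_congr ⟨fun hh j h1 => ?_, fun hh j h1 => ?_⟩ (by simp only [Function.comp, h0]) rfl
    · by_cases hj : j ∈ Set.range (offsetEmb h)
      · obtain ⟨j, rfl⟩ := hj
        rw [offsetEmb_val] at h1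
        exact hh j (by omega)
      · exact hab j hj
    · exact hh _ (by rw [offsetEmb_val]; omega)
  · rw [place_apply_of_not _ _ hab, if_neg]
    intro hh
    refine hab fun j hj => hh j ?_
    rw [mem_range_offsetEmb] at hj
    omega

/-- The copy with index i is built from operators in the factors 0, …, i only, hence does not depend
on the number of further factors. -/
theorem place_matCopy (F : TwoOp N) {m P : ℕ} (h : 0 + m ≤ P) (M : Matrix (Fin N) (Fin N) A)
    {i : ℕ} (hi : i < m) : place (offsetEmb h) (matCopy F m M i) = matCopy F P M i := by
  induction i with
  | zero => exact place_firstCopy h hi M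
  | succ i ih =>
    rw [matCopy, matCopy, ← place_mul, ← place_mul, ih (by omega), ← numMat_place, ← numMat_place,
      place_siteOp h hi, place_siteOp h hi, zero_add]

theorem commute_siteOp_matCopy (F X : TwoOp N) {P : ℕ} (M : Matrix (Fin N) (Fin N) A) {i j : ℕ}
    (hij : j < i) (hi : i + 1 < P) :
    Commute (numMat A (siteOp P X i)) (matCopy F P M j) := by
  rw [siteOp_eq_place hi, ← place_matCopy F (show 0 + (j + 1) ≤ P by omega) M (Nat.lt_succ_self j)]
  refine commute_place _ _ (fun x y hxy => ?_) _ _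
  have := congrArg Fin.val hxy
  simp only [offsetEmb_val] at this
  omega

theorem numMat_mul_inv {F : TwoOp N} (hF : IsUnit F) {P i : ℕ} (h : i + 1 < P) :
    numMat A (siteOp P F i) * numMat A (siteOp P F⁻¹ i) = 1 := by
  rw [← numMat_mul, siteOp_mul_inv h hF]
  exact map_one (numMatHom A P)

theorem numMat_inv_mul {F : TwoOp N} (hF : IsUnit F) {P i : ℕ} (h : i + 1 < P) :
    numMat A (siteOp P F⁻¹ i) * numMat A (siteOp P F i) = 1 := by
  rw [← numMat_mul, siteOp_inv_mul h hF]
  exact map_one (numMatHom A P)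

theorem inv_mul_eq_of_mul_eq {B : Type*} [Ring B] {x y u v : B} (h : x * u = u * y)
    (huv : u * v = 1) (hvu : v * u = 1) : v * x = y * v := by
  calc v * x = v * (x * u) * v := by rw [← mul_assoc, mul_assoc, huv, mul_one]
    _ = y * v := by rw [h, ← mul_assoc, hvu, one_mul]

/-- `X_i` commutes with the copies `M_{\bar j}` for `j ≥ i + 2`. -/
theorem commute_matCopy_of_twist {F X : TwoOp N} (hF : IsUnit F)
    (hX : siteOp 3 X 0 * siteOp 3 F 1 * siteOp 3 F 0 = siteOp 3 F 1 * siteOp 3 F 0 * siteOp 3 X 1)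
    {P : ℕ} (M : Matrix (Fin N) (Fin N) A) {i j : ℕ} (hij : i + 2 ≤ j) (hj : j < P) :
    Commute (numMat A (siteOp P X i)) (matCopy F P M j) := by
  induction j, hij using Nat.le_induction with
  -- The copy i + 2 is the conjugate of the copy i by F_{i+1} F_i. That product turns X_i into
  -- X_{i+1}, which acts in factors disjoint from those of the copy i.
  | base =>
    have e1 := siteOp_three hj (by omega) (by omega) (by omega) (by omega) (by omega) (by omega) hX
    rw [add_zero] at e1
    have e2 := congrArg (numMat A) e1
    simp only [numMat_mul, mul_assoc] at e2
    have u1 := numMat_mul_inv (A := A) hF (show i + 1 < P by omega)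
    have u2 := numMat_inv_mul (A := A) hF (show i + 1 < P by omega)
    have u3 := numMat_mul_inv (A := A) hF (show i + 1 + 1 < P by omega)
    have u4 := numMat_inv_mul (A := A) hF (show i + 1 + 1 < P by omega)
    have hc := commute_siteOp_matCopy F X M (show i < i + 1 by omega) (show i + 1 + 1 < P by omega)
    rw [matCopy, matCopy]
    set f := numMat A (siteOp P F i)
    set f' := numMat A (siteOp P F⁻¹ i)
    set g := numMat A (siteOp P F (i + 1))
    set g' := numMat A (siteOp P F⁻¹ (i + 1))
    set x := numMat A (siteOp P X i)
    set y := numMat A (siteOp P X (i + 1))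
    have e3 : x * (g * f) = (g * f) * y := by rw [e2, mul_assoc]
    have e4 := inv_mul_eq_of_mul_eq e3 (v := f' * g')
      (by rw [mul_assoc, ← mul_assoc f, u1, one_mul, u3])
      (by rw [mul_assoc, ← mul_assoc g', u4, one_mul, u2])
    show x * (g * (f * matCopy F P M i * f') * g') = g * (f * matCopy F P M i * f') * g' * x
    calc x * (g * (f * matCopy F P M i * f') * g')
        = x * (g * f) * (matCopy F P M i * (f' * g')) := by simp only [mul_assoc]
      _ = g * f * (y * matCopy F P M i) * (f' * g') := by rw [e3]; simp only [mul_assoc]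
      _ = g * f * matCopy F P M i * (f' * g' * x) := by rw [hc.eq, e4]; simp only [mul_assoc]
      _ = _ := by simp only [mul_assoc]
  | succ j hij ih =>
    rw [matCopy]
    have hc : ∀ Y : TwoOp N, Commute (numMat A (siteOp P X i)) (numMat A (siteOp P Y j)) := fun Y =>
      (commute_siteOp (by omega) hj X Y).map (numMatHom A P)
    exact ((hc F).mul_right (ih (by omega))).mul_right (hc F⁻¹)

/-- The product `M_{\overline{a}} ⋯ M_{\overline{a+m-1}}`. -/
def copySeg (F : TwoOp N) (P : ℕ) (M : Matrix (Fin N) (Fin N) A) (a : ℕ) : ℕ → TensorMat N P A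
  | 0 => 1
  | m + 1 => copySeg F P M a m * matCopy F P M (a + m)

theorem matString_eq_copySeg (F : TwoOp N) (n : ℕ) (M : Matrix (Fin N) (Fin N) A) :
    matString F n M = copySeg F n M 0 n := by
  have : ∀ m, ((List.range m).map (matCopy F n M)).prod = copySeg F n M 0 m := by
    intro m
    induction m with
    | zero => simp [copySeg]
    | succ m ih => rw [List.range_succ, List.map_append, List.prod_append, ih, copySeg]; simp
  exact this n

theorem copySeg_add (F : TwoOp N) (P : ℕ) (M : Matrix (Fin N) (Fin N) A) (a m l : ℕ) :
    copySeg F P M a (m + l) = copySeg F P M a m * copySeg F P M (a + m) l := by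
  induction l with
  | zero => simp [copySeg]
  | succ l ih => rw [← add_assoc, copySeg, ih, copySeg, mul_assoc, ← add_assoc]

theorem place_copySeg (F : TwoOp N) {n P : ℕ} (h : 0 + n ≤ P) (M : Matrix (Fin N) (Fin N) A)
    {a m : ℕ} (hm : a + m ≤ n) :
    place (offsetEmb h) (copySeg F n M a m) = copySeg F P M a m := by
  induction m with
  | zero => exact place_one _
  | succ m ih => rw [copySeg, copySeg, ← place_mul, ih (by omega), place_matCopy F h M (by omega)]

/-- `M` is a quantum matrix for the pair `{R, F}`. -/
def IsQuantumMatrix (R F : TwoOp N) (M : Matrix (Fin N) (Fin N) A) : Prop :=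
  Commute (numMat A (siteOp 2 R 0)) (matString F 2 M)

theorem place_offset {c c' c'' m n P : ℕ} (h : c' + n ≤ P) (h' : c + m ≤ n) (h'' : c'' + m ≤ P)
    (hc : c' + c = c'') (X : TensorMat N m A) :
    place (offsetEmb h) (place (offsetEmb h') X) = place (offsetEmb h'') X := by
  rw [place_place]
  congr 1
  ext i
  simp [← hc, add_assoc]

variable {R F : TwoOp N} {M : Matrix (Fin N) (Fin N) A}

/-- F_{i+1} carries the copy i + 1 to the copy i + 2, and F_i commutes with the latter by the braid
relation for F. -/
theorem matCopy_conj (hF : IsYangBaxter F) {P i : ℕ} (hi : i + 2 < P) :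
    numMat A (siteOp P F i) * numMat A (siteOp P F (i + 1)) * matCopy F P M (i + 1) =
      matCopy F P M (i + 2) * (numMat A (siteOp P F i) * numMat A (siteOp P F (i + 1))) := by
  have hX : siteOp 3 F 0 * siteOp 3 F 1 * siteOp 3 F 0 =
      siteOp 3 F 1 * siteOp 3 F 0 * siteOp 3 F 1 := hF.2
  have hc := commute_matCopy_of_twist hF.1 hX M (i := i) (j := i + 2) le_rfl hi
  have u4 := numMat_inv_mul (A := A) hF.1 (show i + 1 + 1 < P by omega)
  rw [← mul_assoc, ← hc.eq, mul_assoc, mul_assoc]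
  congr 1
  rw [matCopy.eq_2 F P M (i + 1), mul_assoc, u4, mul_one]

/-- The product F_i F_{i+1} intertwines R_i with R_{i+1} and the pair of copies i, i+1 with the pair
i+1, i+2. So the defining relation propagates from the first two factors to any neighbouring pair.
-/
theorem commute_pair (hRF : IsCompatiblePair R F) (hM : IsQuantumMatrix R F M) {P i : ℕ}
    (hi : i + 1 < P) :
    Commute (numMat A (siteOp P R i)) (matCopy F P M i * matCopy F P M (i + 1)) := by
  induction i with
  | zero =>
    have h2 := congrArg (place (offsetEmb (show 0 + 2 ≤ P by omega))) hM.eq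
    rw [matString_eq_copySeg, ← place_mul, ← place_mul, place_copySeg F _ M (by omega), ← numMat_place,
      place_siteOp _ (by omega), add_zero] at h2
    simpa [copySeg, Commute, SemiconjBy] using h2
  | succ i ih =>
    have hF := hRF.yangBaxter_F
    have ih := ih (by omega)
    have u1 := numMat_mul_inv (A := A) hF.1 (show i + 1 < P by omega)
    have u2 := numMat_inv_mul (A := A) hF.1 (show i + 1 < P by omega)
    have u3 := numMat_mul_inv (A := A) hF.1 (show i + 1 + 1 < P by omega)
    have u4 := numMat_inv_mul (A := A) hF.1 (show i + 1 + 1 < P by omega)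
    have c1 := matCopy_conj (A := A) (M := M) hF (i := i) hi
    have c2 := commute_siteOp_matCopy F F M (show i < i + 1 by omega) (show i + 1 + 1 < P by omega)
    have e1 := siteOp_three (i := i) hi (by omega) (by omega) (by omega) (by omega) (by omega)
      (by omega) hRF.twist_right
    rw [add_zero] at e1
    have e2 := congrArg (numMat A) e1
    simp only [numMat_mul, mul_assoc] at e2
    have m1 : matCopy F P M (i + 1) * numMat A (siteOp P F i) =
        numMat A (siteOp P F i) * matCopy F P M i := by
      rw [matCopy, mul_assoc, u2, mul_one]
    set f := numMat A (siteOp P F i)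
    set f' := numMat A (siteOp P F⁻¹ i)
    set g := numMat A (siteOp P F (i + 1))
    set g' := numMat A (siteOp P F⁻¹ (i + 1))
    set r := numMat A (siteOp P R i)
    set r' := numMat A (siteOp P R (i + 1))
    set x := matCopy F P M i
    set y := matCopy F P M (i + 1)
    set z := matCopy F P M (i + 2)
    have k1 : y * z * (f * g) = f * g * (x * y) := by
      calc y * z * (f * g) = y * (f * g * y) := by rw [c1, mul_assoc]
        _ = f * (x * g) * y := by rw [← mul_assoc, ← mul_assoc, m1]; simp only [mul_assoc]
        _ = _ := by rw [← c2.eq]; simp only [mul_assoc]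
    have k2 : r' * (f * g) = f * g * r := by rw [e2, mul_assoc]
    have k3 : (f * g) * (g' * f') = 1 := by rw [mul_assoc, ← mul_assoc g, u3, one_mul, u1]
    show r' * (y * z) = y * z * r'
    calc r' * (y * z) = r' * (y * z * (f * g)) * (g' * f') := by
          rw [mul_assoc, mul_assoc (y * z), k3, mul_one]
      _ = f * g * (r * (x * y)) * (g' * f') := by
          rw [k1, ← mul_assoc r', k2]; simp only [mul_assoc]
      _ = (y * z) * (r' * (f * g)) * (g' * f') := by
          rw [ih.eq, k2, ← mul_assoc (f * g), ← k1]; simp only [mul_assoc]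
      _ = y * z * r' := by rw [mul_assoc, mul_assoc r', k3, mul_one]

theorem commute_copySeg (hRF : IsCompatiblePair R F) (hM : IsQuantumMatrix R F M) {P a m i : ℕ}
    (hm : a + m ≤ P) (hP : i + 1 < P)
    (hi : a ≤ i ∧ i + 1 < a + m ∨ i + 1 < a ∨ a + m ≤ i) :
    Commute (numMat A (siteOp P R i)) (copySeg F P M a m) := by
  have hfar : ∀ j, i + 2 ≤ j → j < P → Commute (numMat A (siteOp P R i)) (matCopy F P M j) :=
    fun j hj hjP => commute_matCopy_of_twist hRF.yangBaxter_F.1 hRF.twist_left M hj hjP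
  induction m using Nat.strong_induction_on with
  | _ m ih =>
    match m, ih, hi, hm with
    | 0, _, _, _ => exact Commute.one_right _
    | m + 1, ih, hi, hm =>
      rcases Nat.lt_trichotomy (i + 1) (a + m) with h | h | h
      · exact (ih m (by omega) (by omega) (by omega)).mul_right (hfar _ (by omega) (by omega))
      · match m, ih, hi, hm, h with
        | 0, _, hi, _, h => omega
        | m + 1, ih, hi, hm, h =>
          obtain rfl : i = a + m := by omega
          rw [copySeg, copySeg, mul_assoc]
          exact (ih m (by omega) (by omega) (by omega)).mul_right (commute_pair hRF hM hP)
      · exact (ih m (by omega) (by omega) (by omega)).mul_right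
          (commute_siteOp_matCopy F R M (by omega) hP)

/-- The algebra generated by the operators `R_i` on `V^{⊗n}`. -/
def braidAlg (R : TwoOp N) (n : ℕ) : Subalgebra ℂ (TensorMat N n ℂ) :=
  Algebra.adjoin ℂ {x | ∃ i, i + 1 < n ∧ x = siteOp n R i}

theorem siteOp_mem_braidAlg (R : TwoOp N) {n i : ℕ} (h : i + 1 < n) :
    siteOp n R i ∈ braidAlg R n := Algebra.subset_adjoin ⟨i, h, rfl⟩

theorem kappa_mem {B : Type*} [Ring B] [Algebra ℂ B] {S : Subalgebra ℂ B} {q μ : ℂ} {s : B}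
    (h : s ∈ S) : kappa q μ s ∈ S :=
  S.smul_mem (S.mul_mem (S.sub_mem (S.algebraMap_mem _) h) (S.add_mem (S.algebraMap_mem _) h)) _

theorem antisymmetrizer_mem {B : Type*} [Ring B] [Algebra ℂ B] {S : Subalgebra ℂ B} {q μ : ℂ}
    {s : ℕ → B} (m : ℕ) (h : ∀ i, i + 1 < m → s i ∈ S) : antisymmetrizer q μ s m ∈ S := by
  induction m using Nat.strong_induction_on with
  | _ m ih =>
    match m, ih, h with
    | 0, _, _ => exact S.one_mem
    | 1, _, _ => exact S.one_mem
    | m + 2, ih, h =>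
      have h1 := ih (m + 1) (by omega) fun i hi => h i (by omega)
      have h2 := h m (by omega)
      exact S.smul_mem (S.mul_mem (S.mul_mem h1 (S.add_mem (S.add_mem S.one_mem
        (S.smul_mem h2 _)) (S.smul_mem (kappa_mem h2) _))) h1) _

theorem upChain_mem {B : Type*} [Ring B] [Algebra ℂ B] {S : Subalgebra ℂ B} {κ : ℕ → B} {c m : ℕ}
    (h : ∀ j, c ≤ j → j ≤ c + m → κ j ∈ S) : upChain κ c m ∈ S := by
  induction m with
  | zero => exact h c le_rfl le_rfl
  | succ m ih => exact S.mul_mem (ih fun j h1 h2 => h j h1 (by omega)) (h _ (by omega) le_rfl)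

theorem downChain_mem {B : Type*} [Ring B] [Algebra ℂ B] {S : Subalgebra ℂ B} {κ : ℕ → B}
    {c m : ℕ} (h : ∀ j, c ≤ j → j ≤ c + m → κ j ∈ S) : downChain κ c m ∈ S := by
  induction m with
  | zero => exact h c le_rfl le_rfl
  | succ m ih => exact S.mul_mem (h _ (by omega) le_rfl) (ih fun j h1 h2 => h j h1 (by omega))

theorem nest_mem {B : Type*} [Ring B] [Algebra ℂ B] {S : Subalgebra ℂ B} {κ : ℕ → B} {d m : ℕ}
    (h : ∀ j, d ≤ j → j + 2 ≤ d + 2 * m → κ j ∈ S) : nest κ d m ∈ S := by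
  induction m with
  | zero => exact S.one_mem
  | succ m ih =>
    exact S.mul_mem (S.mul_mem (upChain_mem fun j h1 h2 => h j (by omega) (by omega))
      (ih fun j h1 h2 => h j h1 (by omega))) (downChain_mem fun j h1 h2 => h j (by omega) (by omega))

theorem place_mem_braidAlg {R : TwoOp N} {c m P : ℕ} (h : c + m ≤ P) {x : TensorMat N m ℂ}
    (hx : x ∈ braidAlg R m) : place (offsetEmb h) x ∈ braidAlg R P := by
  have : braidAlg R m ≤ (braidAlg R P).comap (placeHom (offsetEmb h)) := by
    refine Algebra.adjoin_le ?_
    rintro _ ⟨i, hi, rfl⟩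
    change place (offsetEmb h) (siteOp m R i) ∈ braidAlg R P
    rw [place_siteOp h hi]
    exact siteOp_mem_braidAlg R (by omega)
  exact this hx

/-- Operators in the image of `W_m`, placed in the factors `c, …, c + m - 1`, commute with a
matrix that commutes with the generators `R_i`, `c ≤ i < c + m - 1`. -/
theorem commute_place_braidAlg {R : TwoOp N} {c m P : ℕ} (h : c + m ≤ P) {x : TensorMat N m ℂ}
    (hx : x ∈ braidAlg R m) {Z : TensorMat N P A}
    (hZ : ∀ i, i + 1 < m → Commute (numMat A (siteOp P R (c + i))) Z) :
    Commute (numMat A (place (offsetEmb h) x)) Z := by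
  have : braidAlg R m ≤
      (Subalgebra.centralizer ℂ {Z}).comap ((numMatHom A P).comp (placeHom (offsetEmb h))) := by
    refine Algebra.adjoin_le ?_
    rintro _ ⟨i, hi, rfl⟩
    change numMat A (place (offsetEmb h) (siteOp m R i)) ∈ Subalgebra.centralizer ℂ {Z}
    rw [place_siteOp h hi, Subalgebra.mem_centralizer_iff]
    rintro _ rfl
    exact (hZ i hi).symm
  exact ((Subalgebra.mem_centralizer_iff ℂ).mp (this hx) Z rfl).symm

end Strings

/-! ## Partial traces -/

section PartialTrace

variable {N : ℕ} {A : Type*} [Ring A] [Algebra ℂ A] {m P : ℕ}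

/-- The trace over the tensor factor `j`, weighted by `D`, as an operator on the same space that is
the identity in the factor `j`. -/
def partialTrace (D : Matrix (Fin N) (Fin N) ℂ) (j : Fin P) (Z : TensorMat N P A) :
    TensorMat N P A :=
  Matrix.of fun a b =>
    if a j = b j then ∑ s, ∑ t, D s t • Z (Function.update a j t) (Function.update b j s) else 0

variable (D : Matrix (Fin N) (Fin N) ℂ)

theorem partialTrace_apply {j : Fin P} (Z : TensorMat N P A) {a b : Fin P → Fin N}
    (h : a j = b j) : partialTrace D j Z a b =
      ∑ s, ∑ t, D s t • Z (Function.update a j t) (Function.update b j s) := by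
  rw [partialTrace, Matrix.of_apply, if_pos h]

theorem partialTrace_apply_of_ne {j : Fin P} (Z : TensorMat N P A) {a b : Fin P → Fin N}
    (h : a j ≠ b j) : partialTrace D j Z a b = 0 := by
  rw [partialTrace, Matrix.of_apply, if_neg h]

theorem update_fill {φ : Fin m ↪ Fin P} {j : Fin P} (hj : j ∉ Set.range φ) (d : Fin m → Fin N)
    (a : Fin P → Fin N) (t : Fin N) :
    Function.update (fill φ d a) j t = fill φ d (Function.update a j t) := by
  funext i
  by_cases hi : i = j
  · subst hi
    rw [fill_apply_of_notMem φ _ _ hj, Function.update_self, Function.update_self]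
  · rw [Function.update_of_ne hi]
    by_cases h : i ∈ Set.range φ
    · obtain ⟨i, rfl⟩ := h
      exact (congrFun (fill_comp φ d _) i).trans (congrFun (fill_comp φ d _) i).symm
    · rw [fill_apply_of_notMem φ _ _ h, fill_apply_of_notMem φ _ _ h, Function.update_of_ne hi]

theorem update_comp {φ : Fin m ↪ Fin P} {j : Fin P} (hj : j ∉ Set.range φ) (a : Fin P → Fin N)
    (t : Fin N) : Function.update a j t ∘ φ = a ∘ φ := by
  funext i
  exact Function.update_of_ne (fun h => hj ⟨i, h⟩) _ _

theorem partialTrace_place_mul {φ : Fin m ↪ Fin P} {j : Fin P} (hj : j ∉ Set.range φ)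
    (X : TensorMat N m A) (Z : TensorMat N P A) :
    partialTrace D j (place φ X * Z) = place φ X * partialTrace D j Z := by
  ext a b
  rw [place_mul_apply]
  by_cases h : a j = b j
  · rw [partialTrace_apply D _ h]
    have : ∀ d, partialTrace D j Z (fill φ d a) b = ∑ s, ∑ t, D s t •
        Z (fill φ d (Function.update a j t)) (Function.update b j s) := by
      intro d
      rw [partialTrace_apply D _ (by rw [fill_apply_of_notMem φ _ _ hj, h])]
      simp only [update_fill hj]
    simp only [this, place_mul_apply, update_comp hj, Finset.mul_sum, Finset.smul_sum,
      mul_smul_comm]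
    rw [Finset.sum_congr rfl fun s _ => Finset.sum_comm, Finset.sum_comm]
  · rw [partialTrace_apply_of_ne D _ h]
    refine (Finset.sum_eq_zero fun d _ => ?_).symm
    rw [partialTrace_apply_of_ne D _ (by rwa [fill_apply_of_notMem φ _ _ hj]), mul_zero]

theorem partialTrace_mul_place {φ : Fin m ↪ Fin P} {j : Fin P} (hj : j ∉ Set.range φ)
    (X : TensorMat N m A) (Z : TensorMat N P A) :
    partialTrace D j (Z * place φ X) = partialTrace D j Z * place φ X := by
  ext a b
  rw [mul_place_apply]
  by_cases h : a j = b j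
  · rw [partialTrace_apply D _ h]
    have : ∀ d, partialTrace D j Z a (fill φ d b) = ∑ s, ∑ t, D s t •
        Z (Function.update a j t) (fill φ d (Function.update b j s)) := by
      intro d
      rw [partialTrace_apply D _ (by rw [fill_apply_of_notMem φ _ _ hj, h])]
      simp only [update_fill hj]
    simp only [this, mul_place_apply, update_comp hj, Finset.sum_mul, Finset.smul_sum,
      smul_mul_assoc]
    rw [Finset.sum_congr rfl fun s _ => Finset.sum_comm, Finset.sum_comm]
  · rw [partialTrace_apply_of_ne D _ h]
    refine (Finset.sum_eq_zero fun d _ => ?_).symm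
    rw [partialTrace_apply_of_ne D _ (by rwa [fill_apply_of_notMem φ _ _ hj]), zero_mul]

theorem partialTrace_mul_diagonal (j : Fin P) (Z : TensorMat N P A) (x : A) :
    partialTrace D j (Z * Matrix.diagonal fun _ => x) =
      partialTrace D j Z * Matrix.diagonal fun _ => x := by
  ext a b
  rw [Matrix.mul_diagonal]
  by_cases h : a j = b j
  · rw [partialTrace_apply D _ h, partialTrace_apply D _ h]
    simp only [Matrix.mul_diagonal, Finset.sum_mul, smul_mul_assoc]
  · rw [partialTrace_apply_of_ne D _ h, partialTrace_apply_of_ne D _ h, zero_mul]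

/-- `Z` acts as the identity in the tensor factor `j`. -/
def Inert (j : Fin P) (Z : TensorMat N P A) : Prop :=
  ∀ a b, (a j ≠ b j → Z a b = 0) ∧
    ∀ c, a j = b j → Z (Function.update a j c) (Function.update b j c) = Z a b

theorem inert_partialTrace (j : Fin P) (Z : TensorMat N P A) : Inert j (partialTrace D j Z) := by
  refine fun a b => ⟨partialTrace_apply_of_ne D Z, fun c h => ?_⟩
  rw [partialTrace_apply D _ (by simp), partialTrace_apply D _ h]
  simp

theorem inert_partialTrace_of_inert {i j : Fin P} {Z : TensorMat N P A} (hZ : Inert i Z) :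
    Inert i (partialTrace D j Z) := by
  by_cases hij : i = j
  · subst hij
    exact inert_partialTrace D i Z
  refine fun a b => ⟨fun h => ?_, fun c h => ?_⟩
  · by_cases hab : a j = b j
    · rw [partialTrace_apply D _ hab]
      refine Finset.sum_eq_zero fun s _ => Finset.sum_eq_zero fun t _ => ?_
      rw [(hZ _ _).1 (by rwa [Function.update_of_ne hij, Function.update_of_ne hij]), smul_zero]
    · exact partialTrace_apply_of_ne D _ hab
  · have hji : j ≠ i := fun h => hij h.symm
    by_cases hab : a j = b j
    · rw [partialTrace_apply D _ (by simpa [Function.update_of_ne hji] using hab),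
        partialTrace_apply D _ hab]
      refine Finset.sum_congr rfl fun s _ => Finset.sum_congr rfl fun t _ => ?_
      rw [Function.update_comm hij, Function.update_comm hij, (hZ _ _).2 c
        (by rwa [Function.update_of_ne hij, Function.update_of_ne hij])]
    · rw [partialTrace_apply_of_ne D _ hab, partialTrace_apply_of_ne]
      simpa [Function.update_of_ne hji] using hab

theorem inert_place {φ : Fin m ↪ Fin P} {j : Fin P} (hj : j ∉ Set.range φ)
    (X : TensorMat N m A) : Inert j (place φ X) := by
  refine fun a b => ⟨fun h => place_apply_of_not _ _ fun h' => h (h' j hj), fun c h => ?_⟩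
  by_cases hab : AgreeOff φ a b
  · rw [place_apply _ _ hab, place_apply, update_comp hj, update_comp hj]
    intro i hi
    by_cases hij : i = j
    · subst hij; simp
    · rw [Function.update_of_ne hij, Function.update_of_ne hij, hab i hi]
  · rw [place_apply_of_not _ _ hab, place_apply_of_not]
    refine fun h' => hab fun i hi => ?_
    by_cases hij : i = j
    · rwa [hij]
    · simpa [Function.update_of_ne hij] using h' i hi

/-- The trace over the factors `c, …, c + m - 1`. -/
def segTrace (c : ℕ) : (m : ℕ) → c + m ≤ P → TensorMat N P A → TensorMat N P A
  | 0, _, Z => Z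
  | m + 1, h, Z => segTrace c m (by omega) (partialTrace D ⟨c + m, by omega⟩ Z)

theorem segTrace_place_mul {l c n : ℕ} {φ : Fin l ↪ Fin P} (h : c + n ≤ P)
    (hφ : ∀ j, c ≤ (φ j).val → c + n ≤ (φ j).val) (X : TensorMat N l A) (Z : TensorMat N P A) :
    segTrace D c n h (place φ X * Z) = place φ X * segTrace D c n h Z := by
  induction n generalizing Z with
  | zero => rfl
  | succ n ih =>
    rw [segTrace, segTrace, partialTrace_place_mul, ih _ (fun j hj => by have := hφ j hj; omega)]
    rintro ⟨j, hj⟩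
    have h1 := congrArg Fin.val hj
    have := hφ j
    simp only at h1
    omega

theorem segTrace_mul_diagonal {c n : ℕ} (h : c + n ≤ P) (Z : TensorMat N P A) (x : A) :
    segTrace D c n h (Z * Matrix.diagonal fun _ => x) =
      segTrace D c n h Z * Matrix.diagonal fun _ => x := by
  induction n generalizing Z with
  | zero => rfl
  | succ n ih => rw [segTrace, segTrace, partialTrace_mul_diagonal, ih]

theorem segTrace_add {c c' n l : ℕ} (h : c + (n + l) ≤ P) (hc : c + n = c')
    (Z : TensorMat N P A) :
    segTrace D c (n + l) h Z = segTrace D c n (by omega) (segTrace D c' l (by omega) Z) := by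
  subst hc
  induction l generalizing Z with
  | zero => rfl
  | succ l ih =>
    have : (⟨c + (n + l), by omega⟩ : Fin P) = ⟨c + n + l, by omega⟩ := Fin.ext (by simp; omega)
    show segTrace D c (n + l) _ (partialTrace D ⟨c + (n + l), _⟩ Z) = _
    rw [ih, segTrace, this]

theorem fill_snoc {c n : ℕ} (h : c + (n + 1) ≤ P) (d : Fin n → Fin N) (t : Fin N)
    (a : Fin P → Fin N) :
    fill (offsetEmb h) (Fin.snoc (α := fun _ => Fin N) d t) a =
      Function.update (fill (offsetEmb (show c + n ≤ P by omega)) d a) ⟨c + n, by omega⟩ t := by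
  set φ := offsetEmb (show c + n ≤ P by omega)
  set j : Fin P := ⟨c + n, by omega⟩ with hj
  have h1 : AgreeOff (offsetEmb h) a (Function.update (fill φ d a) j t) := by
    intro i hi
    rw [mem_range_offsetEmb] at hi
    rw [Function.update_of_ne (by rintro rfl; exact hi (by simp [hj])), fill_apply_of_notMem]
    rw [mem_range_offsetEmb]
    omega
  have h2 : Function.update (fill φ d a) j t ∘ offsetEmb h =
      Fin.snoc (α := fun _ => Fin N) d t := by
    funext i
    refine Fin.lastCases ?_ (fun i => ?_) i
    · rw [Fin.snoc_last]
      exact Function.update_self (β := fun _ => Fin N) j t _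
    · rw [Fin.snoc_castSucc]
      refine (Function.update_of_ne (fun h' => ?_) _ _).trans (congrFun (fill_comp φ d a) i)
      have := congrArg Fin.val h'
      simp [hj] at this
      omega
  rw [h1.eq_fill, h2]

theorem segTrace_apply {c n : ℕ} (h : c + n ≤ P) (Z : TensorMat N P A) (a b : Fin P → Fin N) :
    segTrace D c n h Z a b = if a ∘ offsetEmb h = b ∘ offsetEmb h then
      ∑ s : Fin n → Fin N, ∑ t : Fin n → Fin N, (∏ i, D (s i) (t i)) •
        Z (fill (offsetEmb h) t a) (fill (offsetEmb h) s b) else 0 := by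
  induction n generalizing Z with
  | zero =>
    have : ∀ (d : Fin 0 → Fin N) (a : Fin P → Fin N), fill (offsetEmb h) d a = a := by
      intro d a
      funext i
      exact fill_apply_of_notMem _ _ _ (by rw [mem_range_offsetEmb]; omega)
    rw [if_pos (Subsingleton.elim _ _)]
    simp [segTrace, this]
  | succ n ih =>
    have hn : c + n ≤ P := by omega
    have hc : a ∘ offsetEmb h = b ∘ offsetEmb h ↔ a ∘ offsetEmb hn = b ∘ offsetEmb hn ∧
          a ⟨c + n, by omega⟩ = b ⟨c + n, by omega⟩ := by
      constructor
      · exact fun hh => ⟨funext fun i => congrFun hh i.castSucc, congrFun hh (Fin.last n)⟩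
      · exact fun hh => funext fun i =>
          Fin.lastCases (motive := fun i => (a ∘ offsetEmb h) i = (b ∘ offsetEmb h) i) hh.2
            (fun i => congrFun hh.1 i) i
    have hj : (⟨c + n, by omega⟩ : Fin P) ∉ Set.range (offsetEmb hn) := by
      rw [mem_range_offsetEmb]; simp
    rw [segTrace, ih hn]
    by_cases h1 : a ∘ offsetEmb hn = b ∘ offsetEmb hn
    · by_cases h2 : a ⟨c + n, by omega⟩ = b ⟨c + n, by omega⟩
      · rw [if_pos h1, if_pos (hc.mpr ⟨h1, h2⟩)]
        have hp : ∀ s t : Fin n → Fin N, partialTrace D ⟨c + n, by omega⟩ Z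
            (fill (offsetEmb hn) t a) (fill (offsetEmb hn) s b) =
            ∑ s', ∑ t', D s' t' • Z (fill (offsetEmb h) (Fin.snoc (α := fun _ => Fin N) t t') a)
              (fill (offsetEmb h) (Fin.snoc (α := fun _ => Fin N) s s') b) := by
          intro s t
          rw [partialTrace_apply D _ (by
            rw [fill_apply_of_notMem _ _ _ hj, fill_apply_of_notMem _ _ _ hj, h2])]
          simp only [fill_snoc]
        simp only [hp, ← (Fin.snocEquiv fun _ => Fin N).sum_comp, Fintype.sum_prod_type,
          Fin.snocEquiv_apply, Fin.prod_univ_castSucc, Fin.snoc_castSucc, Fin.snoc_last,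
          Finset.smul_sum, smul_smul]
        rw [Finset.sum_comm (γ := Fin N)]
        refine Finset.sum_congr rfl fun s _ => ?_
        rw [Finset.sum_comm]
        refine Finset.sum_congr rfl fun s' _ => ?_
        rw [Finset.sum_comm]
        rfl
      · rw [if_pos h1, if_neg fun h' => h2 (hc.mp h').2]
        refine Finset.sum_eq_zero fun s _ => Finset.sum_eq_zero fun t _ => ?_
        rw [partialTrace_apply_of_ne, smul_zero]
        rwa [fill_apply_of_notMem _ _ _ hj, fill_apply_of_notMem _ _ _ hj]
    · rw [if_neg h1, if_neg fun h' => h1 (hc.mp h').1]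

/-- This turns the iterated partial traces, which can be moved and split, back into the R-trace. -/
theorem segTrace_place {c n : ℕ} (h : c + n ≤ P) (R : TwoOp N) (Z : TensorMat N n A) :
    segTrace (dMatrix R) c n h (place (offsetEmb h) Z) =
      Matrix.diagonal fun _ => rTrace R n Z := by
  have hf : ∀ a b : Fin P → Fin N, ∀ s t : Fin n → Fin N,
      AgreeOff (offsetEmb h) (fill (offsetEmb h) t a) (fill (offsetEmb h) s b) ↔
        AgreeOff (offsetEmb h) a b := fun a b s t =>
    ⟨fun h' => ((agreeOff_fill _ t a).trans h').trans (agreeOff_fill _ s b).symm,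
      fun h' => ((agreeOff_fill _ t a).symm.trans h').trans (agreeOff_fill _ s b)⟩
  ext a b
  rw [segTrace_apply]
  by_cases hab : a = b
  · subst hab
    rw [if_pos rfl, Matrix.diagonal_apply_eq, rTrace, Matrix.trace]
    simp only [Matrix.diag_apply, Matrix.mul_apply, numMat, Matrix.map_apply, Matrix.of_apply]
    refine Finset.sum_congr rfl fun s _ => Finset.sum_congr rfl fun t _ => ?_
    rw [place_apply _ _ ((hf _ _ _ _).mpr fun _ _ => rfl), fill_comp, fill_comp, Algebra.smul_def]
  · rw [Matrix.diagonal_apply_ne _ hab]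
    split_ifs with h1
    · refine Finset.sum_eq_zero fun s _ => Finset.sum_eq_zero fun t _ => ?_
      rw [place_apply_of_not, smul_zero]
      rw [hf]
      intro h2
      exact hab (by rw [h2.eq_fill, ← h1, fill_self])
    · rfl

/-! ## Transport of the trace along a twist -/

theorem fill_pair {j : ℕ} (h : j + 2 ≤ P) (d : Fin 2 → Fin N) (a : Fin P → Fin N) :
    fill (offsetEmb h) d a =
      Function.update (Function.update a ⟨j, by omega⟩ (d 0)) ⟨j + 1, by omega⟩ (d 1) := by
  have h1 : ∀ i : Fin P, i ∉ Set.range (offsetEmb h) ↔ i.val ≠ j ∧ i.val ≠ j + 1 := by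
    intro i
    rw [mem_range_offsetEmb]
    omega
  refine ((AgreeOff.eq_fill (φ := offsetEmb h) (a := a) fun i hi => ?_).trans ?_).symm
  · rw [h1] at hi
    rw [Function.update_of_ne (by rintro rfl; exact hi.2 rfl),
      Function.update_of_ne (by rintro rfl; exact hi.1 rfl)]
  · congr 1
    funext i
    fin_cases i
    · refine (Function.update_of_ne (fun h' => by simpa using congrArg Fin.val h') _ _).trans (Function.update_self _ _ _)
    · exact Function.update_self _ _ _

/-- `Tr_{(2)} (D_2 F X_1 F⁻¹) = Tr (D X)` for all `X`, in components. -/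
def TwistTrace (D : Matrix (Fin N) (Fin N) ℂ) (F : TwoOp N) : Prop :=
  ∀ a e c c', ∑ b, ∑ d, ∑ f, D f b * (F (a, b) (c, d) * F⁻¹ (c', d) (e, f)) =
    if a = e then D c' c else 0

/-- Brings the three sums of `TwistTrace` innermost. -/
theorem sum_rotate {ι B : Type*} [Fintype ι] [AddCommMonoid B] (f : ι → ι → ι → ι → ι → B) :
    ∑ s, ∑ t, ∑ c', ∑ d, ∑ c, f s t c' d c = ∑ c', ∑ c, ∑ t, ∑ d, ∑ s, f s t c' d c := by
  rw [Finset.sum_congr rfl fun s _ => Finset.sum_comm, Finset.sum_comm]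
  refine Finset.sum_congr rfl fun c' _ => ?_
  rw [Finset.sum_congr rfl fun s _ => Finset.sum_congr rfl fun t _ => Finset.sum_comm,
    Finset.sum_congr rfl fun s _ => Finset.sum_comm, Finset.sum_comm]
  refine Finset.sum_congr rfl fun c _ => ?_
  rw [Finset.sum_comm]
  exact Finset.sum_congr rfl fun t _ => Finset.sum_comm

theorem siteOp_mul_mul_apply {j : ℕ} (h : j + 1 < P) (F G : TwoOp N) (Z : TensorMat N P A)
    (a b : Fin P → Fin N) :
    (numMat A (siteOp P F j) * Z * numMat A (siteOp P G j)) a b =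
      ∑ c', ∑ d', ∑ c, ∑ d, (F (a ⟨j, by omega⟩, a ⟨j + 1, h⟩) (c, d) *
        G (c', d') (b ⟨j, by omega⟩, b ⟨j + 1, h⟩)) •
        Z (Function.update (Function.update a ⟨j, by omega⟩ c) ⟨j + 1, h⟩ d)
          (Function.update (Function.update b ⟨j, by omega⟩ c') ⟨j + 1, h⟩ d') := by
  rw [siteOp_eq_place h, siteOp_eq_place h, numMat_place, numMat_place, mul_place_apply]
  simp only [place_mul_apply, Finset.sum_mul]
  simp only [← (finTwoArrowEquiv (Fin N)).symm.sum_comp, Fintype.sum_prod_type, fill_pair]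
  refine Finset.sum_congr rfl fun c' _ => Finset.sum_congr rfl fun d' _ =>
    Finset.sum_congr rfl fun c _ => Finset.sum_congr rfl fun d _ => ?_
  simp only [numMat, Matrix.map_apply, siteOp_two_apply, finTwoArrowEquiv_symm_apply,
    Matrix.cons_val_zero, Matrix.cons_val_one]
  rw [mul_assoc, Algebra.smul_def, map_mul, mul_assoc]
  exact congrArg _ (Algebra.commutes _ _).symm

theorem Inert.apply_update {j : Fin P} {Z : TensorMat N P A} (hZ : Inert j Z) {a b : Fin P → Fin N}
    (h : a j = b j) (c d : Fin N) :
    Z (Function.update a j c) (Function.update b j d) = if c = d then Z a b else 0 := by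
  split_ifs with hcd
  · rw [hcd, (hZ a b).2 d h]
  · exact (hZ _ _).1 (by simpa using hcd)

/-- All indices outside the factors j and j + 1 are spectators, so this is `TwistTrace` entry by
entry. Inertness of Z in the factor j + 1 says that there Z has the form X ⊗ 1. -/
theorem partialTrace_conj {F : TwoOp N} (hF : TwistTrace D F) {j : ℕ} (h : j + 1 < P)
    {Z : TensorMat N P A} (hZ : Inert ⟨j + 1, h⟩ Z) :
    partialTrace D ⟨j + 1, h⟩ (numMat A (siteOp P F j) * Z * numMat A (siteOp P F⁻¹ j)) =
      partialTrace D ⟨j, by omega⟩ Z := by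
  have hj : (⟨j, by omega⟩ : Fin P) ≠ ⟨j + 1, h⟩ := by simp
  ext a b
  by_cases hab : a ⟨j + 1, h⟩ = b ⟨j + 1, h⟩
  · rw [partialTrace_apply D _ hab]
    have hup : ∀ (a : Fin P → Fin N) (t c d : Fin N), Function.update (Function.update
        (Function.update a ⟨j + 1, h⟩ t) ⟨j, by omega⟩ c) ⟨j + 1, h⟩ d =
        Function.update (Function.update a ⟨j, by omega⟩ c) ⟨j + 1, h⟩ d := by
      intro a t c d
      rw [Function.update_comm hj.symm, Function.update_idem]
    have hz : ∀ c c' d d', Z (Function.update (Function.update a ⟨j, by omega⟩ c) ⟨j + 1, h⟩ d)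
        (Function.update (Function.update b ⟨j, by omega⟩ c') ⟨j + 1, h⟩ d') = if d = d' then
          Z (Function.update a ⟨j, by omega⟩ c) (Function.update b ⟨j, by omega⟩ c') else 0 :=
      fun c c' d d' => hZ.apply_update
        (by rw [Function.update_of_ne hj.symm, Function.update_of_ne hj.symm, hab]) d d'
    simp only [siteOp_mul_mul_apply h, hup, hz, Function.update_self, Function.update_of_ne hj,
      smul_ite, smul_zero, Finset.sum_ite_eq', Finset.mem_univ, if_true,
      Finset.smul_sum, smul_smul]
    trans ∑ c', ∑ c, (if a ⟨j, by omega⟩ = b ⟨j, by omega⟩ then D c' c else 0) •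
      Z (Function.update a ⟨j, by omega⟩ c) (Function.update b ⟨j, by omega⟩ c')
    · simp only [← hF (a ⟨j, by omega⟩) (b ⟨j, by omega⟩), Finset.sum_smul]
      exact sum_rotate _
    · by_cases hab' : a ⟨j, by omega⟩ = b ⟨j, by omega⟩
      · rw [partialTrace_apply D _ hab']
        simp [hab']
      · rw [partialTrace_apply_of_ne D _ hab']
        simp [hab']
  · rw [partialTrace_apply_of_ne D _ hab]
    by_cases hab' : a ⟨j, by omega⟩ = b ⟨j, by omega⟩
    · rw [partialTrace_apply D _ hab']
      refine (Finset.sum_eq_zero fun s _ => Finset.sum_eq_zero fun t _ => ?_).symm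
      rw [(hZ _ _).1 (by rwa [Function.update_of_ne hj.symm, Function.update_of_ne hj.symm]),
        smul_zero]
    · rw [partialTrace_apply_of_ne D _ hab']

end PartialTrace

/-! ## Multiplicativity of characteristic elements -/

section Character

variable {N : ℕ} {A : Type*} [Ring A] [Algebra ℂ A] {m P : ℕ}

theorem partialTrace_siteOp_mul (D : Matrix (Fin N) (Fin N) ℂ) {i j : ℕ} (hi : i + 1 < P)
    (hj : j < P) (h1 : j ≠ i) (h2 : j ≠ i + 1) (X : TwoOp N) (Z : TensorMat N P A) :
    partialTrace D ⟨j, hj⟩ (numMat A (siteOp P X i) * Z) =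
      numMat A (siteOp P X i) * partialTrace D ⟨j, hj⟩ Z := by
  rw [siteOp_eq_place hi, numMat_place, partialTrace_place_mul]
  rw [mem_range_offsetEmb]
  simp only
  omega

theorem partialTrace_mul_siteOp (D : Matrix (Fin N) (Fin N) ℂ) {i j : ℕ} (hi : i + 1 < P)
    (hj : j < P) (h1 : j ≠ i) (h2 : j ≠ i + 1) (X : TwoOp N) (Z : TensorMat N P A) :
    partialTrace D ⟨j, hj⟩ (Z * numMat A (siteOp P X i)) =
      partialTrace D ⟨j, hj⟩ Z * numMat A (siteOp P X i) := by
  rw [siteOp_eq_place hi, numMat_place, partialTrace_mul_place]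
  rw [mem_range_offsetEmb]
  simp only
  omega

/-- The product `F_n F_{n+1} ⋯ F_{n+m-1}`. -/
def twist (A : Type*) [Ring A] [Algebra ℂ A] (F : TwoOp N) (P n : ℕ) : ℕ → TensorMat N P A
  | 0 => 1
  | m + 1 => twist A F P n m * numMat A (siteOp P F (n + m))

/-- The inverse of `twist`. -/
def twistInv (A : Type*) [Ring A] [Algebra ℂ A] (F : TwoOp N) (P n : ℕ) : ℕ → TensorMat N P A
  | 0 => 1
  | m + 1 => numMat A (siteOp P F⁻¹ (n + m)) * twistInv A F P n m

theorem twist_mul_twistInv {F : TwoOp N} (hF : IsUnit F) {n m : ℕ} (h : n + m + 1 ≤ P) :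
    twist A F P n m * twistInv A F P n m = 1 := by
  induction m with
  | zero => exact mul_one 1
  | succ m ih =>
    rw [twist, twistInv, mul_assoc, ← mul_assoc (numMat A _), numMat_mul_inv hF (by omega), one_mul,
      ih (by omega)]

theorem partialTrace_twist_conj (D : Matrix (Fin N) (Fin N) ℂ) (F : TwoOp N) {n m : ℕ}
    (h : n + m + 1 < P) (Z : TensorMat N P A) :
    partialTrace D ⟨n + m + 1, h⟩ (twist A F P n m * Z * twistInv A F P n m) =
      twist A F P n m * partialTrace D ⟨n + m + 1, h⟩ Z * twistInv A F P n m := by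
  have key : ∀ l ≤ m, ∀ Z : TensorMat N P A,
      partialTrace D ⟨n + m + 1, h⟩ (twist A F P n l * Z * twistInv A F P n l) =
        twist A F P n l * partialTrace D ⟨n + m + 1, h⟩ Z * twistInv A F P n l := by
    intro l hl
    induction l with
    | zero => intro Z; simp only [twist, twistInv, one_mul, mul_one]
    | succ l ih =>
      intro Z
      have := ih (by omega) (numMat A (siteOp P F (n + l)) * Z * numMat A (siteOp P F⁻¹ (n + l)))
      rw [partialTrace_mul_siteOp D (by omega) _ (by omega) (by omega),
        partialTrace_siteOp_mul D (by omega) _ (by omega) (by omega)] at this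
      simpa only [twist, twistInv, mul_assoc] using this
  exact key m le_rfl Z

/-- The traces are taken from the right. The last one sees only the last F of the product and moves
one factor to the left; the result is inert in the vacated factor, so the argument repeats. -/
theorem segTrace_twist_conj {D : Matrix (Fin N) (Fin N) ℂ} {F : TwoOp N} (hF : TwistTrace D F)
    {n m : ℕ} (h : n + 1 + m ≤ P) (Z : TensorMat N P A)
    (hZ : ∀ j : Fin P, n + m ≤ j.val → Inert j Z) :
    segTrace D (n + 1) m h (twist A F P n m * Z * twistInv A F P n m) =
      segTrace D n m (by omega) Z := by
  induction m generalizing Z with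
  | zero => simp only [twist, twistInv, one_mul, mul_one, segTrace]
  | succ m ih =>
    have e1 : (⟨n + 1 + m, by omega⟩ : Fin P) = ⟨n + m + 1, by omega⟩ := Fin.ext (by simp; omega)
    have e2 : twist A F P n (m + 1) * Z * twistInv A F P n (m + 1) =
        twist A F P n m * (numMat A (siteOp P F (n + m)) * Z * numMat A (siteOp P F⁻¹ (n + m))) *
          twistInv A F P n m := by
      simp only [twist, twistInv, mul_assoc]
    rw [segTrace, segTrace, e1, e2, partialTrace_twist_conj, partialTrace_conj D hF _
      (hZ _ (by simp only; omega)), ih]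
    intro j hj
    rcases Nat.eq_or_lt_of_le hj with h1 | h1
    · rw [show j = ⟨n + m, by omega⟩ from Fin.ext h1.symm]
      exact inert_partialTrace D _ Z
    · exact inert_partialTrace_of_inert D (hZ j (by omega))

variable {R F : TwoOp N} {M : Matrix (Fin N) (Fin N) A}

/-- Each F in the product moves one copy a step to the right, since F_j carries the copy j to the
copy j + 1 and commutes with the copies 0, …, j - 1 and with those from j + 2 on. -/
theorem copySeg_mul_twist (hF : IsYangBaxter F) (M : Matrix (Fin N) (Fin N) A) {n m : ℕ}
    (h : n + 1 + m ≤ P) :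
    copySeg F P M (n + 1) m * twist A F P n m = twist A F P n m * copySeg F P M n m := by
  have hX : siteOp 3 F 0 * siteOp 3 F 1 * siteOp 3 F 0 =
      siteOp 3 F 1 * siteOp 3 F 0 * siteOp 3 F 1 := hF.2
  induction m with
  | zero => simp only [copySeg, twist, one_mul]
  | succ m ih =>
    have h1 : ∀ l ≤ m, Commute (matCopy F P M (n + m + 1)) (twist A F P n l) := by
      intro l hl
      induction l with
      | zero => exact Commute.one_right _
      | succ l ihl =>
        exact (ihl (by omega)).mul_right
          (commute_matCopy_of_twist hF.1 hX M (by omega) (by omega)).symm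
    have h2 : ∀ l ≤ m, Commute (numMat A (siteOp P F (n + m))) (copySeg F P M n l) := by
      intro l hl
      induction l with
      | zero => exact Commute.one_right _
      | succ l ihl =>
        exact (ihl (by omega)).mul_right
          (commute_siteOp_matCopy F F M (by omega) (by omega))
    have h3 : matCopy F P M (n + m + 1) * numMat A (siteOp P F (n + m)) =
        numMat A (siteOp P F (n + m)) * matCopy F P M (n + m) := by
      rw [matCopy, mul_assoc, numMat_inv_mul hF.1 (by omega), mul_one]
    rw [copySeg, copySeg, twist, show n + 1 + m = n + m + 1 by omega]
    calc copySeg F P M (n + 1) m * matCopy F P M (n + m + 1) *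
          (twist A F P n m * numMat A (siteOp P F (n + m)))
        = copySeg F P M (n + 1) m * (matCopy F P M (n + m + 1) * twist A F P n m) *
          numMat A (siteOp P F (n + m)) := by simp only [mul_assoc]
      _ = copySeg F P M (n + 1) m * twist A F P n m *
          (matCopy F P M (n + m + 1) * numMat A (siteOp P F (n + m))) := by
        rw [(h1 m le_rfl).eq]; simp only [mul_assoc]
      _ = twist A F P n m * (copySeg F P M n m * numMat A (siteOp P F (n + m))) *
          matCopy F P M (n + m) := by
        rw [h3, ih (by omega)]; simp only [mul_assoc]
      _ = _ := by rw [← (h2 m le_rfl).eq]; simp only [mul_assoc]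

theorem siteOp_mul_twist (hRF : IsCompatiblePair R F) {n m i : ℕ} (h : n + 1 + m ≤ P)
    (hi : i + 1 < m) :
    numMat A (siteOp P R (n + 1 + i)) * twist A F P n m =
      twist A F P n m * numMat A (siteOp P R (n + i)) := by
  induction m with
  | zero => omega
  | succ m ih =>
    rcases Nat.eq_or_lt_of_le (Nat.lt_succ_iff.mp hi) with h1 | h1
    · subst h1
      have hc : ∀ l ≤ i, Commute (numMat A (siteOp P R (n + 1 + i))) (twist A F P n l) := by
        intro l hl
        induction l with
        | zero => exact Commute.one_right _
        | succ l ihl =>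
          exact (ihl (by omega)).mul_right (((commute_siteOp (show n + l + 1 < n + 1 + i by omega)
            (by omega) F R).symm).map (numMatHom A P))
      have e1 := siteOp_three (i := n + i) (n := P) (by omega) (by omega) (by omega) (by omega)
        (by omega) (by omega) (by omega) hRF.twist_right
      have e2 := congrArg (numMat A) e1
      simp only [numMat_mul, mul_assoc, add_zero] at e2
      rw [twist, twist, ← mul_assoc, ← mul_assoc, (hc i le_rfl).eq]
      simp only [mul_assoc]
      rw [show n + 1 + i = n + i + 1 by omega, ← add_assoc n i 1, e2]
    · have hc : Commute (numMat A (siteOp P R (n + i))) (numMat A (siteOp P F (n + m))) :=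
        (commute_siteOp (by omega) (by omega) R F).map (numMatHom A P)
      rw [twist, ← mul_assoc, ih (by omega) (by omega), mul_assoc, hc.eq, mul_assoc]

theorem place_mul_twist (hRF : IsCompatiblePair R F) {n m : ℕ} (h : n + 1 + m ≤ P)
    {y : TensorMat N m ℂ} (hy : y ∈ braidAlg R m) :
    numMat A (place (offsetEmb h) y) * twist A F P n m =
      twist A F P n m * numMat A (place (offsetEmb (show n + m ≤ P by omega)) y) := by
  have key : ∀ {c} (h : c + m ≤ P) (z : TensorMat N m ℂ), numMat A (place (offsetEmb h) z) =
      ((numMatHom A P).comp (placeHom (offsetEmb h))) z := fun _ _ => rfl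
  rw [key, key]
  induction hy using Algebra.adjoin_induction with
  | mem x hx =>
    obtain ⟨i, hi, rfl⟩ := hx
    rw [← key, ← key, place_siteOp _ hi, place_siteOp _ hi, siteOp_mul_twist hRF h hi]
  | algebraMap r => rw [AlgHom.commutes, AlgHom.commutes, Algebra.commutes]
  | add x y _ _ hx hy => rw [map_add, map_add, add_mul, hx, hy, mul_add]
  | mul x y _ _ hx hy => rw [map_mul, map_mul, mul_assoc, hy, ← mul_assoc, hx, mul_assoc]

/-- The characteristic element `ch(x) = Tr_R M_{\bar 1} ⋯ M_{\bar n} x`. -/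
def charElem (R F : TwoOp N) (M : Matrix (Fin N) (Fin N) A) (n : ℕ) : TensorMat N n ℂ →ₗ[ℂ] A where
  toFun x := rTrace R n (matString F n M * numMat A x)
  map_add' x y := by
    rw [← numMatHom_apply, map_add, mul_add, rTrace, mul_add, Matrix.trace_add]
    rfl
  map_smul' r x := by
    rw [← numMatHom_apply, map_smul, mul_smul_comm, rTrace, mul_smul_comm, Matrix.trace_smul]
    rfl

theorem charElem_apply (R F : TwoOp N) (M : Matrix (Fin N) (Fin N) A) (n : ℕ)
    (x : TensorMat N n ℂ) : charElem R F M n x = rTrace R n (matString F n M * numMat A x) := rfl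

/-- For n = 0 this is the definition of the character element. Conjugation by `twist` then moves the
copies, the placed operator and the trace by one factor simultaneously, so the scalar is independent
of n. -/
theorem segTrace_copySeg (hRF : IsCompatiblePair R F) (hF : TwistTrace (dMatrix R) F)
    (M : Matrix (Fin N) (Fin N) A) {n m : ℕ} (h : n + m ≤ P) {y : TensorMat N m ℂ}
    (hy : y ∈ braidAlg R m) :
    segTrace (dMatrix R) n m h (copySeg F P M n m * numMat A (place (offsetEmb h) y)) =
      Matrix.diagonal fun _ => charElem R F M m y := by
  induction n with
  | zero =>
    rw [charElem_apply, ← segTrace_place h, ← place_mul, matString_eq_copySeg,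
      place_copySeg F h M (by omega), numMat_place]
  | succ n ih =>
    have hu := twist_mul_twistInv (A := A) (P := P) hRF.yangBaxter_F.1 (n := n) (m := m) (by omega)
    rw [← ih (by omega), ← segTrace_twist_conj hF h]
    · congr 1
      rw [← mul_assoc, ← copySeg_mul_twist hRF.yangBaxter_F M h, mul_assoc (copySeg _ _ _ _ _),
        ← place_mul_twist hRF h hy, mul_assoc, mul_assoc, hu, mul_one]
    · intro j hj
      have hnm : 0 + (n + m) ≤ P := by omega
      rw [← place_copySeg F hnm M le_rfl, ← place_offset hnm le_rfl _ (zero_add n), numMat_place,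
        place_mul]
      refine inert_place ?_ _
      rw [mem_range_offsetEmb]
      omega

/-- `ch(x ⊗ y) = ch(x) ch(y)`. -/
theorem charElem_place_mul_place [NeZero N] (hRF : IsCompatiblePair R F)
    (hF : TwistTrace (dMatrix R) F) (hM : IsQuantumMatrix R F M) {n m : ℕ} (h : 0 + n ≤ P)
    (h' : n + m = P) {x : TensorMat N n ℂ} {y : TensorMat N m ℂ} (hx : x ∈ braidAlg R n)
    (hy : y ∈ braidAlg R m) :
    charElem R F M P (place (offsetEmb h) x * place (offsetEmb h'.le) y) =
      charElem R F M n x * charElem R F M m y := by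
  subst h'
  have hP : 0 + (n + m) ≤ n + m := by omega
  have e1 := segTrace_place hP R (matString F (n + m) M *
    numMat A (place (offsetEmb h) x * place (offsetEmb le_rfl) y))
  have hc : Commute (numMat A (place (offsetEmb h) x)) (copySeg F (n + m) M n m) :=
    commute_place_braidAlg h hx fun i hi => commute_copySeg hRF hM le_rfl (by omega) (by omega)
  have e2 : place (offsetEmb hP) (matString F (n + m) M *
      numMat A (place (offsetEmb h) x * place (offsetEmb le_rfl) y)) =
      place (offsetEmb h) (matString F n M * numMat A x) *
        (copySeg F (n + m) M n m * numMat A (place (offsetEmb le_rfl) y)) := by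
    rw [← place_mul, ← place_mul, matString_eq_copySeg, matString_eq_copySeg,
      place_copySeg F _ M (by omega), place_copySeg F _ M (by omega), copySeg_add, zero_add,
      numMat_mul, ← place_mul, ← numMat_place, ← numMat_place, ← numMat_place,
      place_offset hP h h (zero_add 0), place_offset hP le_rfl le_rfl (zero_add n)]
    simp only [mul_assoc]
    rw [← mul_assoc (copySeg F (n + m) M n m), ← hc.eq]
    simp only [mul_assoc]
  rw [e2, segTrace_add _ hP (zero_add n), segTrace_place_mul, segTrace_copySeg hRF hF M le_rfl hy,
    segTrace_mul_diagonal, segTrace_place, Matrix.diagonal_mul_diagonal] at e1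
  -- An equality of scalar matrices is compared at one diagonal entry, which exists because N ≠ 0.
  · have := congrFun (congrFun e1 fun _ => 0) fun _ => 0
    rw [Matrix.diagonal_apply_eq, Matrix.diagonal_apply_eq] at this
    exact this.symm
  · intro j hj
    rw [offsetEmb_val] at hj
    omega

end Character

/-! ## The matrix `D_R` -/

section DMatrix

variable {N : ℕ} {R : TwoOp N}

theorem isSkewInverse_skewInverse (h : IsSkewInvertible R) : IsSkewInverse R (skewInverse R) := by
  rw [skewInverse, dif_pos h]
  exact h.choose_spec

/-- The identity Tr_(2) D_2 R = 1: trace the first skew-inverse relation over b = d. -/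
theorem sum_mul_dMatrix (h : IsSkewInvertible R) (a c : Fin N) :
    ∑ s, ∑ t, dMatrix R s t * R (a, t) (c, s) = if a = c then 1 else 0 := by
  have h1 : ∀ b, ∑ s, ∑ t, R (a, s) (c, t) * skewInverse R (t, b) (s, b) =
      if a = b ∧ b = c then 1 else 0 := fun b => (isSkewInverse_skewInverse h).1 a b c b
  have h2 := Finset.sum_congr (s₁ := Finset.univ) rfl fun b _ => h1 b
  rw [Finset.sum_comm, Finset.sum_congr rfl fun s _ => Finset.sum_comm, Finset.sum_comm] at h2
  have h3 : (∑ b, if a = b ∧ b = c then (1 : ℂ) else 0) = if a = c then 1 else 0 := by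
    simp only [ite_and, Finset.sum_ite_eq, Finset.mem_univ, if_true]
  rw [h3] at h2
  rw [← h2]
  refine Finset.sum_congr rfl fun s _ => Finset.sum_congr rfl fun t _ => ?_
  rw [dMatrix, Matrix.of_apply, mul_comm, Finset.mul_sum]

/-- Skew invertibility means that partial contraction with R is an invertible linear map on
matrices, with inverse given by Ψ_R; an unknown Y can be recovered from its contraction. -/
theorem eq_of_skew (h : IsSkewInvertible R) {Y W : Fin N → Fin N → ℂ}
    (hY : ∀ a c, ∑ s, ∑ t, R (a, s) (c, t) * Y t s = W a c) (a c : Fin N) :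
    Y a c = ∑ s, ∑ t, skewInverse R (a, s) (c, t) * W t s := by
  have h1 : ∀ b d, ∑ s, ∑ t, skewInverse R (a, s) (c, t) * R (t, b) (s, d) =
      if a = d ∧ b = c then 1 else 0 := fun b d => (isSkewInverse_skewInverse h).2 a b c d
  calc Y a c = ∑ b, ∑ d, (if a = d ∧ b = c then 1 else 0) * Y d b := by
        simp only [ite_and, ite_mul, one_mul, zero_mul, Finset.sum_ite_eq, Finset.mem_univ,
          if_true, Finset.sum_ite_eq']
    _ = ∑ b, ∑ d, ∑ s, ∑ t, skewInverse R (a, s) (c, t) * (R (t, b) (s, d) * Y d b) := by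
        simp only [← h1, Finset.sum_mul, mul_assoc]
    _ = _ := by
        simp only [← hY, Finset.mul_sum]
        rw [Finset.sum_congr rfl fun b _ => Finset.sum_comm, Finset.sum_comm]
        refine Finset.sum_congr rfl fun s _ => ?_
        rw [Finset.sum_congr rfl fun b _ => Finset.sum_comm, Finset.sum_comm]

theorem partialTrace_siteOp (h : IsSkewInvertible R) {P j : ℕ} (hj : j + 1 < P) :
    partialTrace (dMatrix R) ⟨j + 1, hj⟩ (siteOp P R j) = 1 := by
  have hne : (⟨j, by omega⟩ : Fin P) ≠ ⟨j + 1, hj⟩ := by simp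
  ext a b
  by_cases hab : a ⟨j + 1, hj⟩ = b ⟨j + 1, hj⟩
  · rw [partialTrace_apply _ _ hab]
    by_cases hag : ∀ i : Fin P, i.val ≠ j → i.val ≠ j + 1 → a i = b i
    · have : ∀ s t, siteOp P R j (Function.update a ⟨j + 1, hj⟩ t) (Function.update b ⟨j + 1, hj⟩ s)
          = R (a ⟨j, by omega⟩, t) (b ⟨j, by omega⟩, s) := by
        intro s t
        rw [siteOp_apply hj, if_pos]
        · simp only [Function.update_of_ne hne, Function.update_self]
        · intro i h1 h2
          have : i ≠ ⟨j + 1, hj⟩ := fun h => h2 (congrArg Fin.val h)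
          rw [Function.update_of_ne this, Function.update_of_ne this, hag i h1 h2]
      simp only [this, smul_eq_mul, sum_mul_dMatrix h, Matrix.one_apply]
      refine if_congr ⟨fun h1 => ?_, fun h1 => by rw [h1]⟩ rfl rfl
      funext i
      by_cases h2 : i.val = j
      · rwa [show i = ⟨j, by omega⟩ from Fin.ext h2]
      by_cases h3 : i.val = j + 1
      · rwa [show i = ⟨j + 1, hj⟩ from Fin.ext h3]
      exact hag i h2 h3
    · rw [Matrix.one_apply_ne (by rintro rfl; exact hag fun _ _ _ => rfl)]
      refine Finset.sum_eq_zero fun s _ => Finset.sum_eq_zero fun t _ => ?_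
      rw [siteOp_apply hj, if_neg, smul_zero]
      refine fun hh => hag fun i h1 h2 => ?_
      have : i ≠ ⟨j + 1, hj⟩ := fun h => h2 (congrArg Fin.val h)
      simpa [Function.update_of_ne this] using hh i h1 h2
  · rw [partialTrace_apply_of_ne _ _ hab, Matrix.one_apply_ne (by rintro rfl; exact hab rfl)]

theorem numMat_complex {n : ℕ} (X : TensorMat N n ℂ) : numMat ℂ X = X := by
  ext a b
  simp [numMat]

/-- The hypothesis gives X_2 R_1 X_2⁻¹ = X_1⁻¹ R_2 X_1. Tracing out the third factor makes the
right-hand side 1, as Tr_(3) D_3 R_2 = 1. The left-hand side is R contracted with the tensor to be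
determined, and skew invertibility recovers that tensor. -/
theorem twistTrace_of_twist (h : IsSkewInvertible R) {X : TwoOp N} (hX : IsUnit X)
    (H : siteOp 3 X 0 * siteOp 3 X 1 * siteOp 3 R 0 = siteOp 3 R 1 * siteOp 3 X 0 * siteOp 3 X 1) :
    TwistTrace (dMatrix R) X := by
  have u0 := siteOp_inv_mul (n := 3) (i := 0) (by omega) hX
  have u1 := siteOp_mul_inv (n := 3) (i := 1) (by omega) hX
  have e1 : siteOp 3 X 1 * siteOp 3 R 0 * siteOp 3 X⁻¹ 1 =
      siteOp 3 X⁻¹ 0 * (siteOp 3 R 1 * siteOp 3 X 0) := by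
    calc siteOp 3 X 1 * siteOp 3 R 0 * siteOp 3 X⁻¹ 1
        = siteOp 3 X⁻¹ 0 * (siteOp 3 X 0 * siteOp 3 X 1 * siteOp 3 R 0) * siteOp 3 X⁻¹ 1 := by
          rw [mul_assoc (siteOp 3 X 0), ← mul_assoc, u0, one_mul]
      _ = _ := by rw [H, mul_assoc, mul_assoc _ _ (siteOp 3 X⁻¹ 1), u1, mul_one]
  have e2 : partialTrace (dMatrix R) ⟨1 + 1, by omega⟩
      (siteOp 3 X 1 * siteOp 3 R 0 * siteOp 3 X⁻¹ 1) = 1 := by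
    have a1 := partialTrace_siteOp_mul (A := ℂ) (dMatrix R) (i := 0) (j := 1 + 1) (P := 3)
      (by omega) (by omega) (by omega) (by omega) X⁻¹ (siteOp 3 R 1 * siteOp 3 X 0)
    have a2 := partialTrace_mul_siteOp (A := ℂ) (dMatrix R) (i := 0) (j := 1 + 1) (P := 3)
      (by omega) (by omega) (by omega) (by omega) X (siteOp 3 R 1)
    rw [numMat_complex] at a1 a2
    rw [e1, a1, a2, partialTrace_siteOp h, one_mul, u0]
  have e3 : ∀ a e x y, ∑ c, ∑ c', R (x, c) (y, c') *
      (∑ b, ∑ d, ∑ f, dMatrix R f b * (X (a, b) (c, d) * X⁻¹ (c', d) (e, f))) =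
      if x = y then (if a = e then 1 else 0) else 0 := by
    intro a e x y
    -- The third index is immaterial, both sides being the identity in that factor; a serves as an
    -- available value.
    have := congrFun (congrFun e2 ![x, a, a]) ![y, e, a]
    have hsite : ∀ c c' d d' s t : Fin N, siteOp 3 R 0
        (Function.update (Function.update (Function.update ![x, a, a] 2 t) 1 c) 2 d)
        (Function.update (Function.update (Function.update ![y, e, a] 2 s) 1 c') 2 d') =
        if d = d' then R (x, c) (y, c') else 0 := by
      intro c c' d d' s t
      rw [siteOp_apply (by omega)]
      refine if_congr ⟨fun hh => ?_, fun hh j h1 h2 => ?_⟩ ?_ rfl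
      · simpa using hh 2 (by decide) (by decide)
      · obtain rfl : j = 2 := by omega
        simpa using hh
      · simp
    rw [partialTrace_apply _ _ (by simp)] at this
    have hs := fun Z a b => siteOp_mul_mul_apply (A := ℂ) (P := 3) (j := 1) (by omega) X X⁻¹ Z a b
    simp only [numMat_complex] at hs
    simp only [hs] at this
    simp only [show (⟨1 + 1, by omega⟩ : Fin 3) = 2 from rfl, show (⟨1, by omega⟩ : Fin 3) = 1 from rfl,
      hsite, smul_eq_mul, mul_ite, mul_zero, Finset.sum_ite_eq', Finset.mem_univ, if_true,
      Finset.mul_sum] at this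
    rw [sum_rotate] at this
    have hone : (1 : TensorMat N 3 ℂ) ![x, a, a] ![y, e, a] =
        if x = y then (if a = e then 1 else 0) else 0 := by
      rw [Matrix.one_apply, ← ite_and]
      refine if_congr ⟨fun h1 => ⟨congrFun h1 0, congrFun h1 1⟩, fun h1 => ?_⟩ rfl rfl
      rw [h1.1, h1.2]
    rw [← hone, ← this, Finset.sum_comm]
    simp only [Finset.mul_sum]
    refine Finset.sum_congr rfl fun c' _ => Finset.sum_congr rfl fun c _ =>
      Finset.sum_congr rfl fun t _ => Finset.sum_congr rfl fun d _ =>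
      Finset.sum_congr rfl fun s _ => ?_
    simp only [Function.update_self, ne_eq, Function.update_of_ne, Matrix.cons_val, 
      show (1 : Fin 3) ≠ 2 by decide, not_false_eq_true]
    ring
  intro a e c c'
  rw [eq_of_skew h (Y := fun c' c => ∑ b, ∑ d, ∑ f, dMatrix R f b *
    (X (a, b) (c, d) * X⁻¹ (c', d) (e, f))) (e3 a e) c' c]
  simp only [mul_ite, mul_one, mul_zero, Finset.sum_ite_eq', Finset.mem_univ, if_true]
  split_ifs
  · simp [dMatrix]
  · simp

theorem twistTrace_self (h : IsSkewInvertible R) (hR : IsYangBaxter R) :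
    TwistTrace (dMatrix R) R := twistTrace_of_twist h hR.1 hR.2

theorem twistTrace_inv (h : IsSkewInvertible R) (hR : IsYangBaxter R) :
    TwistTrace (dMatrix R) R⁻¹ := by
  have v0 := siteOp_inv_mul (n := 3) (i := 0) (by omega) hR.1
  have v1 := siteOp_inv_mul (n := 3) (i := 1) (by omega) hR.1
  have u0 := siteOp_mul_inv (n := 3) (i := 0) (by omega) hR.1
  have u1 := siteOp_mul_inv (n := 3) (i := 1) (by omega) hR.1
  refine twistTrace_of_twist h ((Matrix.isUnit_nonsing_inv_iff).mpr hR.1) ?_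
  have h2 := hR.2
  set r := siteOp 3 R 0
  set r' := siteOp 3 R⁻¹ 0
  set s := siteOp 3 R 1
  set s' := siteOp 3 R⁻¹ 1
  have e1 : s * r * s * r' * s' = r := by
    rw [← h2, mul_assoc (r * s), u0, mul_one, mul_assoc, u1, mul_one]
  calc r' * s' * r = r' * (s' * s) * r * s * r' * s' := by
        conv_lhs => rw [← e1]
        simp only [mul_assoc]
    _ = s * r' * s' := by rw [v1, mul_one, v0, one_mul]

/-- `D_R ⊗ ⋯ ⊗ D_R`. -/
def dPow (R : TwoOp N) (n : ℕ) : TensorMat N n ℂ := Matrix.of fun a b => ∏ j, dMatrix R (a j) (b j)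

theorem commute_dPow_place {m P : ℕ} (φ : Fin m ↪ Fin P) {X : TensorMat N m ℂ}
    (h : Commute (dPow R m) X) : Commute (dPow R P) (place φ X) := by
  classical
  have hsplit : ∀ f : Fin P → ℂ, ∏ j, f j =
      (∏ j ∈ Finset.univ.filter fun j => j ∉ Set.range φ, f j) * ∏ i, f (φ i) := by
    intro f
    rw [← Finset.prod_filter_mul_prod_filter_not _ fun j => j ∉ Set.range φ]
    congr 1
    rw [← Finset.prod_map Finset.univ φ]
    refine Finset.prod_congr ?_ fun _ _ => rfl
    ext j
    simp
  ext a b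
  rw [mul_place_apply, place_mul_apply]
  have h1 : ∀ d, dPow R P a (fill φ d b) * X d (b ∘ φ) =
      (∏ j ∈ Finset.univ.filter fun j => j ∉ Set.range φ, dMatrix R (a j) (b j)) *
        (dPow R m (a ∘ φ) d * X d (b ∘ φ)) := by
    intro d
    rw [dPow, Matrix.of_apply, hsplit, mul_assoc]
    congr 1
    · refine Finset.prod_congr rfl fun j hj => ?_
      rw [fill_apply_of_notMem φ _ _ (Finset.mem_filter.mp hj).2]
    · simp only [dPow, Matrix.of_apply, Function.comp, φ.injective.extend_apply, fill]
  have h2 : ∀ d, X (a ∘ φ) d * dPow R P (fill φ d a) b =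
      (∏ j ∈ Finset.univ.filter fun j => j ∉ Set.range φ, dMatrix R (a j) (b j)) *
        (X (a ∘ φ) d * dPow R m d (b ∘ φ)) := by
    intro d
    rw [dPow, Matrix.of_apply, hsplit, mul_left_comm]
    congr 1
    · refine Finset.prod_congr rfl fun j hj => ?_
      rw [fill_apply_of_notMem φ _ _ (Finset.mem_filter.mp hj).2]
    · simp only [dPow, Matrix.of_apply, Function.comp, φ.injective.extend_apply, fill]
  simp only [h1, h2, ← Finset.mul_sum, ← Matrix.mul_apply, h.eq]

/-- The twist-trace identities for R and R⁻¹, solved by skew invertibility, express R⁻¹ D_2 and D_2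
R⁻¹ through Ψ_R and one D each. Multiplying by the missing D on the other side gives the same
expression, so D ⊗ D commutes with R⁻¹, hence with R. -/
theorem commute_dPow_siteOp_two (h : IsSkewInvertible R) (hR : IsYangBaxter R) :
    Commute (dPow R 2) (siteOp 2 R 0) := by
  have hdet := (Matrix.isUnit_iff_isUnit_det _).mp hR.1
  have hW : ∀ a b c d, ∑ f, R⁻¹ (a, b) (c, f) * dMatrix R f d =
      ∑ x, skewInverse R (b, x) (d, c) * dMatrix R a x := by
    intro a b c d
    rw [eq_of_skew h (Y := fun b d => ∑ f, R⁻¹ (a, b) (c, f) * dMatrix R f d)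
      (W := fun p r => if p = c then dMatrix R a r else 0)]
    · simp
    · intro p r
      rw [← twistTrace_self h hR]
      simp only [Finset.mul_sum]
      refine Finset.sum_congr rfl fun s _ => Finset.sum_congr rfl fun t _ =>
        Finset.sum_congr rfl fun f _ => ?_
      ring
  have hV : ∀ a b c d, ∑ f, dMatrix R b f * R⁻¹ (a, f) (c, d) =
      ∑ x, skewInverse R (b, a) (d, x) * dMatrix R x c := by
    intro a b c d
    rw [eq_of_skew h (Y := fun b d => ∑ f, dMatrix R b f * R⁻¹ (a, f) (c, d))
      (W := fun p r => if a = r then dMatrix R p c else 0)]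
    · simp
    · intro p r
      rw [← twistTrace_inv h hR, Matrix.nonsing_inv_nonsing_inv _ hdet]
      simp only [Finset.mul_sum]
      rw [Finset.sum_congr rfl fun s _ => Finset.sum_comm, Finset.sum_comm]
      refine Finset.sum_congr rfl fun s _ => Finset.sum_congr rfl fun t _ =>
        Finset.sum_congr rfl fun f _ => ?_
      ring
  have hinv : Commute (dPow R 2) (siteOp 2 R⁻¹ 0) := by
    have hd : dPow R 2 = siteOp 2 (Matrix.of fun a b => dMatrix R a.1 b.1 * dMatrix R a.2 b.2) 0 := by
      ext a b
      rw [siteOp_two_apply, dPow, Matrix.of_apply, Matrix.of_apply, Fin.prod_univ_two]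
    rw [hd, Commute, SemiconjBy, siteOp_mul (by omega), siteOp_mul (by omega)]
    congr 1
    ext ⟨a, b⟩ ⟨c, d⟩
    simp only [Matrix.mul_apply, Fintype.sum_prod_type, Matrix.of_apply]
    calc ∑ x, ∑ y, dMatrix R a x * dMatrix R b y * R⁻¹ (x, y) (c, d)
        = ∑ x, dMatrix R a x * ∑ y, dMatrix R b y * R⁻¹ (x, y) (c, d) := by
          simp only [Finset.mul_sum, mul_assoc]
      _ = ∑ x, ∑ y, dMatrix R a x * (skewInverse R (b, x) (d, y) * dMatrix R y c) := by
          simp only [hV, Finset.mul_sum]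
      _ = ∑ y, dMatrix R y c * ∑ x, skewInverse R (b, x) (d, y) * dMatrix R a x := by
          rw [Finset.sum_comm]
          simp only [Finset.mul_sum]
          refine Finset.sum_congr rfl fun s _ => Finset.sum_congr rfl fun t _ => ?_
          ring
      _ = _ := by
          simp only [← hW, Finset.mul_sum]
          refine Finset.sum_congr rfl fun s _ => Finset.sum_congr rfl fun t _ => ?_
          ring
  have u := siteOp_mul_inv (n := 2) (i := 0) (by omega) hR.1
  have v := siteOp_inv_mul (n := 2) (i := 0) (by omega) hR.1
  calc dPow R 2 * siteOp 2 R 0 = siteOp 2 R 0 * (siteOp 2 R⁻¹ 0 * dPow R 2) * siteOp 2 R 0 := by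
        rw [← mul_assoc, u, one_mul]
    _ = _ := by rw [← hinv.eq, ← mul_assoc, mul_assoc, v, mul_one]

theorem commute_dPow_braidAlg (h : IsSkewInvertible R) (hR : IsYangBaxter R) {n : ℕ}
    {x : TensorMat N n ℂ} (hx : x ∈ braidAlg R n) : Commute (dPow R n) x := by
  have : braidAlg R n ≤ Subalgebra.centralizer ℂ {dPow R n} := by
    refine Algebra.adjoin_le ?_
    rintro _ ⟨i, hi, rfl⟩
    rw [SetLike.mem_coe, Subalgebra.mem_centralizer_iff]
    rintro _ rfl
    rw [siteOp_eq_place hi]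
    exact commute_dPow_place _ (commute_dPow_siteOp_two h hR)
  exact (Subalgebra.mem_centralizer_iff ℂ).mp (this hx) _ rfl

end DMatrix

/-! ### Idempotent and rank-one matrices. -/

section Idempotent

variable {ι : Type*} [Fintype ι] [DecidableEq ι]

theorem trace_eq_rank_of_isIdempotentElem {p : Matrix ι ι ℂ} (h : p * p = p) :
    p.trace = (p.rank : ℂ) := by
  have h' : IsIdempotentElem p.toLin' := by
    rw [IsIdempotentElem, Module.End.mul_eq_comp, ← Matrix.toLin'_mul, h]
  rw [← Matrix.trace_toLin'_eq, (LinearMap.IsIdempotentElem.isProj_range _ h').trace]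
  rfl

theorem eq_zero_of_isIdempotentElem_of_trace {p : Matrix ι ι ℂ} (h : p * p = p)
    (ht : p.trace = 0) : p = 0 := by
  have h' : IsIdempotentElem p.toLin' := by
    rw [IsIdempotentElem, Module.End.mul_eq_comp, ← Matrix.toLin'_mul, h]
  rw [← Matrix.trace_toLin'_eq] at ht
  simpa using (LinearMap.IsIdempotentElem.trace_eq_zero_iff h').mp ht

/-- A rank-one p is a column times a row, so pZp differs from p by the scalar row · Z · column. -/
theorem mul_mul_self_of_rank_eq_one {p : Matrix ι ι ℂ} (h : p.rank = 1) (Z : Matrix ι ι ℂ) :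
    p * Z * p = (p * Z).trace • p := by
  obtain ⟨v, -, hv⟩ := finrank_eq_one_iff'.mp h
  have h1 : ∀ j, ∃ c : ℂ, ∀ i, p i j = c * v.1 i := by
    intro j
    obtain ⟨c, hc⟩ := hv ⟨p.mulVecLin (Pi.single j 1), ⟨_, rfl⟩⟩
    refine ⟨c, fun i => ?_⟩
    have := congrFun (congrArg Subtype.val hc) i
    simpa using this.symm
  choose c hc using h1
  ext i j
  simp only [Matrix.mul_apply, Matrix.smul_apply, Matrix.trace, Matrix.diag_apply, smul_eq_mul,
    hc, Finset.sum_mul]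
  refine Finset.sum_congr rfl fun a _ => Finset.sum_congr rfl fun b _ => ?_
  ring

end Idempotent

/-! ### Characters of the BMW images. -/

section Character

variable {N : ℕ} {A : Type*} [Ring A] [Algebra ℂ A] {R F : TwoOp N}
  {M : Matrix (Fin N) (Fin N) A} {q μ : ℂ}

theorem place_full {n : ℕ} (h : 0 + n ≤ n) (x : TensorMat N n A) : place (offsetEmb h) x = x := by
  have h1 : ∀ a : Fin n → Fin N, a ∘ offsetEmb h = a := fun a =>
    funext fun i => congrArg a (Fin.ext (by simp))
  ext a b
  rw [place_apply, h1, h1]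
  intro j hj
  rw [mem_range_offsetEmb] at hj
  omega

/-- The trace over a noncommutative A is not cyclic in general; it is when one factor is numerical.
-/
theorem trace_numMat_mul {n : ℕ} (Y : TensorMat N n ℂ) (Z : TensorMat N n A) :
    (numMat A Y * Z).trace = (Z * numMat A Y).trace := by
  simp only [Matrix.trace, Matrix.diag_apply, Matrix.mul_apply, numMat, Matrix.map_apply]
  rw [Finset.sum_comm]
  exact Finset.sum_congr rfl fun a _ => Finset.sum_congr rfl fun b _ => Algebra.commutes _ _

theorem commute_braidAlg_matString (hRF : IsCompatiblePair R F) (hM : IsQuantumMatrix R F M) {n : ℕ}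
    {x : TensorMat N n ℂ} (hx : x ∈ braidAlg R n) : Commute (numMat A x) (matString F n M) := by
  have h : 0 + n ≤ n := by omega
  rw [← place_full h x, matString_eq_copySeg]
  exact commute_place_braidAlg h hx fun i hi =>
    commute_copySeg hRF hM (by omega) (by omega) (Or.inl ⟨by omega, by omega⟩)

/-- A family of linear functionals on the images of the BMW algebras that is cyclic and
multiplicative. -/
structure IsCharacter (R : TwoOp N) (τ : ∀ n, TensorMat N n ℂ →ₗ[ℂ] A) : Prop where
  one : τ 0 1 = 1
  mul_comm : ∀ {n : ℕ} {x y : TensorMat N n ℂ}, x ∈ braidAlg R n → y ∈ braidAlg R n →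
    τ n (x * y) = τ n (y * x)
  place_mul_place : ∀ {n m P : ℕ} (h : 0 + n ≤ P) (h' : n + m = P) {x : TensorMat N n ℂ}
    {y : TensorMat N m ℂ}, x ∈ braidAlg R n → y ∈ braidAlg R m →
    τ P (place (offsetEmb h) x * place (offsetEmb h'.le) y) = τ n x * τ m y

/-- Cyclicity holds because an operator in the braid image commutes both with D_R ⊗ ⋯ ⊗ D_R and with
the string of copies, and may thus be carried around the trace. -/
theorem isCharacter_charElem [NeZero N] (hRF : IsCompatiblePair R F) (hM : IsQuantumMatrix R F M) :
    IsCharacter R (charElem R F M) where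
  one := by
    rw [charElem_apply, rTrace, matString_eq_copySeg, copySeg, one_mul, ← numMat_mul, mul_one]
    simp [Matrix.trace, numMat]
  mul_comm {n x y} hx hy := by
    have hD := (commute_dPow_braidAlg hRF.strict_R.1 hRF.yangBaxter_R hy).map (numMatHom A n)
    have hT := commute_braidAlg_matString (A := A) hRF hM hy
    simp only [numMatHom_apply] at hD
    rw [charElem_apply, charElem_apply, rTrace, rTrace]
    change (numMat A (dPow R n) * _).trace = (numMat A (dPow R n) * _).trace
    rw [numMat_mul, numMat_mul, ← mul_assoc, ← mul_assoc, ← trace_numMat_mul]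
    congr 1
    calc numMat A y * (numMat A (dPow R n) * matString F n M * numMat A x)
        = (numMat A y * numMat A (dPow R n)) * matString F n M * numMat A x := by
          simp only [mul_assoc]
      _ = numMat A (dPow R n) * (numMat A y * matString F n M) * numMat A x := by
          rw [← hD.eq]; simp only [mul_assoc]
      _ = _ := by rw [hT.eq]; simp only [mul_assoc]
  place_mul_place h h' _ _ hx hy := charElem_place_mul_place hRF
    (twistTrace_of_twist hRF.strict_R.1 hRF.yangBaxter_F.1 hRF.twist_right.symm) hM h h' hx hy

/-- The second character, without weights. On idempotents it returns ranks, which supplies the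
integrality and positivity behind the rank comparison. -/
theorem isCharacter_trace (R : TwoOp N) :
    IsCharacter R fun n => Matrix.traceLinearMap (Fin n → Fin N) ℂ ℂ where
  one := by simp [Matrix.trace]
  mul_comm _ _ := Matrix.trace_mul_comm _ _
  place_mul_place {n m P} h h' x y _ _ := by
    subst h'
    simp only [Matrix.traceLinearMap_apply, Matrix.trace, Matrix.diag_apply, Finset.sum_mul_sum]
    rw [← Fintype.sum_prod_type', ← (Fin.appendEquiv n m).sum_comp]
    refine Finset.sum_congr rfl fun a _ => ?_
    have hd : ∀ i j, offsetEmb h i ≠ offsetEmb (le_refl (n + m)) j := fun i j hij => by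
      have := congrArg Fin.val hij
      simp only [offsetEmb_val] at this
      omega
    have e1 : ∀ i, offsetEmb h i = Fin.castAdd m i := fun i => Fin.ext (by simp)
    have e2 : ∀ i, offsetEmb (le_refl (n + m)) i = Fin.natAdd n i := fun i => Fin.ext (by simp)
    have h1 : Fin.appendEquiv n m a ∘ offsetEmb h = a.1 := funext fun i => by
      rw [Function.comp, e1]
      exact Fin.append_left a.1 a.2 i
    have h2 : Fin.appendEquiv n m a ∘ offsetEmb (le_refl (n + m)) = a.2 := funext fun i => by
      rw [Function.comp, e2]
      exact Fin.append_right a.1 a.2 i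
    rw [place_mul_place_apply _ _ hd, fill_self, place_apply _ _ fun _ _ => rfl, h1, h2]

/-! ## The rank one operator `κ` -/

theorem kappa_siteOp {n m P i : ℕ} (h : n + m ≤ P) (hi : i + 1 < m) :
    place (offsetEmb h) (kappa q μ (siteOp m R i)) = kappa q μ (siteOp P R (n + i)) := by
  rw [← placeHom_apply, map_kappa, placeHom_apply, place_siteOp h hi]

theorem kappa_siteOp_eq_place {P i : ℕ} (h : i + 2 ≤ P) :
    kappa q μ (siteOp P R i) = place (offsetEmb h) (kappa q μ (siteOp 2 R 0)) := by
  rw [kappa_siteOp h (by omega), add_zero]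

theorem place_ne_zero [NeZero N] {m P : ℕ} (φ : Fin m ↪ Fin P) {X : TensorMat N m A} (h : X ≠ 0) :
    place φ X ≠ 0 := by
  refine fun h0 => h ?_
  ext a b
  have := congrFun (congrFun h0 (fill φ a fun _ => 0)) (fill φ b fun _ => 0)
  rwa [place_apply _ _ ((agreeOff_fill φ a _).symm.trans (agreeOff_fill φ b _)), fill_comp,
    fill_comp] at this

/-- Let E be the weighted trace of κ_3 over the last of four factors. Tracing σ_3 κ_2 = σ_2⁻¹ κ_3
κ_2 gives E κ_2 = μ κ_2, and then κ_1 κ_2 κ_1 = κ_1 gives E κ_1 = μ κ_1. Tracing κ_2 κ_3 κ_2 = κ_2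
gives Tr D_R = μη. Tracing E κ_1 = μ κ_1 over the third factor yields Tr_R κ = μ · μη. The fourth
factor leaves room for a non-zero κ_1 disjoint from the traced factors, so that scalars can be
compared. -/
theorem rTrace_kappa [NeZero N] (hskew : IsSkewInvertible R) (hR : IsYangBaxter R)
    (hbmw : IsBMWType R q μ) (hK : kappa q μ (siteOp 2 R 0) ≠ 0) :
    rTrace R 2 (kappa q μ (siteOp 2 R 0)) = μ ^ 2 * eta q μ := by
  have fam := bmwFamily_siteOp hbmw hR.1 4
  set κ : ℕ → TensorMat N 4 ℂ := fun i => kappa q μ (siteOp 4 R i) with hκ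
  set D := dMatrix R
  have hne : ∀ i, i + 2 ≤ 4 → κ i ≠ 0 := fun i hi => by
    rw [hκ]
    simp only
    rw [kappa_siteOp_eq_place hi]
    exact place_ne_zero _ hK
  have pl : ∀ {j i : ℕ} (hj : j < 4) (hi : i + 2 ≤ 4) (h1 : j ≠ i) (h2 : j ≠ i + 1)
      (Z : TensorMat N 4 ℂ), partialTrace D ⟨j, hj⟩ (κ i * Z) = κ i * partialTrace D ⟨j, hj⟩ Z := by
    intro j i hj hi h1 h2 Z
    rw [hκ]
    simp only
    rw [kappa_siteOp_eq_place hi, partialTrace_place_mul]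
    rw [mem_range_offsetEmb]
    simp only
    omega
  have pr : ∀ {j i : ℕ} (hj : j < 4) (hi : i + 2 ≤ 4) (h1 : j ≠ i) (h2 : j ≠ i + 1)
      (Z : TensorMat N 4 ℂ), partialTrace D ⟨j, hj⟩ (Z * κ i) = partialTrace D ⟨j, hj⟩ Z * κ i := by
    intro j i hj hi h1 h2 Z
    rw [hκ]
    simp only
    rw [kappa_siteOp_eq_place hi, partialTrace_mul_place]
    rw [mem_range_offsetEmb]
    simp only
    omega
  have p1 : ∀ {j : ℕ} (hj : j < 4),
      partialTrace D ⟨j, hj⟩ (1 : TensorMat N 4 ℂ) = rTrace R 1 (1 : TensorMat N 1 ℂ) • 1 := by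
    intro j hj
    have := segTrace_place (show j + 1 ≤ 4 from hj) R (1 : TensorMat N 1 ℂ)
    rw [place_one] at this
    rw [Matrix.smul_one_eq_diagonal]
    exact this
  set E := partialTrace D ⟨3, by omega⟩ (κ 2) with hE
  have hE1 : E * κ 1 = μ • κ 1 := by
    have h1 := congrArg (partialTrace D ⟨3, by omega⟩) (fam.sk_adj 1 2 (by omega) (by omega)
      (by omega))
    have h2 := partialTrace_siteOp hskew (P := 4) (j := 2) (by omega)
    have h3 := partialTrace_siteOp_mul (A := ℂ) D (P := 4) (i := 1) (j := 3) (by omega) (by omega)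
      (by omega) (by omega) R⁻¹ (κ 2 * κ 1)
    rw [numMat_complex] at h3
    rw [mul_assoc] at h1
    change partialTrace D _ (siteOp 4 R 2 * κ 1) =
      partialTrace D _ (siteOp 4 R⁻¹ 1 * (κ 2 * κ 1)) at h1
    rw [pr (by omega) (by omega) (by omega) (by omega), h3, pr (by omega) (by omega) (by omega)
      (by omega), h2, one_mul] at h1
    have h4 := fam.sk 1 (by omega)
    change _ * κ 1 = _ • κ 1 at h4
    rw [← h4]
    conv_rhs => rw [h1]
    rw [← mul_assoc, fam.mul_inv 1 (by omega), one_mul]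
  have hE0 : E * κ 0 = μ • κ 0 := by
    have hc : Commute (κ 0) E := by
      have := (fam.commute_kappa (i := 0) (j := 2) (by omega) (by omega) (by omega)).eq
      have := congrArg (partialTrace D ⟨3, by omega⟩) this
      change partialTrace D _ (κ 0 * κ 2) = partialTrace D _ (κ 2 * κ 0) at this
      rwa [pl (by omega) (by omega) (by omega) (by omega), pr (by omega) (by omega) (by omega)
        (by omega)] at this
    have h1 := fam.kkk 0 1 (by omega) (by omega) (by omega)
    change κ 0 * κ 1 * κ 0 = κ 0 at h1
    calc E * κ 0 = E * (κ 0 * κ 1 * κ 0) := by rw [h1]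
      _ = κ 0 * (E * κ 1) * κ 0 := by rw [← mul_assoc, ← mul_assoc, ← hc.eq]; simp only [mul_assoc]
      _ = μ • κ 0 := by rw [hE1, mul_smul_comm, smul_mul_assoc, h1]
  have hD : rTrace R 1 (1 : TensorMat N 1 ℂ) = μ * eta q μ := by
    have h1 := congrArg (partialTrace D ⟨3, by omega⟩) (fam.kkk 1 2 (by omega) (by omega) (by omega))
    change partialTrace D _ (κ 1 * κ 2 * κ 1) = partialTrace D _ (κ 1) at h1
    have h2 := fam.kk 1 (by omega)
    change κ 1 * κ 1 = _ • κ 1 at h2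
    rw [pr (by omega) (by omega) (by omega) (by omega), pl (by omega) (by omega) (by omega)
      (by omega), mul_assoc, ← hE, hE1, mul_smul_comm, h2, smul_smul, ← mul_one (κ 1),
      pl (by omega) (by omega) (by omega) (by omega), p1, mul_smul_comm] at h1
    exact (smul_left_injective ℂ (by rw [mul_one]; exact hne 1 (by omega)) h1).symm
  have hP : 2 + 2 ≤ 4 := le_rfl
  have h1 := segTrace_place hP R (kappa q μ (siteOp 2 R 0))
  rw [← kappa_siteOp_eq_place] at h1
  change partialTrace D ⟨2, by omega⟩ E = _ at h1
  have h2 := congrArg (partialTrace D ⟨2, by omega⟩) hE0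
  rw [pr (by omega) (by omega) (by omega) (by omega), h1, ← Matrix.smul_one_eq_diagonal,
    smul_mul_assoc, one_mul] at h2
  have h3 : partialTrace D ⟨2, by omega⟩ (μ • κ 0) = (μ * (μ * eta q μ)) • κ 0 := by
    have e1 : μ • κ 0 = κ 0 * 1 * Matrix.diagonal fun _ => μ := by
      rw [mul_one, ← Matrix.smul_one_eq_diagonal, mul_smul_comm, mul_one]
    rw [e1, partialTrace_mul_diagonal, pl (by omega) (by omega) (by omega) (by omega), p1, hD,
      ← Matrix.smul_one_eq_diagonal, mul_smul_comm, mul_smul_comm, mul_one, mul_one, smul_smul]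
  rw [h3] at h2
  rw [smul_left_injective ℂ (hne 0 (by omega)) h2]
  ring

/-- The normalized contraction operator is an idempotent of rank one. -/
theorem contraction_eq_charElem [NeZero N] (hskew : IsSkewInvertible R) (hR : IsYangBaxter R)
    (hbmw : IsBMWType R q μ) (hη : eta q μ ≠ 0) (hK : kappa q μ (siteOp 2 R 0) ≠ 0)
    (hrank : ((eta q μ)⁻¹ • kappa q μ (siteOp 2 R 0)).rank = 1) :
    contraction R F q μ M = charElem R F M 2 ((eta q μ)⁻¹ • kappa q μ (siteOp 2 R 0)) := by
  have hkk := (bmwFamily_siteOp hbmw hR.1 2).kk 0 (by omega)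
  have htr := rTrace_kappa hskew hR hbmw hK
  have hmem : kappa q μ (siteOp 2 R 0) ∈ braidAlg R 2 := kappa_mem (siteOp_mem_braidAlg R (by omega))
  set κ := kappa q μ (siteOp 2 R 0)
  set p := (eta q μ)⁻¹ • κ with hp
  have hpp : p * p = p := by
    rw [hp, smul_mul_smul_comm, hkk, smul_smul, mul_assoc, inv_mul_cancel₀ hη, mul_one]
  have hc : Commute (dPow R 2) p := (commute_dPow_braidAlg hskew hR hmem).smul_right _
  -- Since p has rank one and commutes with D ⊗ D, the latter acts on its image by the scalar Tr(p
  -- (D ⊗ D)), which is η⁻¹ μ² η. This is where the factor μ² in the definition of g comes from.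
  have hpD : p * dPow R 2 = (μ ^ 2) • p := by
    have h1 := mul_mul_self_of_rank_eq_one hrank (dPow R 2)
    rw [mul_assoc, hc.eq, ← mul_assoc, hpp] at h1
    rw [h1]
    congr 1
    rw [Matrix.trace_mul_comm, hp, mul_smul_comm, Matrix.trace_smul]
    have : rTrace R 2 κ = (dPow R 2 * κ).trace := by
      rw [rTrace, numMat_complex]
      rfl
    rw [← this, htr, smul_eq_mul]
    field_simp
  rw [contraction, charElem_apply, rTrace]
  change _ = (numMat A (dPow R 2) * (_ * numMat A p)).trace
  rw [trace_numMat_mul, mul_assoc, ← numMat_mul, hpD, ← numMatHom_apply (A := A) ((μ ^ 2) • p),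
    map_smul, mul_smul_comm, Matrix.trace_smul]
  rfl

end Character

/-! ## Characters of antisymmetrizers -/

section Congruence

variable {A B : Type*} [Ring A] [Algebra ℂ A] [Ring B] [Algebra ℂ B]

theorem antisymmetrizer_congr {q μ : ℂ} {s s' : ℕ → A} (m : ℕ) (h : ∀ i, i + 1 < m → s i = s' i) :
    antisymmetrizer q μ s m = antisymmetrizer q μ s' m := by
  induction m using Nat.strong_induction_on with
  | _ m ih =>
    match m, ih, h with
    | 0, _, _ => rfl
    | 1, _, _ => rfl
    | m + 2, ih, h =>
      rw [antisymmetrizer, antisymmetrizer, ih (m + 1) (by omega) fun i hi => h i (by omega),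
        h m (by omega)]

theorem mul_antisymmetrizer_of_intertwine {q μ : ℂ} {s s' : ℕ → A} {u : A} (m : ℕ)
    (h : ∀ i, i + 1 < m → u * s i = s' i * u) :
    u * antisymmetrizer q μ s m = antisymmetrizer q μ s' m * u := by
  have hk : ∀ {x y : A}, u * x = y * u → u * kappa q μ x = kappa q μ y * u := by
    intro x y hxy
    simp only [kappa, mul_smul_comm, smul_mul_assoc]
    have h1 : u * (algebraMap ℂ A q - x) = (algebraMap ℂ A q - y) * u := by
      rw [mul_sub, sub_mul, hxy, Algebra.commutes]
    have h2 : u * (algebraMap ℂ A q⁻¹ + x) = (algebraMap ℂ A q⁻¹ + y) * u := by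
      rw [mul_add, add_mul, hxy, Algebra.commutes]
    rw [← mul_assoc, h1, mul_assoc, h2, mul_assoc]
  induction m using Nat.strong_induction_on with
  | _ m ih =>
    match m, ih, h with
    | 0, _, _ => simp [antisymmetrizer]
    | 1, _, _ => simp [antisymmetrizer]
    | m + 2, ih, h =>
      have h1 := ih (m + 1) (by omega) fun i hi => h i (by omega)
      have h2 := h m (by omega)
      have h3 : ∀ x, u * baxMinus q μ (s m) x = baxMinus q μ (s' m) x * u := by
        intro x
        simp only [baxMinus, mul_add, add_mul, mul_smul_comm, smul_mul_assoc, h2, hk h2, mul_one,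
          one_mul]
      rw [antisymmetrizer, antisymmetrizer, mul_smul_comm, smul_mul_assoc, ← mul_assoc,
        ← mul_assoc, h1, mul_assoc (antisymmetrizer q μ s' (m + 1)) u, h3, ← mul_assoc,
        mul_assoc _ u, h1, mul_assoc _ _ u]

theorem upChain_congr {κ κ' : ℕ → A} {c m : ℕ} (h : ∀ j, c ≤ j → j ≤ c + m → κ j = κ' j) :
    upChain κ c m = upChain κ' c m := by
  induction m with
  | zero => exact h c le_rfl le_rfl
  | succ m ih =>
    rw [upChain, upChain, ih fun j h1 h2 => h j h1 (by omega), h (c + m + 1) (by omega) le_rfl]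

theorem downChain_congr {κ κ' : ℕ → A} {c m : ℕ} (h : ∀ j, c ≤ j → j ≤ c + m → κ j = κ' j) :
    downChain κ c m = downChain κ' c m := by
  induction m with
  | zero => exact h c le_rfl le_rfl
  | succ m ih =>
    rw [downChain, downChain, ih fun j h1 h2 => h j h1 (by omega),
      h (c + m + 1) (by omega) le_rfl]

theorem nest_congr {κ κ' : ℕ → A} {d m : ℕ} (h : ∀ j, d ≤ j → j + 2 ≤ d + 2 * m → κ j = κ' j) :
    nest κ d m = nest κ' d m := by
  induction m with
  | zero => rfl
  | succ m ih =>
    rw [nest, nest, ih fun j h1 h2 => h j h1 (by omega),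
      upChain_congr fun j h1 h2 => h j (by omega) (by omega),
      downChain_congr fun j h1 h2 => h j (by omega) (by omega)]

theorem map_upChain (f : A →ₐ[ℂ] B) (κ : ℕ → A) (c m : ℕ) :
    f (upChain κ c m) = upChain (fun i => f (κ i)) c m := by
  induction m with
  | zero => rfl
  | succ m ih => rw [upChain, upChain, map_mul, ih]

theorem map_downChain (f : A →ₐ[ℂ] B) (κ : ℕ → A) (c m : ℕ) :
    f (downChain κ c m) = downChain (fun i => f (κ i)) c m := by
  induction m with
  | zero => rfl
  | succ m ih => rw [downChain, downChain, map_mul, ih]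

theorem map_nest (f : A →ₐ[ℂ] B) (κ : ℕ → A) (d m : ℕ) :
    f (nest κ d m) = nest (fun i => f (κ i)) d m := by
  induction m with
  | zero => exact map_one f
  | succ m ih => rw [nest, nest, map_mul, map_mul, ih, map_upChain, map_downChain]

end Congruence

/-! ### Values of characters on antisymmetrizers and nested contractions. -/

section Characters

variable {N : ℕ} {A : Type*} [Ring A] [Algebra ℂ A] {R : TwoOp N} {q μ : ℂ} {k : ℕ}
  {τ : ∀ n, TensorMat N n ℂ →ₗ[ℂ] A}

theorem place_antisymOp {c m P : ℕ} (h : c + m ≤ P) :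
    place (offsetEmb h) (antisymOp R q μ m m) =
      antisymmetrizer q μ (fun i => siteOp P R (c + i)) m := by
  rw [antisymOp, ← placeHom_apply, map_antisymmetrizer]
  exact antisymmetrizer_congr m fun i hi => place_siteOp h hi R

theorem place_nest {d m n P : ℕ} (h : 0 + n ≤ P) (hn : d + 2 * m ≤ n) :
    place (offsetEmb h) (nest (fun i => kappa q μ (siteOp n R i)) d m) =
      nest (fun i => kappa q μ (siteOp P R i)) d m := by
  rw [← placeHom_apply, map_nest]
  refine nest_congr fun j _ h2 => ?_
  rw [placeHom_apply, kappa_siteOp h (by omega), zero_add]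

theorem antisymOp_mem (R : TwoOp N) (q μ : ℂ) (m : ℕ) : antisymOp R q μ m m ∈ braidAlg R m :=
  antisymmetrizer_mem m fun _ hi => siteOp_mem_braidAlg R hi

theorem kappa_siteOp_mem (R : TwoOp N) (q μ : ℂ) {P i : ℕ} (h : i + 1 < P) :
    kappa q μ (siteOp P R i) ∈ braidAlg R P := kappa_mem (siteOp_mem_braidAlg R h)

theorem commute_place_kappa {d j P : ℕ} (h : 0 + d ≤ P) (hd : d ≤ j) (hj : j + 2 ≤ P)
    (x : TensorMat N d ℂ) : Commute (place (offsetEmb h) x) (kappa q μ (siteOp P R j)) := by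
  have := commute_place (A := ℂ) (offsetEmb h) (offsetEmb hj) (fun i i' hi => by
    have := congrArg Fin.val hi
    simp only [offsetEmb_val] at this
    omega) x (kappa q μ (siteOp 2 R 0))
  rwa [numMat_complex, ← kappa_siteOp_eq_place hj] at this

/-- By cyclicity the outer chains meet and collapse to η times a κ in the last two factors. That κ
splits off by multiplicativity, and the smaller nest remains. -/
theorem IsCharacter.apply_nest (hτ : IsCharacter R τ) (hbmw : IsBMWType R q μ) (hR : IsUnit R)
    {d m P : ℕ} (hP : P = d + 2 * m) (h : 0 + d ≤ P) {x : TensorMat N d ℂ}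
    (hx : x ∈ braidAlg R d) :
    τ P (nest (fun i => kappa q μ (siteOp P R i)) d m * place (offsetEmb h) x) =
      eta q μ ^ m • (τ d x * τ 2 (kappa q μ (siteOp 2 R 0)) ^ m) := by
  induction m generalizing P with
  | zero =>
    obtain rfl : P = d := by omega
    rw [nest, one_mul, place_full, pow_zero, pow_zero, one_smul, mul_one]
  | succ m ih =>
    set n := d + 2 * m with hn
    have h0 : 0 + n ≤ P := by omega
    have h1 : 0 + d ≤ n := by omega
    have h2 : n + 2 = P := by omega
    have fam := bmwFamily_siteOp hbmw hR P
    have hW : place (offsetEmb h0) (nest (fun i => kappa q μ (siteOp n R i)) d m *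
        place (offsetEmb h1) x) =
        nest (fun i => kappa q μ (siteOp P R i)) d m * place (offsetEmb h) x := by
      rw [← place_mul, place_nest h0 le_rfl, place_offset h0 h1 h (zero_add 0)]
    have hDU := fam.downChain_mul_upChain (c := d + m) (m := m) (by omega)
    have mk : ∀ j, j + 1 < P → kappa q μ (siteOp P R j) ∈ braidAlg R P :=
      fun j hj => kappa_siteOp_mem R q μ hj
    have mU : upChain (fun i => kappa q μ (siteOp P R i)) (d + m) m ∈ braidAlg R P :=
      upChain_mem fun j _ _ => mk j (by omega)
    have mD : downChain (fun i => kappa q μ (siteOp P R i)) (d + m) m ∈ braidAlg R P :=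
      downChain_mem fun j _ _ => mk j (by omega)
    have mN : nest (fun i => kappa q μ (siteOp P R i)) d m ∈ braidAlg R P :=
      nest_mem fun j _ _ => mk j (by omega)
    have mX := place_mem_braidAlg h hx
    have cD : Commute (place (offsetEmb h) x)
        (downChain (fun i => kappa q μ (siteOp P R i)) (d + m) m) :=
      commute_downChain fun j _ _ => commute_place_kappa h (by omega) (by omega) x
    rw [nest]
    have mW : nest (fun i => kappa q μ (siteOp n R i)) d m * place (offsetEmb h1) x ∈
        braidAlg R n :=
      mul_mem (nest_mem fun j _ _ => kappa_siteOp_mem R q μ (by omega)) (place_mem_braidAlg h1 hx)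
    have hih := ih hn h1
    set U := upChain (fun i => kappa q μ (siteOp P R i)) (d + m) m
    set D := downChain (fun i => kappa q μ (siteOp P R i)) (d + m) m
    set Nn := nest (fun i => kappa q μ (siteOp P R i)) d m
    set X := place (offsetEmb h) x
    have e1 : U * Nn * D * X = U * (Nn * X * D) := by
      rw [mul_assoc, ← cD.eq]; simp only [mul_assoc]
    have e2 : Nn * X * D * U = eta q μ • (Nn * X * kappa q μ (siteOp P R n)) := by
      rw [mul_assoc, hDU, mul_smul_comm, show d + m + m = n by omega]
    rw [e1, hτ.mul_comm mU (mul_mem (mul_mem mN mX) mD), e2, map_smul, ← hW,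
      kappa_siteOp_eq_place (P := P) (i := n) h2.le, hτ.place_mul_place h0 h2 mW
      (kappa_siteOp_mem R q μ (by omega)), hih, pow_succ, pow_succ, smul_mul_assoc, smul_smul,
      _root_.mul_comm (eta q μ), mul_assoc]

/-- The operator `a^{(n)} ⊗ a^{(m)}` on `V^{⊗(n+m)}`. -/
def pairOp (R : TwoOp N) (q μ : ℂ) (n m : ℕ) : TensorMat N (n + m) ℂ :=
  place (offsetEmb (show 0 + n ≤ n + m by omega)) (antisymOp R q μ n n) *
    place (offsetEmb le_rfl) (antisymOp R q μ m m)

/-- The operator `a^{(d)}`, multiplied by `m` nested contractions, on `V^{⊗(d+2m)}`. -/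
def nestOp (R : TwoOp N) (q μ : ℂ) (d m : ℕ) : TensorMat N (d + m + m) ℂ :=
  nest (fun i => kappa q μ (siteOp (d + m + m) R i)) d m *
    place (offsetEmb (show 0 + d ≤ d + m + m by omega)) (antisymOp R q μ d d)

theorem pairOp_mem (R : TwoOp N) (q μ : ℂ) (n m : ℕ) : pairOp R q μ n m ∈ braidAlg R (n + m) :=
  mul_mem (place_mem_braidAlg _ (antisymOp_mem R q μ n))
    (place_mem_braidAlg _ (antisymOp_mem R q μ m))

theorem nestOp_mem (R : TwoOp N) (q μ : ℂ) (d m : ℕ) :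
    nestOp R q μ d m ∈ braidAlg R (d + m + m) :=
  mul_mem (nest_mem fun j _ _ => kappa_siteOp_mem R q μ (by omega))
    (place_mem_braidAlg _ (antisymOp_mem R q μ d))

theorem IsCharacter.apply_pairOp (hτ : IsCharacter R τ) (n m : ℕ) :
    τ (n + m) (pairOp R q μ n m) = τ n (antisymOp R q μ n n) * τ m (antisymOp R q μ m m) :=
  hτ.place_mul_place _ rfl (antisymOp_mem R q μ n) (antisymOp_mem R q μ m)

theorem IsCharacter.apply_nestOp (hτ : IsCharacter R τ) (hbmw : IsBMWType R q μ) (hR : IsUnit R)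
    (d m : ℕ) : τ (d + m + m) (nestOp R q μ d m) = eta q μ ^ m •
      (τ d (antisymOp R q μ d d) * τ 2 (kappa q μ (siteOp 2 R 0)) ^ m) :=
  hτ.apply_nest hbmw hR (by omega) _ (antisymOp_mem R q μ d)

theorem pairOp_nestOp (hbmw : IsBMWType R q μ) (hR : IsUnit R) {d m : ℕ}
    (hg : Generic q μ (d + m)) :
    pairOp R q μ (d + m) m * pairOp R q μ (d + m) m = pairOp R q μ (d + m) m ∧
      nestOp R q μ d m * nestOp R q μ d m = eta q μ ^ (2 * m) • nestOp R q μ d m ∧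
      ∃ c : ℂ, c ≠ 0 ∧ nestOp R q μ d m * pairOp R q μ (d + m) m * nestOp R q μ d m =
        c • nestOp R q μ d m :=
  (bmwFamily_siteOp hbmw hR (d + m + m)).antisymmetrizer_nest_equiv hg (by omega) le_rfl
    (by rw [pairOp, place_antisymOp, place_antisymOp]; simp only [zero_add])
    (by rw [nestOp, place_antisymOp]; simp only [zero_add])

theorem antisymOp_mul_self (hbmw : IsBMWType R q μ) (hR : IsUnit R) (hg : Generic q μ k) {m : ℕ}
    (hm : m ≤ k) : antisymOp R q μ m m * antisymOp R q μ m m = antisymOp R q μ m m :=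
  (bmwFamily_siteOp hbmw hR m).antisymmetrizer_mul_self hg hm le_rfl

/-- The normalized contraction operator. -/
def contractionOp (R : TwoOp N) (q μ : ℂ) : TensorMat N 2 ℂ :=
  (eta q μ)⁻¹ • kappa q μ (siteOp 2 R 0)

theorem contractionOp_mul_self (hbmw : IsBMWType R q μ) (hR : IsUnit R) (hη : eta q μ ≠ 0) :
    contractionOp R q μ * contractionOp R q μ = contractionOp R q μ := by
  have hkk := (bmwFamily_siteOp hbmw hR 2).kk 0 (by omega)
  rw [contractionOp, smul_mul_smul_comm, hkk, smul_smul, mul_assoc, inv_mul_cancel₀ hη, mul_one]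

theorem IsCharacter.smul_apply_nestOp (hτ : IsCharacter R τ) (hbmw : IsBMWType R q μ)
    (hR : IsUnit R) (hη : eta q μ ≠ 0) (d m : ℕ) :
    (eta q μ ^ (2 * m))⁻¹ • τ (d + m + m) (nestOp R q μ d m) =
      τ d (antisymOp R q μ d d) * τ 2 (contractionOp R q μ) ^ m := by
  have : kappa q μ (siteOp 2 R 0) = eta q μ • contractionOp R q μ := by
    rw [contractionOp, smul_smul, mul_inv_cancel₀ hη, one_smul]
  rw [hτ.apply_nestOp hbmw hR, this, map_smul, smul_pow, mul_smul_comm, smul_smul, smul_smul, mul_assoc,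
    ← pow_add, two_mul, inv_mul_cancel₀ (pow_ne_zero _ hη), one_smul]

/-- The trace of `c⁻¹ P Q P` and its idempotency, for `Q P Q = c Q`, `Q² = z Q`. -/
theorem exists_nat_trace_sub {ι : Type*} [Fintype ι] [DecidableEq ι] {P Q : Matrix ι ι ℂ} {z c : ℂ}
    (hz : z ≠ 0) (hc : c ≠ 0) (hP : P * P = P) (hQ : Q * Q = z • Q) (hQPQ : Q * P * Q = c • Q) :
    (∃ n : ℕ, P.trace - z⁻¹ • Q.trace = n) ∧
      (P.trace = z⁻¹ • Q.trace → P * Q * P = c • P) := by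
  -- The part of P complementary to the copy of Q inside it; being idempotent, it has a natural
  -- number as trace and vanishes when that trace does.
  set E := P - c⁻¹ • (P * Q * P)
  have h1 : P * Q * P * (P * Q * P) = c • (P * Q * P) := by
    calc P * Q * P * (P * Q * P) = P * (Q * (P * P) * Q) * P := by simp only [mul_assoc]
      _ = _ := by rw [hP, hQPQ, mul_smul_comm, smul_mul_assoc]
  have h2 : P * (P * Q * P) = P * Q * P := by rw [← mul_assoc, ← mul_assoc, hP]
  have h3 : P * Q * P * P = P * Q * P := by rw [mul_assoc, hP]
  have hE : E * E = E := by
    simp only [E, sub_mul, mul_sub, hP, smul_mul_assoc, mul_smul_comm, h1, h2, h3, smul_smul,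
      inv_mul_cancel₀ hc, one_smul, sub_self, smul_zero, sub_zero]
  have h4 : (P * Q * P).trace = (Q * P).trace := by
    rw [mul_assoc, Matrix.trace_mul_comm, mul_assoc, hP]
  have h5 : c * Q.trace = z * (Q * P).trace := by
    rw [← smul_eq_mul, ← Matrix.trace_smul, ← hQPQ, mul_assoc, Matrix.trace_mul_comm, mul_assoc,
      hQ, mul_smul_comm, Matrix.trace_smul, smul_eq_mul, Matrix.trace_mul_comm]
  have h6 : E.trace = P.trace - z⁻¹ • Q.trace := by
    simp only [E, Matrix.trace_sub, Matrix.trace_smul, h4, smul_eq_mul]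
    congr 1
    field_simp
    linear_combination -h5
  refine ⟨⟨E.rank, by rw [← h6, trace_eq_rank_of_isIdempotentElem hE]⟩, fun h => ?_⟩
  have h7 := eq_zero_of_isIdempotentElem_of_trace hE (by rw [h6, h, sub_self])
  have h8 := sub_eq_zero.mp h7
  conv_rhs => rw [h8]
  rw [smul_smul, mul_inv_cancel₀ hc, one_smul]

theorem antisymOp_zero (R : TwoOp N) (q μ : ℂ) : antisymOp R q μ 0 0 = 1 := rfl

/-- The trace of P - c⁻¹PQP is a natural number. For d + m = k the two traces in it are 1 · rk
a^{(m)} and rk a^{(d)} times the m-th power of the rank of the contraction. -/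
theorem rank_antisymOp_le (hbmw : IsBMWType R q μ) (hR : IsUnit R) (hg : Generic q μ k)
    (hrank : (antisymOp R q μ k k).rank = 1) {d m : ℕ} (hk : d + m = k) :
    (antisymOp R q μ d d).rank * (contractionOp R q μ).rank ^ m ≤ (antisymOp R q μ m m).rank := by
  subst hk
  obtain ⟨i1, i2, c, hc, i3⟩ := pairOp_nestOp hbmw hR hg
  obtain ⟨⟨n, hn⟩, -⟩ := exists_nat_trace_sub (pow_ne_zero _ hg.eta_ne) hc i1 i2 i3
  have hτ := isCharacter_trace R
  have e1 := hτ.apply_pairOp (q := q) (μ := μ) (d + m) m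
  have e2 := hτ.smul_apply_nestOp hbmw hR hg.eta_ne d m
  simp only [Matrix.traceLinearMap_apply] at e1 e2
  rw [e1, e2, trace_eq_rank_of_isIdempotentElem (antisymOp_mul_self hbmw hR hg le_rfl), hrank,
    trace_eq_rank_of_isIdempotentElem (antisymOp_mul_self hbmw hR hg (show d ≤ d + m by omega)),
    trace_eq_rank_of_isIdempotentElem (antisymOp_mul_self hbmw hR hg (show m ≤ d + m by omega)),
    trace_eq_rank_of_isIdempotentElem (contractionOp_mul_self hbmw hR hg.eta_ne), sub_eq_iff_eq_add]
    at hn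
  have : (antisymOp R q μ m m).rank =
      n + (antisymOp R q μ d d).rank * (contractionOp R q μ).rank ^ m := by
    rw [Nat.cast_one, one_mul] at hn
    exact_mod_cast hn
  omega

theorem rank_contractionOp (hbmw : IsBMWType R q μ) (hR : IsUnit R) (hg : Generic q μ k)
    (hk : k ≠ 0) (hrank : (antisymOp R q μ k k).rank = 1)
    (hK : kappa q μ (siteOp 2 R 0) ≠ 0) : (contractionOp R q μ).rank = 1 := by
  have h0 : (contractionOp R q μ).rank ≠ 0 := by
    intro h
    have h1 := trace_eq_rank_of_isIdempotentElem (contractionOp_mul_self hbmw hR hg.eta_ne)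
    rw [h, Nat.cast_zero] at h1
    have h2 := eq_zero_of_isIdempotentElem_of_trace (contractionOp_mul_self hbmw hR hg.eta_ne) h1
    exact (smul_ne_zero (inv_ne_zero hg.eta_ne) hK) h2
  have h1 := rank_antisymOp_le hbmw hR hg hrank (zero_add k)
  -- For d = 0 the space V^{⊗0} is one-dimensional, so the inequality reads r^k ≤ 1 for the rank r
  -- of the contraction.
  rw [hrank, antisymOp_zero, Matrix.rank_one] at h1
  simp only [Fintype.card_pi, Finset.univ_eq_empty, Finset.prod_empty, one_mul] at h1
  by_contra h
  have : 1 < (contractionOp R q μ).rank ^ k := Nat.one_lt_pow hk (by omega)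
  omega

/-- With a contraction of rank one the rank inequality for (d, m) and for (m, d) gives equality, so
the complementary idempotent vanishes and PQP = cP. Together with QPQ = cQ and cyclicity, every
character satisfies τ(P) = η^{-2m} τ(Q). -/
theorem IsCharacter.reciprocal (hτ : IsCharacter R τ) (hbmw : IsBMWType R q μ) (hR : IsUnit R)
    (hg : Generic q μ k) (hrank : (antisymOp R q μ k k).rank = 1)
    (hrank' : (contractionOp R q μ).rank = 1) {d m : ℕ} (hk : d + m = k) :
    τ k (antisymOp R q μ k k) * τ m (antisymOp R q μ m m) =
      τ d (antisymOp R q μ d d) * τ 2 (contractionOp R q μ) ^ m := by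
  have hle := rank_antisymOp_le hbmw hR hg hrank hk
  have hle' := rank_antisymOp_le hbmw hR hg hrank ((add_comm m d).trans hk)
  rw [hrank', one_pow, mul_one] at hle hle'
  subst hk
  obtain ⟨i1, i2, c, hc, i3⟩ := pairOp_nestOp hbmw hR hg
  have hz : eta q μ ^ (2 * m) ≠ 0 := pow_ne_zero _ hg.eta_ne
  have hPQP : pairOp R q μ (d + m) m * nestOp R q μ d m * pairOp R q μ (d + m) m =
      c • pairOp R q μ (d + m) m := by
    refine (exists_nat_trace_sub hz hc i1 i2 i3).2 ?_
    have hτ := isCharacter_trace R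
    have e1 := hτ.apply_pairOp (q := q) (μ := μ) (d + m) m
    have e2 := hτ.smul_apply_nestOp hbmw hR hg.eta_ne d m
    simp only [Matrix.traceLinearMap_apply] at e1 e2
    rw [e1, e2, trace_eq_rank_of_isIdempotentElem (antisymOp_mul_self hbmw hR hg le_rfl), hrank,
      trace_eq_rank_of_isIdempotentElem (antisymOp_mul_self hbmw hR hg (show d ≤ d + m by omega)),
      trace_eq_rank_of_isIdempotentElem (antisymOp_mul_self hbmw hR hg (show m ≤ d + m by omega)),
      trace_eq_rank_of_isIdempotentElem (contractionOp_mul_self hbmw hR hg.eta_ne), hrank',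
      le_antisymm hle hle']
    simp
  have mP := pairOp_mem R q μ (d + m) m
  have mQ := nestOp_mem R q μ d m
  rw [← hτ.apply_pairOp, ← hτ.smul_apply_nestOp hbmw hR hg.eta_ne]
  set P := pairOp R q μ (d + m) m
  set Q := nestOp R q μ d m
  have h1 : c • τ (d + m + m) P = τ _ (Q * P) := by
    rw [← map_smul, ← hPQP, mul_assoc, hτ.mul_comm mP (mul_mem mQ mP), mul_assoc, i1]
  have h2 : c • τ (d + m + m) Q = eta q μ ^ (2 * m) • τ _ (Q * P) := by
    rw [← map_smul, ← i3, hτ.mul_comm (mul_mem mQ mP) mQ, ← mul_assoc, i2, smul_mul_assoc,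
      map_smul]
  rw [← h1, smul_comm] at h2
  rw [smul_right_injective _ hc h2, smul_smul, inv_mul_cancel₀ hz, one_smul]

/-- The chain of κ across i + 2 factors carries the contraction from the right end to the left end
while moving a^{(i)} by two factors. By cyclicity a character takes equal values on a^{(i)} ⊗ κ and
κ ⊗ a^{(i)}. -/
theorem IsCharacter.commute_contractionOp (hτ : IsCharacter R τ) (hbmw : IsBMWType R q μ)
    (hR : IsUnit R) (hη : eta q μ ≠ 0) (i : ℕ) :
    Commute (τ 2 (contractionOp R q μ)) (τ i (antisymOp R q μ i i)) := by
  set P := i + 2 with hP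
  have fam := bmwFamily_siteOp hbmw hR P
  have h1 : 0 + i ≤ P := by omega
  have h2 : 0 + 2 ≤ P := by omega
  have mk : ∀ j, j + 1 < P → kappa q μ (siteOp P R j) ∈ braidAlg R P :=
    fun j hj => kappa_siteOp_mem R q μ hj
  have ma := antisymOp_mem R q μ i
  have mκ : kappa q μ (siteOp 2 R 0) ∈ braidAlg R 2 := kappa_siteOp_mem R q μ (by omega)
  have e1 := hτ.place_mul_place h1 rfl ma mκ
  have e2 := hτ.place_mul_place h2 (add_comm 2 i) mκ ma
  have mU : upChain (fun i => kappa q μ (siteOp P R i)) 0 i ∈ braidAlg R P :=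
    upChain_mem fun j _ _ => mk j (by omega)
  have mD : downChain (fun i => kappa q μ (siteOp P R i)) 0 i ∈ braidAlg R P :=
    downChain_mem fun j _ _ => mk j (by omega)
  have m1 := place_mem_braidAlg h1 ma
  have m2 := place_mem_braidAlg (show 2 + i ≤ P by omega) ma
  have hDU := fam.downChain_mul_upChain (c := 0) (m := i) (by omega)
  have hUD := fam.upChain_mul_downChain (c := 0) (m := i) (by omega)
  have hs : upChain (fun i => kappa q μ (siteOp P R i)) 0 i *
      place (offsetEmb h1) (antisymOp R q μ i i) =
      place (offsetEmb (show 2 + i ≤ P by omega)) (antisymOp R q μ i i) *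
        upChain (fun i => kappa q μ (siteOp P R i)) 0 i := by
    rw [place_antisymOp, place_antisymOp]
    refine mul_antisymmetrizer_of_intertwine i fun j hj => ?_
    rw [zero_add, add_comm 2 j]
    exact fam.s_mul_upChain hη (by omega) (Nat.zero_le j) (by omega)
  rw [← kappa_siteOp_eq_place (P := P) (i := i) le_rfl] at e1
  rw [← kappa_siteOp_eq_place (P := P) (i := 0) h2] at e2
  set U := upChain (fun i => kappa q μ (siteOp P R i)) 0 i
  set D := downChain (fun i => kappa q μ (siteOp P R i)) 0 i
  set a := place (offsetEmb h1) (antisymOp R q μ i i)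
  set b := place (offsetEmb (show 2 + i ≤ P by omega)) (antisymOp R q μ i i)
  have h3 : eta q μ • (τ i (antisymOp R q μ i i) * τ 2 (kappa q μ (siteOp 2 R 0))) =
      eta q μ • (τ 2 (kappa q μ (siteOp 2 R 0)) * τ i (antisymOp R q μ i i)) := by
    rw [zero_add] at hDU
    rw [← e1, ← e2, ← map_smul, ← map_smul, ← mul_smul_comm, ← hDU, ← smul_mul_assoc, ← hUD,
      ← hτ.mul_comm (mul_mem mD mU) m1, mul_assoc, mul_assoc, hs, ← hτ.mul_comm (mul_mem mD m2) mU,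
      mul_assoc]
  have h4 := smul_right_injective _ hη h3
  rw [contractionOp, map_smul]
  exact Commute.smul_left h4.symm _

end Characters

/-! ## Reciprocal relations in the extended algebra -/

theorem IsOrthogonalType.generic {N : ℕ} {R : TwoOp N} {q μ : ℂ} {k : ℕ}
    (h : IsOrthogonalType R q μ k) : Generic q μ k := by
  have hh := h.height
  have hq := hh.q_ne_zero
  have hk := hh.two_le
  have hl : q - q⁻¹ ≠ 0 := by
    intro h0
    refine hh.q_pow_ne_one 1 (Finset.mem_Icc.mpr ⟨le_rfl, by omega⟩) ?_
    field_simp at h0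
    linear_combination h0
  -- The condition μ ≠ -q^{1-2i} with denominators cleared.
  have hneg : ∀ i, 1 ≤ i → i ≤ k → q ^ (2 * i) * μ + q ≠ 0 := by
    intro i h1 h2 h0
    refine hh.μ_ne_neg i (Finset.mem_Icc.mpr ⟨h1, h2⟩) ?_
    have : q ^ (-2 * (i : ℤ) + 1) = (q ^ (2 * i))⁻¹ * q := by
      rw [zpow_add₀ hq, zpow_one, ← zpow_natCast, ← zpow_neg]
      congr 2
    rw [this]
    field_simp
    linear_combination h0
  refine ⟨hq, hh.μ_ne_zero, hl, ?_, fun j h1 h2 => ?_, fun j h1 h2 => ?_, fun j h1 h2 => ?_,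
    fun j h1 h2 => ?_⟩
  · refine div_ne_zero (mul_ne_zero (sub_ne_zero.mpr (Ne.symm hh.μ_ne_q)) fun h0 => ?_)
      (mul_ne_zero hh.μ_ne_zero hl)
    refine hneg 1 le_rfl (by omega) ?_
    field_simp at h0
    linear_combination q * h0
  · refine div_ne_zero (fun h0 => hh.q_pow_ne_one j (Finset.mem_Icc.mpr ⟨h1, h2⟩) ?_) hl
    rw [inv_pow] at h0
    field_simp at h0
    rw [mul_comm 2 j, pow_mul]
    linear_combination h0
  · intro h0
    refine hneg j h1 h2 ?_
    rw [inv_pow] at h0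
    field_simp at h0
    linear_combination h0
  -- The excluded value is μ = -q^{1-2(j+1)}; the shift to j + 1 is the reason for requiring j < k.
  · intro h0
    refine hneg (j + 1) (by omega) (by omega) ?_
    rw [inv_pow] at h0
    field_simp at h0
    rw [mul_add, pow_add]
    linear_combination q * h0
  -- Here μ = q^{1-k} enters: the excluded equality would give q^{2(k-j)} = 1.
  · intro h0
    refine hh.q_pow_ne_one (k - j) (Finset.mem_Icc.mpr ⟨by omega, by omega⟩) ?_
    have h3 : μ * q ^ k = q := by
      rw [h.μ_eq, ← zpow_natCast q k, ← zpow_add₀ hq]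
      simp
    have h4 : q ^ (2 * k) = q ^ (2 * (k - j)) * q ^ (2 * j) := by
      rw [← pow_add]
      congr 1
      omega
    have h5 : μ ^ 2 * q ^ (2 * k) = q ^ 2 := by
      rw [mul_comm 2 k, pow_mul, ← mul_pow, h3]
    rw [inv_pow] at h0
    have h6 : q ^ 2 = μ ^ 2 * q ^ (2 * j) := by
      field_simp at h0
      linear_combination h0
    have h7 : μ ^ 2 * q ^ (2 * j) ≠ 0 :=
      mul_ne_zero (pow_ne_zero _ hh.μ_ne_zero) (pow_ne_zero _ hq)
    rw [h4, h6] at h5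
    refine mul_left_cancel₀ h7 ?_
    linear_combination h5

/-! ### Compatibility of the constructions with algebra homomorphisms. -/

section Naturality

variable {N : ℕ} {A B : Type*} [Ring A] [Algebra ℂ A] [Ring B] [Algebra ℂ B]

theorem numMat_map (f : A →ₐ[ℂ] B) {n : ℕ} (X : TensorMat N n ℂ) :
    (numMat A X).map f = numMat B X := by
  ext a b
  simp [numMat]

theorem firstCopy_map (f : A →ₐ[ℂ] B) {n : ℕ} (M : Matrix (Fin N) (Fin N) A) :
    firstCopy n (M.map f) = (firstCopy n M).map f := by
  unfold firstCopy
  split_ifs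
  · ext a b
    simp only [Matrix.of_apply, Matrix.map_apply]
    split_ifs <;> simp
  · exact (Matrix.map_one f (map_zero f) (map_one f)).symm

theorem matCopy_map (f : A →ₐ[ℂ] B) (F : TwoOp N) {n : ℕ} (M : Matrix (Fin N) (Fin N) A) (i : ℕ) :
    matCopy F n (M.map f) i = (matCopy F n M i).map f := by
  induction i with
  | zero => exact firstCopy_map f M
  | succ i ih => rw [matCopy, matCopy, ih, Matrix.map_mul, Matrix.map_mul, numMat_map, numMat_map]

theorem matString_map (f : A →ₐ[ℂ] B) (F : TwoOp N) (n : ℕ) (M : Matrix (Fin N) (Fin N) A) :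
    matString F n (M.map f) = (matString F n M).map f := by
  have : ∀ m, copySeg F n (M.map f) 0 m = (copySeg F n M 0 m).map f := by
    intro m
    induction m with
    | zero => exact (Matrix.map_one f (map_zero f) (map_one f)).symm
    | succ m ih => rw [copySeg, copySeg, ih, Matrix.map_mul, matCopy_map]
  rw [matString_eq_copySeg, matString_eq_copySeg, this]

theorem contraction_map (f : A →ₐ[ℂ] B) (R F : TwoOp N) (q μ : ℂ) (M : Matrix (Fin N) (Fin N) A) :
    contraction R F q μ (M.map f) = f (contraction R F q μ M) := by
  rw [contraction, contraction, matString_map, ← numMat_map f, ← Matrix.map_mul, map_smul,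
    AddMonoidHom.map_trace]

end Naturality

section Extended

variable {N : ℕ} (R F : TwoOp N) (q μ : ℂ)

theorem isQuantumMatrix_quantumMatrix : IsQuantumMatrix R F (quantumMatrix R F q μ) := by
  set f := RingQuot.mkAlgHom ℂ (ExtRel R F q μ)
  have h : ∀ a b, f ((numMat (ExtFree N) (siteOp 2 R 0) * matString F 2 (freeM N)) a b) =
      f ((matString F 2 (freeM N) * numMat (ExtFree N) (siteOp 2 R 0)) a b) :=
    fun a b => RingQuot.mkAlgHom_rel ℂ (ExtRel.qma a b)
  rw [IsQuantumMatrix, quantumMatrix, matString_map, ← numMat_map f, Commute, SemiconjBy,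
    ← Matrix.map_mul, ← Matrix.map_mul]
  ext a b
  exact h a b

theorem gInv_mul_g : gInv R F q μ * g R F q μ = 1 := by
  rw [gInv, g, quantumMatrix, contraction_map, ← map_mul,
    RingQuot.mkAlgHom_rel ℂ ExtRel.inv_mul, map_one]

theorem g_mul_gInv : g R F q μ * gInv R F q μ = 1 := by
  rw [gInv, g, quantumMatrix, contraction_map, ← map_mul,
    RingQuot.mkAlgHom_rel ℂ ExtRel.mul_inv, map_one]

/-- If κ vanishes, so does g, although it is invertible; every identity in the algebra is then
trivial. This settles the case in which the contraction operator cannot have rank one. -/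
theorem subsingleton_of_kappa_eq_zero (hK : kappa q μ (siteOp 2 R 0) = 0) :
    Subsingleton (ExtAlgebra R F q μ) := by
  have hg : g R F q μ = 0 := by
    rw [g, contraction, hK, smul_zero, ← numMatHom_apply, map_zero, mul_zero, Matrix.trace_zero,
      smul_zero]
  exact subsingleton_of_zero_eq_one (by rw [← gInv_mul_g, hg, mul_zero])

variable {R F q μ} {k : ℕ}

/-- The products `e_k e_m` and the commutativity of `g` with the elementary sums. -/
theorem e_mul_e (hRF : IsCompatiblePair R F) (hR : IsOrthogonalType R q μ k) :
    e R F q μ 0 = 1 ∧ (∀ i, Commute (g R F q μ) (e R F q μ i)) ∧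
      ∀ d m, d + m = k → e R F q μ k * e R F q μ m = e R F q μ d * g R F q μ ^ m := by
  by_cases hK : kappa q μ (siteOp 2 R 0) = 0
  · have := subsingleton_of_kappa_eq_zero R F q μ hK
    exact ⟨Subsingleton.elim _ _, fun _ => Subsingleton.elim _ _, fun _ _ _ => Subsingleton.elim _ _⟩
  have hk := hR.height.two_le
  -- On the zero space no operator on V^{⊗k} with k ≥ 2 can have rank one.
  have : NeZero N := ⟨by
    rintro rfl
    have : IsEmpty (Fin k → Fin 0) := ⟨fun f => (f ⟨0, by omega⟩).elim0⟩
    have h0 := Matrix.rank_le_card_width (antisymOp R q μ k k)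
    rw [hR.rank_one, Fintype.card_eq_zero] at h0
    omega⟩
  have hg := hR.generic
  have hbmw := hR.height.bmw
  have hYB := hRF.yangBaxter_R
  have hrank := rank_contractionOp hbmw hYB.1 hg (by omega) hR.rank_one hK
  have hτ := isCharacter_charElem hRF (isQuantumMatrix_quantumMatrix R F q μ)
  have he : ∀ i, e R F q μ i = charElem R F (quantumMatrix R F q μ) i (antisymOp R q μ i i) := by
    intro i
    cases i with
    | zero => exact hτ.one.symm
    | succ i => rfl
  have hgg : g R F q μ = charElem R F (quantumMatrix R F q μ) 2 (contractionOp R q μ) :=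
    contraction_eq_charElem hRF.strict_R.1 hYB hbmw hg.eta_ne hK hrank
  refine ⟨rfl, fun i => ?_, fun d m hdm => ?_⟩
  · rw [he, hgg]
    exact hτ.commute_contractionOp hbmw hYB.1 hg.eta_ne i
  · rw [he, he, he, hgg]
    exact hτ.reciprocal hbmw hYB.1 hg hR.rank_one hrank hdm

end Extended

/-! ### Solving the reciprocal relations in an abstract ring. -/

section Resolution

variable {B : Type*} [Ring B] {g g' : B} {e : ℕ → B}

theorem reciprocal_of_mul {k : ℕ} (hc : ∀ i, Commute g (e i))
    (hm : ∀ d m, d + m = k → e k * e m = e d * g ^ m) {i : ℕ} (hi : i ≤ k) :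
    g ^ (k - i) * e i = e k * e (k - i) := by
  rw [hm i (k - i) (by omega), ((hc i).pow_left _).eq]

/-- The sign relation means e_{2l} = ε g^l. The product relation for d = l + i, m = l - i becomes ε
g^l e_{l-i} = g^{l-i} e_{l+i}, and g^{l-i} is cancelled. -/
theorem resolve_even {l : ℕ} (h1 : g' * g = 1) (h2 : g * g' = 1) (hc : ∀ i, Commute g (e i))
    (hm : ∀ d m, d + m = 2 * l → e (2 * l) * e m = e d * g ^ m) {ε : ℤ}
    (hε : g' ^ l * e (2 * l) = ε) {i : ℕ} (hi : i ≤ l) :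
    e (l + i) = ε • (g ^ i * e (l - i)) := by
  have hgg : Commute g' g := h1.trans h2.symm
  have hk : e (2 * l) = ε • g ^ l := by
    calc e (2 * l) = (g * g') ^ l * e (2 * l) := by rw [h2, one_pow, one_mul]
      _ = ε • g ^ l := by
        rw [hgg.symm.mul_pow, mul_assoc, hε, zsmul_eq_mul, Int.cast_comm]
  have h3 := hm (l + i) (l - i) (by omega)
  rw [hk, ← ((hc _).pow_left _).eq] at h3
  calc e (l + i) = (g' * g) ^ (l - i) * e (l + i) := by rw [h1, one_pow, one_mul]
    _ = g' ^ (l - i) * (ε • g ^ l * e (l - i)) := by rw [hgg.mul_pow, mul_assoc, h3]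
    _ = ε • ((g' * g) ^ (l - i) * (g ^ i * e (l - i))) := by
      rw [hgg.mul_pow, smul_mul_assoc, mul_smul_comm, mul_assoc, ← mul_assoc (g ^ _), ← pow_add,
        show l - i + i = l by omega]
    _ = _ := by rw [h1, one_pow, one_mul]

/-- For d = 0 the product relation is e_k² = g^k. As k = 2l - 1 is odd and e_k commutes with g,
dividing e_k by g^{l-1} produces a square root h of g with e_k = h^k, so no choice of sign remains.
The other relations follow by cancelling g^{l-1-i}. -/
theorem resolve_odd {l : ℕ} (hl : 1 ≤ l) (h1 : g' * g = 1) (h2 : g * g' = 1) (h0 : e 0 = 1)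
    (hc : ∀ i, Commute g (e i))
    (hm : ∀ d m, d + m = 2 * l - 1 → e (2 * l - 1) * e m = e d * g ^ m) {h : B}
    (hh : h = g' ^ (l - 1) * e (2 * l - 1)) :
    h ^ 2 = g ∧ e (2 * l - 1) = h ^ (2 * l - 1) ∧
      ∀ i < l, e (l + i) = h ^ (2 * i + 1) * e (l - 1 - i) := by
  have hgg : Commute g' g := h1.trans h2.symm
  have hge : ∀ i, Commute g' (e i) := fun i => by
    calc g' * e i = g' * (e i * g) * g' := by rw [mul_assoc, mul_assoc, h2, mul_one]
      _ = e i * g' := by rw [← (hc i).eq, ← mul_assoc, h1, one_mul]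
  have hsq : h ^ 2 = g := by
    have h3 := hm 0 (2 * l - 1) (by omega)
    rw [h0, one_mul] at h3
    rw [hh, ((hge _).pow_left _).mul_pow, sq (e _), h3, ← pow_mul,
      show 2 * l - 1 = (l - 1) * 2 + 1 by omega, pow_succ, ← mul_assoc, ← hgg.mul_pow, h1,
      one_pow, one_mul]
  have hk : e (2 * l - 1) = h ^ (2 * l - 1) := by
    rw [show 2 * l - 1 = 2 * (l - 1) + 1 by omega, pow_succ, pow_mul, hsq, hh, ← mul_assoc,
      ← hgg.symm.mul_pow, h2, one_pow, one_mul]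
    congr 1
    omega
  refine ⟨hsq, hk, fun i hi => ?_⟩
  have h3 := hm (l + i) (l - 1 - i) (by omega)
  rw [hk, ← ((hc _).pow_left _).eq] at h3
  calc e (l + i) = (g' * g) ^ (l - 1 - i) * e (l + i) := by rw [h1, one_pow, one_mul]
    _ = g' ^ (l - 1 - i) * (h ^ (2 * l - 1) * e (l - 1 - i)) := by rw [hgg.mul_pow, mul_assoc, h3]
    _ = (g' * g) ^ (l - 1 - i) * (h ^ (2 * i + 1) * e (l - 1 - i)) := by
      rw [hgg.mul_pow, mul_assoc, ← mul_assoc (g ^ _), ← hsq, ← pow_mul, ← pow_add,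
        show 2 * (l - 1 - i) + (2 * i + 1) = 2 * l - 1 by omega]
    _ = _ := by rw [h1, one_pow, one_mul]

end Resolution

end QMA

end

/-! ### The resolution theorem. -/

theorem mainTheorem2 {N : ℕ} (R F : QMA.TwoOp N) (q μ : ℂ) (k : ℕ)
    (hRF : QMA.IsCompatiblePair R F) (hR : QMA.IsOrthogonalType R q μ k) :
    (∀ ℓ : ℕ, k = 2 * ℓ →
      QMA.signElement R F q μ ℓ ∈ Subalgebra.center ℂ (QMA.ExtAlgebra R F q μ) →
        (∀ ε : ℤˣ,
          (∀ i < 2 * ℓ,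
            QMA.toComponent R F q μ ℓ ε (QMA.g R F q μ) ^ (2 * ℓ - i) *
                QMA.toComponent R F q μ ℓ ε (QMA.e R F q μ i) =
              QMA.toComponent R F q μ ℓ ε (QMA.e R F q μ (2 * ℓ)) *
                QMA.toComponent R F q μ ℓ ε (QMA.e R F q μ (2 * ℓ - i))) ∧
          (∀ i ≤ ℓ,
            QMA.toComponent R F q μ ℓ ε (QMA.e R F q μ (ℓ + i)) =
              (ε : ℤ) • (QMA.toComponent R F q μ ℓ ε (QMA.g R F q μ) ^ i *
                QMA.toComponent R F q μ ℓ ε (QMA.e R F q μ (ℓ - i))))) ∧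
        QMA.toComponent R F q μ ℓ (-1) (QMA.e R F q μ ℓ) = 0) ∧
    (∀ ℓ : ℕ, k + 1 = 2 * ℓ →
      (∀ i < 2 * ℓ - 1,
        QMA.g R F q μ ^ (2 * ℓ - 1 - i) * QMA.e R F q μ i =
          QMA.e R F q μ (2 * ℓ - 1) * QMA.e R F q μ (2 * ℓ - 1 - i)) ∧
      QMA.gHalf R F q μ ℓ ^ 2 = QMA.g R F q μ ∧
      QMA.e R F q μ (2 * ℓ - 1) = QMA.gHalf R F q μ ℓ ^ (2 * ℓ - 1) ∧
      ∀ i < ℓ,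
        QMA.e R F q μ (ℓ + i) =
          QMA.gHalf R F q μ ℓ ^ (2 * i + 1) * QMA.e R F q μ (ℓ - 1 - i)) := by
  obtain ⟨h0, hc, hm⟩ := QMA.e_mul_e hRF hR
  have h1 := QMA.gInv_mul_g R F q μ
  have h2 := QMA.g_mul_gInv R F q μ
  refine ⟨fun ℓ hk _ => ?_, fun ℓ hk => ?_⟩
  · subst hk
    have key : ∀ ε : ℤˣ, ∀ i ≤ ℓ,
        QMA.toComponent R F q μ ℓ ε (QMA.e R F q μ (ℓ + i)) =
          (ε : ℤ) • (QMA.toComponent R F q μ ℓ ε (QMA.g R F q μ) ^ i *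
            QMA.toComponent R F q μ ℓ ε (QMA.e R F q μ (ℓ - i))) := by
      intro ε i hi
      set f := QMA.toComponent R F q μ ℓ ε
      refine QMA.resolve_even (g' := f (QMA.gInv R F q μ)) (e := fun i => f (QMA.e R F q μ i))
        (by rw [← map_mul, h1, map_one]) (by rw [← map_mul, h2, map_one])
        (fun i => (hc i).map f) (fun d m hdm => ?_) ?_ hi
      · rw [← map_mul, hm d m hdm, map_mul, map_pow]
      · have := RingQuot.mkAlgHom_rel ℂ (QMA.ComponentRel.sign (R := R) (F := F) (q := q) (μ := μ)
          (ℓ := ℓ) (ε := ε))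
        change f (QMA.signElement R F q μ ℓ) = f _ at this
        rw [QMA.signElement, map_mul, map_pow, map_intCast] at this
        exact this
    refine ⟨fun ε => ⟨fun i hi => ?_, key ε⟩, ?_⟩
    · rw [← map_pow, ← map_mul, ← map_mul, QMA.reciprocal_of_mul hc hm hi.le]
    -- For i = 0 and sign -1 the resolution reads e_ℓ = -e_ℓ, and 2 is invertible in ℂ.
    · have h3 := key (-1) 0 (Nat.zero_le _)
      rw [add_zero, pow_zero, one_mul, Nat.sub_zero, Units.val_neg, Units.val_one, neg_one_zsmul] at h3
      have h4 : (2 : ℂ) • QMA.toComponent R F q μ ℓ (-1) (QMA.e R F q μ ℓ) = 0 := by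
        rw [two_smul]
        exact eq_neg_iff_add_eq_zero.mp h3
      exact (smul_eq_zero_iff_right two_ne_zero).mp h4
  · obtain rfl : k = 2 * ℓ - 1 := by omega
    exact ⟨fun i hi => QMA.reciprocal_of_mul hc hm hi.le,
      QMA.resolve_odd (by omega) h1 h2 h0 hc hm rfl⟩
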